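/- **The algorithm.** The Citrus tree is a concurrent internal binary search tree implementing a map from $\mathbb N$ to $\mathbb N$. Nodes have fields `key, data, left, right, tag, rem` and a lock; the root has key $-1$ and its right child is a sentinel with key $\infty$. Any number of threads run the following operations, interleaved under sequential consistency. `locate(k)`, under the RCU read lock, searches from the root by binary search and returns the last link $(x,y)$ and the tag of $x$ (read just before the RCU lock is released). `contains(k)` returns the data of $y$, or false if $y$ is null. `insert(k,d)` returns false if $y\neq$ null; otherwise it locks $x$, restarts if $x$ is marked (`rem`), and links a new node as the left child if $k<x.key$, $x.left=$ null and $x.tag$ is unchanged, or as the right child if $k>x.key$ and $x.right=$ null (otherwise it restarts). `delete(k)` returns false if $y=$ null; otherwise it locks $x,y$ and restarts unless both are unmarked and $y$ is a child of $x$. If $y$ has a null child, it marks $y$ and makes $x$ point to the other child (incrementing $x.tag$ if $x.left$ becomes null). Otherwise it walks to the leftmost node $cs$ of the right subtree of $y$ and its predecessor $ps$ on the walk, locks both, validates them (both unmarked, $ps=y$ or $ps.left=cs$, $cs.left=$ null; otherwise restart), makes a copy $w$ of $y$ with the key and data of $cs$, marks $y$, locks $w$, makes $x$ point to $w$, calls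 `synchronize_rcu` (which waits for all RCU read sections in progress), marks $cs$, and unlinks it by $w.right\leftarrow cs.right$ if $ps=y$, and by $ps.left\leftarrow cs.right$ otherwise (incrementing $ps.tag$ if $ps.left$ becomes null). Locks are released on return and on restart. **Reachability.** The standard search step for $k$ goes from $(o,key)$ to $(o,right)$ if $o.key<k$, to $(o,left)$ if $k<o.key$, and from $(o,left)$, $(o,right)$ to $(o',key)$ where $o'$ is the node (or null) stored there. A location is *standardly $k$-reachable* if there is a path of such steps to it from $(root,key)$. Each traversal (invocation of `locate`) has its own ghost field $\overline{key}$ of every node: it equals $key$ when the traversal starts and when a node is allocated; making $x$ point to $w$ in a deletion of $k$ with two children sets $w.\overline{key}$ to $k$, and the final unlinking write of that deletion sets $w.\overline{key}$ to $w.key$, in both cases for all the traversals in progress. *Weak $k$-reachability* for a traversal is defined by paths that use the same pointer steps and, from $(o,key)$ with $m=o.key$, $\bar m=o.\overline{key}$, the *weak links* to $(o,right)$ if $(k>\bar m\wedge k\ne m)\vee(k=m\wedge\bar m\neq m)$ and to $(o,left)$ if $k<m$. A traversal that reads $\ell_1,\dots,\ell_n$ at times $t_1,\dots,t_n$ and reaches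 $\ell_{n+1}$ is *correct* w.r.t. a reachability predicate and a base time $t_\star\le t_1$ if $\ell_1$ is reachable at $t_\star$ and each $\ell_{i+1}$ is reachable at some time in $[t_\star,t_i]$. A write satisfies *strong forepassed* if every location whose reachability it reduces is written neither by it nor later in the timespan under consideration. **Theorem.** 1. There are an execution and a traversal by `locate(k)` in it that is not correct w.r.t. standard $k$-reachability, whatever the base time $t_\star\le t_1$ is. In every execution, the following hold. 2. During each traversal (from acquiring to releasing the RCU read lock) and for each $k\in\mathbb N$: standard implies weak $k$-reachability; weak $k$-reachability is single-step compatible with the standard search step (a location that is one standard search step for $k$ from a weakly $k$-reachable one is weakly $k$-reachable); every write satisfies strong forepassed w.r.t. weak $k$-reachability; and after a write that reduces the weak $k$-reachability of a node $x$, the field $x.tag$ is not written during the traversal (nor is it by that write). 3. Every traversal by `locate(k)` follows the standard search steps for $k$ and is correct w.r.t. weak $k$-reachability and any base time $t_\star\le t_1$ after it acquired the RCU read lock. 4. During each traversal: (a) if $x.\overline{key}\ne x.key$, then no key in the open interval $(x.\overline{key},x.key)$ occurs in the *right* subtree of $x$, and there is a node $y\ne x$ with $y.key=x.key$ on the standard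 search path for $x.key$ from $(x,right)$; (b) if $(x,key)$ is weakly $k$-reachable, where $x$ is a node other than the root or null, then there are $\ell,\ell'$ such that $\ell$ is standardly $k$-reachable, $(\ell,\ell')$ is a weak link, and there is a standard $k$-search path from $\ell'$ to $(x,key)$. 5. If $x$ is null or a node with key $k$ and $(x,key)$ is weakly $k$-reachable at some time of a traversal, then it was standardly $k$-reachable at that time or earlier during this traversal. When an invocation of `locate(k)` has returned $(x,tag,y)$, then $x.key\ne k$, and $y$ is null or has key $k$; during its traversal, at some time $x$ was weakly $k$-reachable and had the tag $tag$, and at some time $y$ was weakly $k$-reachable; and at some time since the invocation of the operation, $y$ was standardly $k$-reachable. 6. If a node $x$ was weakly $k$-reachable with $x.tag=v$ at some time of a traversal, and now or later $x.left=$ null, $x.tag=v$, and $x$ is unmarked and unlocked, then $x$ is standardly $k$-reachable at this later time. If $(x,right)$ was weakly $k$-reachable at some time of a traversal, and now or later $x.key<k$ and $x$ is unmarked and unlocked, then $(x,right)$ is standardly $k$-reachable then. If a node $x$ with $x.key=k$ was weakly $k$-reachable at some time of a traversal, and now or later $x$ is unmarked and unlocked, then it is standardly $k$-reachable then. Consequently,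 whenever `insert(k,d)` is about to link a node as the left (right) child of $x$, $x$ is standardly $k$-reachable, $k<x.key$ and $x.left=$ null ($k>x.key$ and $x.right=$ null); and whenever `delete(k)` has validated $x$ and $y$, both are standardly $k$-reachable. 7. The history of every finite prefix of the execution is linearizable (in the sense of Herlihy and Wing) with respect to the sequential map in which `insert(k,d)` adds $k\mapsto d$ and returns true if $k$ is absent and otherwise returns false, `delete(k)` removes $k$ and returns true if $k$ is present and otherwise returns false, and `contains(k)` returns the data of $k$, or false if $k$ is absent; moreover, there is a linearization whose final map consists of the key-data pairs of the nodes that are, at the end of the prefix, standardly reachable for their own key. -/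

import Mathlib

namespace Citrus

/-! ### Memory -/

/-- Node keys: integers together with the sentinel key `∞ = ⊤`. The root has key `-1`. -/
abbrev Key := WithTop ℤ

/-- The keys stored in the map are natural numbers. -/
def userKey (k : ℕ) : Key := ((k : ℤ) : WithTop ℤ)

abbrev Tid := ℕ

/-- Node identifiers are natural numbers; `none` is the null pointer. -/
abbrev Ptr := Option ℕ

structure Node where
  key : Key
  data : ℕ
  left : Ptr
  right : Ptr
  tag : ℕ
  rem : Bool

inductive Field
  | key | data | left | right | tag | rem

/-- A memory location: an object (possibly null) and a field name. -/
structure Loc where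
  obj : Ptr
  fld : Field

/-- Contents of memory locations. `ref o` is the pointer to `(o, key)`; `undef` is the content of
the locations of the null object. -/
inductive Val
  | key (m : Key)
  | data (d : ℕ)
  | ref (o : Ptr)
  | tag (v : ℕ)
  | rem (b : Bool)
  | undef

abbrev Heap := ℕ → Node

/-- The value `σ(ℓ)` of location `ℓ` in the heap `σ`. -/
def Heap.val (h : Heap) : Loc → Val
  | ⟨none, _⟩ => .undef
  | ⟨some o, .key⟩ => .key (h o).key
  | ⟨some o, .data⟩ => .data (h o).data
  | ⟨some o, .left⟩ => .ref (h o).left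
  | ⟨some o, .right⟩ => .ref (h o).right
  | ⟨some o, .tag⟩ => .tag (h o).tag
  | ⟨some o, .rem⟩ => .rem (h o).rem

def Node.set (n : Node) : Field → Val → Node
  | .key, .key m => { n with key := m }
  | .data, .data d => { n with data := d }
  | .left, .ref o => { n with left := o }
  | .right, .ref o => { n with right := o }
  | .tag, .tag v => { n with tag := v }
  | .rem, .rem b => { n with rem := b }
  | _, _ => n

/-- The heap after the write of `v` to `ℓ`. -/
def Heap.write (h : Heap) (l : Loc) (v : Val) : Heap :=
  match l.obj with
  | none => h
  | some o => Function.update h o ((h o).set l.fld v)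

def rootId : ℕ := 0

def rootLoc : Loc := ⟨some rootId, .key⟩

/-! ### Operations and the sequential map -/

inductive Op
  | insert (k d : ℕ)
  | delete (k : ℕ)
  | contains (k : ℕ)

def Op.key : Op → ℕ
  | .insert k _ => k
  | .delete k => k
  | .contains k => k

inductive Res
  | bool (b : Bool)
  | data (d : ℕ)

/-- One operation of the sequential key-value map. -/
def specStep (m : ℕ → Option ℕ) : Op → Res × (ℕ → Option ℕ)
  | .insert k d =>
    match m k with
    | none => (.bool true, Function.update m k (some d))
    | some _ => (.bool false, m)
  | .delete k =>
    match m k with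
    | none => (.bool false, m)
    | some _ => (.bool true, Function.update m k none)
  | .contains k =>
    match m k with
    | none => (.bool false, m)
    | some d => (.data d, m)

/-- Running the listed operations sequentially from `m` gives the listed results and ends in `m'`. -/
def Legal : (ℕ → Option ℕ) → List (Op × Res) → (ℕ → Option ℕ) → Prop
  | m, [], m' => m' = m
  | m, (op, r) :: l, m' => (specStep m op).1 = r ∧ Legal (specStep m op).2 l m'

/-! ### Shared state and atomic actions -/

structure Shared where
  heap : Heap
  /-- identifiers `≥ next` are not allocated yet -/
  next : ℕ
  lock : ℕ → Option Tid
  /-- `reader i`: thread `i` holds the RCU lock -/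
  reader : Tid → Bool
  /-- the threads that thread `i`, blocked in `synchronize_rcu`, still waits for -/
  waiting : Tid → Set Tid
  /-- `ghost i o`: the ghost key of node `o` in the instance that belongs to the traversal of
  thread `i`; it is meaningful while thread `i` holds the RCU lock -/
  ghost : Tid → ℕ → Key

/-- Ghost code executed atomically with a write. -/
inductive GhostCmd
  | skip
  /-- set the ghost key of `w` to `k` -/
  | open (w : ℕ) (k : Key)
  /-- set the ghost key of `w` to its key -/
  | collapse (w : ℕ)

/-- Ghost code changes the instances of all the traversals that are in progress. -/
def GhostCmd.run (s : Shared) : GhostCmd → Tid → ℕ → Key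
  | .skip => s.ghost
  | .open w k => fun j => if s.reader j then Function.update (s.ghost j) w k else s.ghost j
  | .collapse w => fun j =>
      if s.reader j then Function.update (s.ghost j) w (s.heap w).key else s.ghost j

/-- Atomic actions. -/
inductive Act
  | invoke (op : Op)
  | respond (r : Res)
  | tau
  | read (l : Loc)
  | write (l : Loc) (v : Val) (g : GhostCmd)
  /-- allocation of the node `o`, with initial fields `n` (no other thread has a pointer to it) -/
  | alloc (o : ℕ) (n : Node)
  | lock (o : ℕ)
  | unlock (o : ℕ)
  | rcuLock
  | rcuUnlock
  /-- `synchronize_rcu` is called -/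
  | syncCall
  /-- `synchronize_rcu` returns -/
  | syncReturn

/-- Effect of an action of thread `i`. -/
def applyAct (i : Tid) (s : Shared) : Act → Shared
  | .write l v g => { s with heap := s.heap.write l v, ghost := g.run s }
  | .alloc o n =>
    { s with
      heap := Function.update s.heap o n
      next := s.next + 1
      ghost := fun j => Function.update (s.ghost j) o n.key }
  | .lock o => { s with lock := Function.update s.lock o (some i) }
  | .unlock o => { s with lock := Function.update s.lock o none }
  | .rcuLock =>
    { s with
      reader := Function.update s.reader i true
      ghost := Function.update s.ghost i (fun o => (s.heap o).key) }
  | .rcuUnlock =>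
    { s with
      reader := Function.update s.reader i false
      waiting := fun j => s.waiting j \ {i} }
  | .syncCall =>
    { s with waiting := Function.update s.waiting i {j | s.reader j = true} }
  | _ => s

/-! ### The algorithm -/

/-- Control points of a thread, with the values of its local variables. -/
inductive PC
  | idle
  -- locate
  | locStart (op : Op)
  | locTest (op : Op) (x : ℕ) (y : Ptr)
  | locRight (op : Op) (x : ℕ)
  | locLeft (op : Op) (x : ℕ)
  | locTag (op : Op) (x : ℕ) (y : Ptr)
  | locUnlock (op : Op) (x tag : ℕ) (y : Ptr)
  | located (op : Op) (x tag : ℕ) (y : Ptr)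
  -- contains
  | conData (y : ℕ)
  -- insert
  | insLock (k d x tag : ℕ)
  | insRem (k d x tag : ℕ)
  | insKey (k d x tag : ℕ)
  | insLeft (k d x tag : ℕ)
  | insTag (k d x tag : ℕ)
  | insNewLeft (k d x : ℕ)
  | insWriteLeft (k d x n : ℕ)
  | insRight (k d x : ℕ)
  | insNewRight (k d x : ℕ)
  | insWriteRight (k d x n : ℕ)
  -- delete: locking and validation
  | delLockX (k x y : ℕ)
  | delLockY (k x y : ℕ)
  | delRemY (k x y : ℕ)
  | delRemX (k x y : ℕ)
  | delParLeft (k x y : ℕ)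
  | delParRight (k x y : ℕ)
  | delLeft (k x y : ℕ)
  | delRight (k x y : ℕ) (l : Ptr)
  -- delete: a node with a null child
  | bypMark (k x y : ℕ) (c : Ptr)
  | bypCmp (k x y : ℕ) (c : Ptr)
  | bypLeft (k x y : ℕ) (c : Ptr)
  | bypRight (k x y : ℕ) (c : Ptr)
  | tagRead (k x : ℕ)
  | tagWrite (k x v : ℕ)
  -- delete: search for the successor
  | sucRight (k x y : ℕ)
  | sucLeft (k x y ps cs : ℕ)
  | sucLockPs (k x y ps cs : ℕ)
  | sucLockCs (k x y ps cs : ℕ)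
  | sucRemPs (k x y ps cs : ℕ)
  | sucRemCs (k x y ps cs : ℕ)
  | sucPar (k x y ps cs : ℕ)
  | sucNull (k x y ps cs : ℕ)
  -- delete: a node with two children
  | dupKey (k x y ps cs : ℕ)
  | dupData (k x y ps cs : ℕ) (m : Key)
  | dupNew (k x y ps cs : ℕ) (m : Key) (d : ℕ)
  | dupMark (k x y ps cs w : ℕ)
  | dupLock (k x y ps cs w : ℕ)
  | linkCmp (k x y ps cs w : ℕ)
  | linkLeft (k x y ps cs w : ℕ)
  | linkRight (k x y ps cs w : ℕ)
  | syncCall (k y ps cs w : ℕ)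
  | syncWait (k y ps cs w : ℕ)
  | csMark (k y ps cs w : ℕ)
  | csRight (k y ps cs w : ℕ)
  | unlinkW (k w : ℕ) (r : Ptr)
  | unlinkPs (k ps w : ℕ) (r : Ptr)
  -- releasing the locks, then returning or restarting
  | finish (r : Res)
  | restart (op : Op)
  | ret (r : Res)

/-- `LStep s i p a p'`: in the shared state `s`, thread `i` can go from control point `p` to `p'`
by the action `a`. A step makes at most one access to the memory shared by the threads, except that
`duplicate(y)` initializes a private node from the fields of `y`, whose lock the thread holds. -/
inductive LStep (s : Shared) (i : Tid) : PC → Act → PC → Prop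
  | stutter : LStep s i .idle .tau .idle
  | invoke (op) : LStep s i .idle (.invoke op) (.locStart op)
  -- `x, y ← root; rcu_read_lock`
  | locStart {op} : LStep s i (.locStart op) .rcuLock (.locTest op rootId (some rootId))
  -- `while (y ≠ null ∧ y.key ≠ k) { x ← y; if (y.key < k) y ← x.right else y ← x.left }`
  | locNull {op x} : LStep s i (.locTest op x none) .tau (.locTag op x none)
  | locFound {op x y} : (s.heap y).key = userKey op.key →
      LStep s i (.locTest op x (some y)) (.read ⟨some y, .key⟩) (.locTag op x (some y))
  | locGoRight {op x y} : (s.heap y).key < userKey op.key →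
      LStep s i (.locTest op x (some y)) (.read ⟨some y, .key⟩) (.locRight op y)
  | locGoLeft {op x y} : userKey op.key < (s.heap y).key →
      LStep s i (.locTest op x (some y)) (.read ⟨some y, .key⟩) (.locLeft op y)
  | locRight {op x} : LStep s i (.locRight op x) (.read ⟨some x, .right⟩)
      (.locTest op x (s.heap x).right)
  | locLeft {op x} : LStep s i (.locLeft op x) (.read ⟨some x, .left⟩)
      (.locTest op x (s.heap x).left)
  -- `tag ← x.tag; rcu_read_unlock; return (x, tag, y)`
  | locTag {op x y} : LStep s i (.locTag op x y) (.read ⟨some x, .tag⟩)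
      (.locUnlock op x (s.heap x).tag y)
  | locUnlock {op x tag y} : LStep s i (.locUnlock op x tag y) .rcuUnlock (.located op x tag y)
  -- contains
  | conNull {k x tag} : LStep s i (.located (.contains k) x tag none) .tau (.ret (.bool false))
  | conFound {k x tag y} : LStep s i (.located (.contains k) x tag (some y)) .tau (.conData y)
  | conData {y} : LStep s i (.conData y) (.read ⟨some y, .data⟩) (.ret (.data (s.heap y).data))
  -- insert
  | insFound {k d x tag y} :
      LStep s i (.located (.insert k d) x tag (some y)) .tau (.ret (.bool false))
  | insNull {k d x tag} :
      LStep s i (.located (.insert k d) x tag none) .tau (.insLock k d x tag)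
  | insLock {k d x tag} : s.lock x = none ∨ s.lock x = some i →
      LStep s i (.insLock k d x tag) (.lock x) (.insRem k d x tag)
  | insRemT {k d x tag} : (s.heap x).rem = true →
      LStep s i (.insRem k d x tag) (.read ⟨some x, .rem⟩) (.restart (.insert k d))
  | insRemF {k d x tag} : (s.heap x).rem = false →
      LStep s i (.insRem k d x tag) (.read ⟨some x, .rem⟩) (.insKey k d x tag)
  | insKeyL {k d x tag} : userKey k < (s.heap x).key →
      LStep s i (.insKey k d x tag) (.read ⟨some x, .key⟩) (.insLeft k d x tag)
  | insKeyR {k d x tag} : (s.heap x).key < userKey k →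
      LStep s i (.insKey k d x tag) (.read ⟨some x, .key⟩) (.insRight k d x)
  | insKeyE {k d x tag} : (s.heap x).key = userKey k →
      LStep s i (.insKey k d x tag) (.read ⟨some x, .key⟩) (.restart (.insert k d))
  | insLeftN {k d x tag} : (s.heap x).left = none →
      LStep s i (.insLeft k d x tag) (.read ⟨some x, .left⟩) (.insTag k d x tag)
  | insLeftS {k d x tag} : (s.heap x).left ≠ none →
      LStep s i (.insLeft k d x tag) (.read ⟨some x, .left⟩) (.restart (.insert k d))
  | insTagE {k d x tag} : (s.heap x).tag = tag →
      LStep s i (.insTag k d x tag) (.read ⟨some x, .tag⟩) (.insNewLeft k d x)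
  | insTagN {k d x tag} : (s.heap x).tag ≠ tag →
      LStep s i (.insTag k d x tag) (.read ⟨some x, .tag⟩) (.restart (.insert k d))
  | insNewLeft {k d x} : LStep s i (.insNewLeft k d x)
      (.alloc s.next ⟨userKey k, d, none, none, 0, false⟩) (.insWriteLeft k d x s.next)
  | insWriteLeft {k d x n} : LStep s i (.insWriteLeft k d x n)
      (.write ⟨some x, .left⟩ (.ref (some n)) .skip) (.finish (.bool true))
  | insRightN {k d x} : (s.heap x).right = none →
      LStep s i (.insRight k d x) (.read ⟨some x, .right⟩) (.insNewRight k d x)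
  | insRightS {k d x} : (s.heap x).right ≠ none →
      LStep s i (.insRight k d x) (.read ⟨some x, .right⟩) (.restart (.insert k d))
  | insNewRight {k d x} : LStep s i (.insNewRight k d x)
      (.alloc s.next ⟨userKey k, d, none, none, 0, false⟩) (.insWriteRight k d x s.next)
  | insWriteRight {k d x n} : LStep s i (.insWriteRight k d x n)
      (.write ⟨some x, .right⟩ (.ref (some n)) .skip) (.finish (.bool true))
  -- delete: `lock(x); lock(y); if (y.rem ∨ x.rem ∨ y is not a child of x) restart`
  | delNull {k x tag} : LStep s i (.located (.delete k) x tag none) .tau (.ret (.bool false))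
  | delFound {k x tag y} :
      LStep s i (.located (.delete k) x tag (some y)) .tau (.delLockX k x y)
  | delLockX {k x y} : s.lock x = none ∨ s.lock x = some i →
      LStep s i (.delLockX k x y) (.lock x) (.delLockY k x y)
  | delLockY {k x y} : s.lock y = none ∨ s.lock y = some i →
      LStep s i (.delLockY k x y) (.lock y) (.delRemY k x y)
  | delRemYT {k x y} : (s.heap y).rem = true →
      LStep s i (.delRemY k x y) (.read ⟨some y, .rem⟩) (.restart (.delete k))
  | delRemYF {k x y} : (s.heap y).rem = false →
      LStep s i (.delRemY k x y) (.read ⟨some y, .rem⟩) (.delRemX k x y)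
  | delRemXT {k x y} : (s.heap x).rem = true →
      LStep s i (.delRemX k x y) (.read ⟨some x, .rem⟩) (.restart (.delete k))
  | delRemXF {k x y} : (s.heap x).rem = false →
      LStep s i (.delRemX k x y) (.read ⟨some x, .rem⟩) (.delParLeft k x y)
  | delParLeftE {k x y} : (s.heap x).left = some y →
      LStep s i (.delParLeft k x y) (.read ⟨some x, .left⟩) (.delLeft k x y)
  | delParLeftN {k x y} : (s.heap x).left ≠ some y →
      LStep s i (.delParLeft k x y) (.read ⟨some x, .left⟩) (.delParRight k x y)
  | delParRightE {k x y} : (s.heap x).right = some y →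
      LStep s i (.delParRight k x y) (.read ⟨some x, .right⟩) (.delLeft k x y)
  | delParRightN {k x y} : (s.heap x).right ≠ some y →
      LStep s i (.delParRight k x y) (.read ⟨some x, .right⟩) (.restart (.delete k))
  -- `(b, otherChild) ← hasNullChild(y)`
  | delLeft {k x y} : LStep s i (.delLeft k x y) (.read ⟨some y, .left⟩)
      (.delRight k x y (s.heap y).left)
  | delRightLN {k x y} : LStep s i (.delRight k x y none) (.read ⟨some y, .right⟩)
      (.bypMark k x y (s.heap y).right)
  | delRightRN {k x y l} : (s.heap y).right = none →
      LStep s i (.delRight k x y (some l)) (.read ⟨some y, .right⟩) (.bypMark k x y (some l))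
  | delRightTwo {k x y l} : (s.heap y).right ≠ none →
      LStep s i (.delRight k x y (some l)) (.read ⟨some y, .right⟩) (.sucRight k x y)
  -- `y.rem ← true; setChild(x, y.key, otherChild)`, where `y.key = k`
  | bypMark {k x y c} : LStep s i (.bypMark k x y c)
      (.write ⟨some y, .rem⟩ (.rem true) .skip) (.bypCmp k x y c)
  | bypCmpL {k x y c} : userKey k < (s.heap x).key →
      LStep s i (.bypCmp k x y c) (.read ⟨some x, .key⟩) (.bypLeft k x y c)
  | bypCmpR {k x y c} : ¬ userKey k < (s.heap x).key →
      LStep s i (.bypCmp k x y c) (.read ⟨some x, .key⟩) (.bypRight k x y c)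
  | bypLeftN {k x y} : LStep s i (.bypLeft k x y none)
      (.write ⟨some x, .left⟩ (.ref none) .skip) (.tagRead k x)
  | bypLeftS {k x y c} : LStep s i (.bypLeft k x y (some c))
      (.write ⟨some x, .left⟩ (.ref (some c)) .skip) (.finish (.bool true))
  | bypRight {k x y c} : LStep s i (.bypRight k x y c)
      (.write ⟨some x, .right⟩ (.ref c) .skip) (.finish (.bool true))
  -- `x.tag ← x.tag + 1`
  | tagRead {k x} : LStep s i (.tagRead k x) (.read ⟨some x, .tag⟩) (.tagWrite k x (s.heap x).tag)
  | tagWrite {k x v} : LStep s i (.tagWrite k x v)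
      (.write ⟨some x, .tag⟩ (.tag (v + 1)) .skip) (.finish (.bool true))
  -- `ps ← y; cs ← y.right; nx ← cs.left; while (nx ≠ null) { ps ← cs; cs ← nx; nx ← cs.left }`
  | sucRight {k x y cs} : (s.heap y).right = some cs →
      LStep s i (.sucRight k x y) (.read ⟨some y, .right⟩) (.sucLeft k x y y cs)
  | sucLeftN {k x y ps cs} : (s.heap cs).left = none →
      LStep s i (.sucLeft k x y ps cs) (.read ⟨some cs, .left⟩) (.sucLockPs k x y ps cs)
  | sucLeftS {k x y ps cs nx} : (s.heap cs).left = some nx →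
      LStep s i (.sucLeft k x y ps cs) (.read ⟨some cs, .left⟩) (.sucLeft k x y cs nx)
  -- `lock(ps); lock(cs)` and validation
  | sucLockPs {k x y ps cs} : s.lock ps = none ∨ s.lock ps = some i →
      LStep s i (.sucLockPs k x y ps cs) (.lock ps) (.sucLockCs k x y ps cs)
  | sucLockCs {k x y ps cs} : s.lock cs = none ∨ s.lock cs = some i →
      LStep s i (.sucLockCs k x y ps cs) (.lock cs) (.sucRemPs k x y ps cs)
  | sucRemPsT {k x y ps cs} : (s.heap ps).rem = true →
      LStep s i (.sucRemPs k x y ps cs) (.read ⟨some ps, .rem⟩) (.restart (.delete k))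
  | sucRemPsF {k x y ps cs} : (s.heap ps).rem = false →
      LStep s i (.sucRemPs k x y ps cs) (.read ⟨some ps, .rem⟩) (.sucRemCs k x y ps cs)
  | sucRemCsT {k x y ps cs} : (s.heap cs).rem = true →
      LStep s i (.sucRemCs k x y ps cs) (.read ⟨some cs, .rem⟩) (.restart (.delete k))
  | sucRemCsF {k x y ps cs} : (s.heap cs).rem = false →
      LStep s i (.sucRemCs k x y ps cs) (.read ⟨some cs, .rem⟩) (.sucPar k x y ps cs)
  | sucParY {k x y cs} : LStep s i (.sucPar k x y y cs) .tau (.sucNull k x y y cs)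
  | sucParE {k x y ps cs} : ps ≠ y → (s.heap ps).left = some cs →
      LStep s i (.sucPar k x y ps cs) (.read ⟨some ps, .left⟩) (.sucNull k x y ps cs)
  | sucParN {k x y ps cs} : ps ≠ y → (s.heap ps).left ≠ some cs →
      LStep s i (.sucPar k x y ps cs) (.read ⟨some ps, .left⟩) (.restart (.delete k))
  | sucNullN {k x y ps cs} : (s.heap cs).left = none →
      LStep s i (.sucNull k x y ps cs) (.read ⟨some cs, .left⟩) (.dupKey k x y ps cs)
  | sucNullS {k x y ps cs} : (s.heap cs).left ≠ none →
      LStep s i (.sucNull k x y ps cs) (.read ⟨some cs, .left⟩) (.restart (.delete k))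
  -- `w ← duplicate(y); w.key ← cs.key; w.data ← cs.data; y.rem ← true; lock(w)`
  | dupKey {k x y ps cs} : LStep s i (.dupKey k x y ps cs) (.read ⟨some cs, .key⟩)
      (.dupData k x y ps cs (s.heap cs).key)
  | dupData {k x y ps cs m} : LStep s i (.dupData k x y ps cs m) (.read ⟨some cs, .data⟩)
      (.dupNew k x y ps cs m (s.heap cs).data)
  | dupNew {k x y ps cs m d} : LStep s i (.dupNew k x y ps cs m d)
      (.alloc s.next { s.heap y with key := m, data := d }) (.dupMark k x y ps cs s.next)
  | dupMark {k x y ps cs w} : LStep s i (.dupMark k x y ps cs w)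
      (.write ⟨some y, .rem⟩ (.rem true) .skip) (.dupLock k x y ps cs w)
  | dupLock {k x y ps cs w} : s.lock w = none ∨ s.lock w = some i →
      LStep s i (.dupLock k x y ps cs w) (.lock w) (.linkCmp k x y ps cs w)
  -- `setChild(x, y.key, w)`, where `y.key = k`; the ghost key of `w` becomes `k`
  | linkCmpL {k x y ps cs w} : userKey k < (s.heap x).key →
      LStep s i (.linkCmp k x y ps cs w) (.read ⟨some x, .key⟩) (.linkLeft k x y ps cs w)
  | linkCmpR {k x y ps cs w} : ¬ userKey k < (s.heap x).key →
      LStep s i (.linkCmp k x y ps cs w) (.read ⟨some x, .key⟩) (.linkRight k x y ps cs w)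
  | linkLeft {k x y ps cs w} : LStep s i (.linkLeft k x y ps cs w)
      (.write ⟨some x, .left⟩ (.ref (some w)) (.open w (userKey k))) (.syncCall k y ps cs w)
  | linkRight {k x y ps cs w} : LStep s i (.linkRight k x y ps cs w)
      (.write ⟨some x, .right⟩ (.ref (some w)) (.open w (userKey k))) (.syncCall k y ps cs w)
  -- `synchronize_rcu; cs.rem ← true`
  | syncCall {k y ps cs w} :
      LStep s i (.syncCall k y ps cs w) .syncCall (.syncWait k y ps cs w)
  | syncWait {k y ps cs w} : s.waiting i = ∅ →
      LStep s i (.syncWait k y ps cs w) .syncReturn (.csMark k y ps cs w)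
  | csMark {k y ps cs w} : LStep s i (.csMark k y ps cs w)
      (.write ⟨some cs, .rem⟩ (.rem true) .skip) (.csRight k y ps cs w)
  -- `if (ps = y) w.right ← cs.right else { ps.left ← cs.right; ... }`; the ghost key collapses
  | csRightW {k y cs w} : LStep s i (.csRight k y y cs w) (.read ⟨some cs, .right⟩)
      (.unlinkW k w (s.heap cs).right)
  | csRightPs {k y ps cs w} : ps ≠ y →
      LStep s i (.csRight k y ps cs w) (.read ⟨some cs, .right⟩)
        (.unlinkPs k ps w (s.heap cs).right)
  | unlinkW {k w r} : LStep s i (.unlinkW k w r)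
      (.write ⟨some w, .right⟩ (.ref r) (.collapse w)) (.finish (.bool true))
  | unlinkPsS {k ps w c} : LStep s i (.unlinkPs k ps w (some c))
      (.write ⟨some ps, .left⟩ (.ref (some c)) (.collapse w)) (.finish (.bool true))
  | unlinkPsN {k ps w} : LStep s i (.unlinkPs k ps w none)
      (.write ⟨some ps, .left⟩ (.ref none) (.collapse w)) (.tagRead k ps)
  -- a terminating or restarting procedure releases its locks, one at a time in any order
  | finishUnlock {r o} : s.lock o = some i → LStep s i (.finish r) (.unlock o) (.finish r)
  | finishDone {r} : (∀ o, s.lock o ≠ some i) → LStep s i (.finish r) .tau (.ret r)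
  | restartUnlock {op o} : s.lock o = some i → LStep s i (.restart op) (.unlock o) (.restart op)
  | restartDone {op} : (∀ o, s.lock o ≠ some i) → LStep s i (.restart op) .tau (.locStart op)
  | ret {r} : LStep s i (.ret r) (.respond r) .idle

structure Config where
  shared : Shared
  pc : Tid → PC

/-- The initial tree: a root with key `-1` whose right child is the sentinel with key `∞`. -/
def initHeap : Heap := fun o =>
  if o = rootId then ⟨((-1 : ℤ) : WithTop ℤ), 0, none, some 1, 0, false⟩
  else ⟨⊤, 0, none, none, 0, false⟩

def initConfig : Config where
  shared :=
    { heap := initHeap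
      next := 2
      lock := fun _ => none
      reader := fun _ => false
      waiting := fun _ => ∅
      ghost := fun _ o => (initHeap o).key }
  pc := fun _ => .idle

/-- A sequentially consistent, interleaved execution. `cfg t` is the configuration at time `t`,
and `act t` is the step, with the thread that makes it, from time `t` to time `t + 1`. (Idle
threads may stutter, so that finite executions are prefixes of these.) -/
structure Execution where
  cfg : ℕ → Config
  act : ℕ → Tid × Act
  init : cfg 0 = initConfig
  step_local : ∀ t, LStep (cfg t).shared (act t).1 ((cfg t).pc (act t).1) (act t).2
    ((cfg (t + 1)).pc (act t).1)
  step_other : ∀ t j, j ≠ (act t).1 → (cfg (t + 1)).pc j = (cfg t).pc j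
  step_shared : ∀ t, (cfg (t + 1)).shared = applyAct (act t).1 (cfg t).shared (act t).2

namespace Execution

variable (E : Execution)

def heap (t : ℕ) : Heap := (E.cfg t).shared.heap

/-- The step at time `t` writes to the location `l`. -/
def writes (t : ℕ) (l : Loc) : Prop :=
  match (E.act t).2 with
  | .write l' _ _ => l' = l
  | .alloc o _ => l.obj = some o
  | _ => False

/-- One and the same RCU-protected section of thread `i`, entered by the step at time `a`, is in
progress at all the times in `(a, b]`. -/
def InSection (i : Tid) (a b : ℕ) : Prop :=
  E.act a = (i, .rcuLock) ∧ a < b ∧ ∀ t, a < t → t ≤ b → (E.cfg t).shared.reader i = true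

/-- The operation `op` that thread `i` invokes by the step at time `j` is in progress at time `t`. -/
def During (i : Tid) (op : Op) (j t : ℕ) : Prop :=
  E.act j = (i, .invoke op) ∧ j < t ∧ ∀ s, j < s → s ≤ t → (E.cfg s).pc i ≠ .idle

/-- The operation that is invoked by the step at time `j` returns `v` by the step at time `r`. -/
def Returns (j r : ℕ) (v : Res) : Prop :=
  ∃ i op, E.act j = (i, .invoke op) ∧ j < r ∧ E.act r = (i, .respond v) ∧
    ∀ s v', j < s → s < r → E.act s ≠ (i, .respond v')

end Execution

/-! ### Traversals, their correctness, and conditions on interference -/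

/-- The next location after reading the value `v` in `l`, in a binary search for the key `k`. -/
inductive Extend (k : Key) : Loc → Val → Loc → Prop
  | right {o m} : m < k → Extend k ⟨o, .key⟩ (.key m) ⟨o, .right⟩
  | left {o m} : k < m → Extend k ⟨o, .key⟩ (.key m) ⟨o, .left⟩
  | ofLeft {o o'} : Extend k ⟨o, .left⟩ (.ref o') ⟨o', .key⟩
  | ofRight {o o'} : Extend k ⟨o, .right⟩ (.ref o') ⟨o', .key⟩

/-- The sequence `(l 0, t 0), …, (l (n-1), t (n-1)), l n` is a traversal along the relation `ext`,
in an execution in which `val s l` is the value of `l` at time `s`. -/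
def IsTraversal (ext : Loc → Val → Loc → Prop) (val : ℕ → Loc → Val) (n : ℕ) (l : ℕ → Loc)
    (t : ℕ → ℕ) : Prop :=
  (∀ j j', j < j' → j' < n → t j ≤ t j') ∧ ∀ j < n, ext (l j) (val (t j) (l j)) (l (j + 1))

/-- Traversal correctness for the reachability predicate `P` (`P s l`: location `l` is reachable at
time `s`) and the given base time. -/
def TraversalCorrect (P : ℕ → Loc → Prop) (base n : ℕ) (l : ℕ → Loc) (t : ℕ → ℕ) : Prop :=
  P base (l 0) ∧ ∀ j < n, ∃ s, base ≤ s ∧ s ≤ t j ∧ P s (l (j + 1))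

/-- Single-step compatibility in a state with contents `val`. -/
def SingleStepCompatible (ext : Loc → Val → Loc → Prop) (val : Loc → Val) (P : Loc → Prop) : Prop :=
  ∀ l l', P l → ext l (val l) l' → P l'

/-- The strong forepassed condition for the step from time `t` to `t + 1`, in an execution whose
timespan ends at time `tend`: whatever location has its reachability reduced by the step is not
written by this step nor later. -/
def StrongForepassed (writes : ℕ → Loc → Prop) (P : ℕ → Loc → Prop) (tend t : ℕ) : Prop :=
  ∀ l, (P t l → P (t + 1) l) ∨ ∀ s, t ≤ s → s < tend → ¬ writes s l

/-- The forepassed condition for the locations `l` and `f`. -/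
def ForepassedField (writes : ℕ → Loc → Prop) (P : ℕ → Loc → Prop) (tend t : ℕ) (l f : Loc) :
    Prop :=
  (P t l → P (t + 1) l) ∨ ∀ s, t ≤ s → s < tend → ¬ writes s f

/-! ### Standard and weak reachability -/

/-- One step of the standard search for `k` in the heap `h`. -/
def StdLink (h : Heap) (k : Key) (l l' : Loc) : Prop := Extend k l (h.val l) l'

/-- There is a standard `k`-search path from `l` to `l'`. -/
def StdPath (h : Heap) (k : Key) : Loc → Loc → Prop := Relation.ReflTransGen (StdLink h k)

/-- Standard `k`-reachability. -/
def StdReach (h : Heap) (k : Key) (l : Loc) : Prop := StdPath h k rootLoc l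

/-- The step from the `key` location of a node in a weak search for `k`; `g` gives the ghost keys. -/
inductive WeakLink (h : Heap) (g : ℕ → Key) (k : Key) : Loc → Loc → Prop
  | right {o} : (g o < k ∧ k ≠ (h o).key) ∨ (k = (h o).key ∧ g o ≠ (h o).key) →
      WeakLink h g k ⟨some o, .key⟩ ⟨some o, .right⟩
  | left {o} : k < (h o).key → WeakLink h g k ⟨some o, .key⟩ ⟨some o, .left⟩

/-- One step of a weak search. -/
inductive WeakStep (h : Heap) (g : ℕ → Key) (k : Key) : Loc → Loc → Prop
  | ofLeft {o} : WeakStep h g k ⟨some o, .left⟩ ⟨(h o).left, .key⟩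
  | ofRight {o} : WeakStep h g k ⟨some o, .right⟩ ⟨(h o).right, .key⟩
  | link {l l'} : WeakLink h g k l l' → WeakStep h g k l l'

/-- Weak `k`-reachability. -/
def WeakReach (h : Heap) (g : ℕ → Key) (k : Key) (l : Loc) : Prop :=
  Relation.ReflTransGen (WeakStep h g k) rootLoc l

/-- `z` is a node of the subtree rooted at `p`. -/
def InSubtree (h : Heap) (p : Ptr) (z : ℕ) : Prop :=
  ∃ x, p = some x ∧
    Relation.ReflTransGen (fun u v => (h u).left = some v ∨ (h u).right = some v) x z

/-- The abstract map of the heap `h`: the key-value pairs in the nodes that are on the standard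
search path for their key. -/
def Represents (h : Heap) (m : ℕ → Option ℕ) : Prop :=
  ∀ k d, m k = some d ↔ ∃ x, StdReach h (userKey k) ⟨some x, .key⟩ ∧ (h x).key = userKey k ∧
    (h x).data = d

namespace Execution

variable (E : Execution)

/-- Standard reachability for the user key `k` at time `t`. -/
def Std (k t : ℕ) (l : Loc) : Prop := StdReach (E.heap t) (userKey k) l

/-- Weak reachability for the user key `k` at time `t`, with the ghost keys of the traversal of
thread `i`. -/
def Weak (i : Tid) (k t : ℕ) (l : Loc) : Prop :=
  WeakReach (E.heap t) ((E.cfg t).shared.ghost i) (userKey k) l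

end Execution

/-! ### Invocations of locate as traversals -/

/-- The location of the tree that an invocation of locate has reached and that is next to be read. -/
def PC.cursor : PC → Option Loc
  | .locTest _ _ y => some ⟨y, .key⟩
  | .locRight _ x => some ⟨some x, .right⟩
  | .locLeft _ x => some ⟨some x, .left⟩
  | _ => none

/-- The invocation of locate that thread `i` starts, on behalf of the operation `op`, by the step at
time `a`, reads `l 0, …, l (n-1)` at the times `t 0 < … < t (n-1)` and then reaches `l n`. -/
structure LocateTraversal (E : Execution) (i : Tid) (op : Op) (a n : ℕ) (l : ℕ → Loc)
    (t : ℕ → ℕ) : Prop where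
  pc_start : (E.cfg a).pc i = .locStart op
  act_start : E.act a = (i, .rcuLock)
  first : l 0 = rootLoc
  after : ∀ j < n, a < t j
  strictMono : ∀ j j', j < j' → j' < n → t j < t j'
  act_read : ∀ j < n, E.act (t j) = (i, .read (l j))
  cursor_before : ∀ j < n, ((E.cfg (t j)).pc i).cursor = some (l j)
  cursor_after : ∀ j < n, ((E.cfg (t j + 1)).pc i).cursor = some (l (j + 1))
  /-- thread `i` makes no other steps until it reaches `l n` -/
  all : ∀ s, a < s → (∃ j < n, s ≤ t j) → (E.act s).1 = i → ∃ j < n, s = t j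

/-! ### Linearizability -/

/-- `L` is a linearization, ending in the abstract map `m`, of the history of the first `N` steps. An
entry `(j, op, v)` stands for the operation `op` invoked by the step at time `j`, with result `v`.
All the completed operations and possibly some of the pending ones are in `L`. -/
structure Linearization (E : Execution) (N : ℕ) (L : List (ℕ × Op × Res)) (m : ℕ → Option ℕ) :
    Prop where
  nodup : (L.map Prod.fst).Nodup
  invoked : ∀ e ∈ L, e.1 < N ∧ ∃ i, E.act e.1 = (i, .invoke e.2.1)
  completed : ∀ j r v, r < N → E.Returns j r v → ∃ op, (j, op, v) ∈ L
  /-- an operation that returned before another one was invoked precedes it -/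
  realTime : L.Pairwise (fun e e' => ¬ ∃ r v, E.Returns e'.1 r v ∧ r < e.1)
  legal : Legal (fun _ => none) (L.map Prod.snd) m

end Citrus

/-!
The tree is a binary search tree at all times, except that during a deletion of `k` with two
children the key `m` of the successor occurs twice: in the copy `w`, once that is linked, and in the
successor, until that is unlinked. `TreeInv` says this, for the family `Pend` of the unfinished
deletions. A copy stands for all the keys from the deleted one to its own (`lowKey`), since no node
of its right subtree has a smaller key than the successor, which is the end of the chain of left
pointers there.

A traversal whose read section began before the copy was linked may pass the replaced node, and may
therefore be on its way through the right subtree for a key `q` with `k < q ≤ m`, while standard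
searches for `q` now end at the copy or turn left there. Weak search admits both: it takes the link
to the right at the copy, while the ghost key of the copy is still `k`. By the tree invariant, this
is its only deviation, and afterwards it follows the chain of left pointers to the successor
(`weak_cases`). Other threads can change the chain meanwhile, but `synchronize_rcu` keeps the
successor in place as long as such a traversal is in progress. Conversely, all the read sections
in progress when the successor is unlinked began after the copy was linked, so that the ghost keys
equal the keys for them (`GhostWaits`, `Inv.ghost_done`).

These facts are part of an invariant `Inv`, which also records what each thread knows at each
control point (`PCInv`). It is proved by rely and guarantee: whatever a step does, it gives the
guarantee `Grt`, which keeps the knowledge of all other threads (`Grt.pcInv`). By the guarantee,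
nodes never change once they are marked, and weak reachability is lost at marked nodes only. Hence
arguments from hindsight work. A location that was weakly reachable during a read section still is,
or its node has not changed since a time when it was (`weak_freeze`), so that a standard search step
leads to a location that was weakly reachable too (`weak_next`). Inside the invariant, the same
argument is the notion `Hind`, which applies to traversals and to walks to a successor.

Weak reachability of an endpoint, that is, of null or of a node with the key searched for, implies
standard reachability in the past: if a deviation leads to it, then the copy was linked during the
read section, and just before this the successor was at the end of the standard path
(`opening_before`). In the present, `TagStable` and `RightStable` replace it: a node that was weakly
reachable stays on the standard search path until it is marked or one of a few visible exceptions
applies, and the validations under locks exclude these.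

For linearizability, insertions and deletions that return true take effect when they write the child
pointer that links the leaf or the copy, or bypasses the node (`PC.commit`). All other operations
take effect at a past time, within their span, at which the endpoint that they found was standardly
reachable. Sorting the operations by these times gives the linearization (`linearizable`).

That `locate` is not correct for standard reachability is shown by a run with two deletions
(`exists_incorrect`): the second one links its copy in a part of the tree where only a traversal
that began before the first one still searches. The run is simulated in the kernel.
-/

namespace Citrus
open Relation

/-! ### Reachability at the level of nodes -/

/-- The child pointer of node `x` in direction `d`; `true` is right and `false` is left. -/
def Heap.child (h : Heap) (x : ℕ) (d : Bool) : Ptr := bif d then (h x).right else (h x).left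

/-- A pointer from `x` to `z` in a direction that `A` admits at `x`. -/
def Edge (h : Heap) (A : ℕ → Bool → Prop) (x z : ℕ) : Prop := ∃ d, A x d ∧ h.child x d = some z

/-- Node `z` can be reached from node `r` by pointers in directions that `A` admits. Standard and
weak reachability, membership in the tree or a subtree, and chains of left pointers are instances.
-/
abbrev Rch (h : Heap) (A : ℕ → Bool → Prop) (r z : ℕ) : Prop := ReflTransGen (Edge h A) r z

/-- Both directions: the descendants of a node are the nodes reachable in them. -/
def AnyDir : ℕ → Bool → Prop := fun _ _ => True

/-- Left only: chains of left pointers. -/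
def LeftDir : ℕ → Bool → Prop := fun _ d => d = false

/-- The direction of a standard search for `k` at a node. -/
def SDir (h : Heap) (k : Key) (o : ℕ) (d : Bool) : Prop :=
  bif d then (h o).key < k else k < (h o).key

/-- The directions of a weak search for `k` at a node, for the ghost keys `g`. -/
def WDir (h : Heap) (g : ℕ → Key) (k : Key) (o : ℕ) (d : Bool) : Prop :=
  bif d then (g o < k ∧ k ≠ (h o).key) ∨ (k = (h o).key ∧ g o ≠ (h o).key) else k < (h o).key

/-- `z` is a node of the shared tree, that is, a descendant of the root. -/
def InTree (h : Heap) (z : ℕ) : Prop := Rch h AnyDir rootId z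

theorem Rch.toDesc {h : Heap} {A r z} (H : Rch h A r z) : Rch h AnyDir r z :=
  ReflTransGen.mono (fun _ _ ⟨d, _, e⟩ => ⟨d, trivial, e⟩) _ _ H

theorem Rch.inTree {h : Heap} {A z} (H : Rch h A rootId z) : InTree h z := H.toDesc

theorem InTree.child {h : Heap} {p d z} (H : InTree h p) (e : h.child p d = some z) : InTree h z :=
  ReflTransGen.tail H ⟨d, trivial, e⟩

theorem InTree.desc {h : Heap} {p z} (H : InTree h p) (e : Rch h AnyDir p z) : InTree h z :=
  ReflTransGen.trans H e

theorem inTree_root (h : Heap) : InTree h rootId := ReflTransGen.refl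

theorem SDir.wdir {h : Heap} {g : ℕ → Key} {k o d} (hg : g o ≤ (h o).key) (H : SDir h k o d) :
    WDir h g k o d := by
  cases d
  · exact H
  · exact Or.inl ⟨lt_of_le_of_lt hg H, (ne_of_lt H).symm⟩

theorem SDir.unique {h : Heap} {k o d e} (H : SDir h k o d) (H' : SDir h k o e) : d = e := by
  cases d <;> cases e <;> simp only [SDir, cond_true, cond_false] at H H' <;>
    first | rfl | exact absurd (lt_trans H H') (lt_irrefl _)

/-- A standard search that reaches a node with the key it looks for stays there, so that it reaches
no other node afterwards. -/
theorem std_unique {h : Heap} {k : Key} {r x y : ℕ} (hx : Rch h (SDir h k) r x)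
    (hy : Rch h (SDir h k) r y) (kx : (h x).key = k) (ky : (h y).key = k) : x = y := by
  have stays : ∀ {x z}, (h x).key = k → Rch h (SDir h k) x z → z = x := by
    intro x z kx H
    induction H with
    | refl => rfl
    | tail _ e ih =>
      subst ih
      obtain ⟨d, hd, -⟩ := e
      cases d <;> simp [SDir, kx] at hd
  have det : Relator.RightUnique (Edge h (SDir h k)) := by
    rintro a b c ⟨d, hd, e⟩ ⟨d', hd', e'⟩
    obtain rfl := hd.unique hd'
    exact Option.some_injective _ (e.symm.trans e')
  rcases ReflTransGen.total_of_right_unique det hx hy with H | H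
  · exact (stays kx H).symm
  · exact stays ky H

/-- A search whose directions at the nodes of the tree do not change reaches the same nodes. -/
theorem Rch.congr {h h' : Heap} {A A' : ℕ → Bool → Prop} {x : ℕ}
    (hc : ∀ o d, InTree h o → h'.child o d = h.child o d)
    (hA : ∀ o d, InTree h o → A o d → A' o d) (H : Rch h A rootId x) : Rch h' A' rootId x := by
  induction H with
  | refl => exact .refl
  | tail hb e ih =>
    obtain ⟨d, hd, e⟩ := e
    exact ih.tail ⟨d, hA _ _ (Rch.inTree hb) hd, by rw [hc _ _ (Rch.inTree hb), e]⟩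

/-! ### Changing one child pointer -/

/-- The heaps `h` and `h'` agree on keys and child pointers, except that `h'` has the child pointer
`c` of `p` in direction `d`. -/
structure SetChild (h h' : Heap) (p : ℕ) (d : Bool) (c : Ptr) : Prop where
  key : ∀ o, (h' o).key = (h o).key
  other : ∀ o e, ¬ (o = p ∧ e = d) → h'.child o e = h.child o e
  self : h'.child p d = c

section
variable {h h' : Heap} {p : ℕ} {d : Bool} {c : Ptr} {A A' : ℕ → Bool → Prop} {r x y w : ℕ}

/-- Setting a null child pointer takes away no reachability. -/
theorem insert_forward (hs : SetChild h h' p d c) (h0 : h.child p d = none)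
    (hA : ∀ o f, A o f → A' o f) (H : Rch h A r x) : Rch h' A' r x := by
  refine ReflTransGen.mono (fun a b ⟨f, hf, e⟩ => ⟨f, hA _ _ hf, ?_⟩) _ _ H
  rw [hs.other _ _ (by rintro ⟨rfl, rfl⟩; simp [h0] at e), e]

/-- Replacing the pointer to a node `y` with a null child by the other child of `y` preserves
everything reachable but `y`. -/
theorem splice_forward {e : Bool} (hs : SetChild h h' p d c) (hy : h.child p d = some y)
    (hc : h.child y e = c) (hn : h.child y (!e) = none) (hpy : p ≠ y)
    (hA : ∀ o f, A o f → A' o f) (H : Rch h A r x) :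
    (x = y ∧ (x = r ∨ (Rch h' A' r p ∧ A' p d))) ∨ Rch h' A' r x := by
  induction H with
  | refl => exact .inr .refl
  | @tail b z hb e' ih =>
    obtain ⟨f, hf, e'⟩ := e'
    by_cases hcase : b = p ∧ f = d
    · obtain ⟨rfl, rfl⟩ := hcase
      obtain rfl : y = z := Option.some_injective _ (hy.symm.trans e')
      rcases ih with ⟨rfl, -⟩ | ih
      · exact absurd rfl hpy
      · exact .inl ⟨rfl, .inr ⟨ih, hA _ _ hf⟩⟩
    · have e2 : h'.child b f = some z := by rw [hs.other _ _ hcase, e']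
      rcases ih with ⟨rfl, rfl | ⟨hp, hpd⟩⟩ | ih
      · exact .inr (.single ⟨f, hA _ _ hf, e2⟩)
      · have : f = e := by
          by_contra hne
          have : f = !e := by cases f <;> cases e <;> simp_all
          simp [this, hn] at e'
        subst this
        exact .inr (hp.tail ⟨d, hpd, by rw [hs.self, ← hc, e']⟩)
      · exact .inr (ih.tail ⟨f, hA _ _ hf, e2⟩)

/-- Replacing the pointer to a node `y` by a pointer to a copy `w` of `y` preserves everything
reachable but `y`, if the search continues from `w` at least in the directions it took from `y`. -/
theorem link_forward (hs : SetChild h h' p d (some w)) (hy : h.child p d = some y)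
    (hw : ∀ e, h.child w e = h.child y e) (hpw : p ≠ w) (hpy : p ≠ y)
    (hA : ∀ o f, o ≠ w → A o f → A' o f) (hAw : ∀ f, A y f → A' w f)
    (hnw : ∀ x, Rch h A r x → x ≠ w) (H : Rch h A r x) :
    (x = y ∧ Rch h' A' r w) ∨ Rch h' A' r x := by
  induction H with
  | refl => exact .inr .refl
  | @tail b z hb e' ih =>
    obtain ⟨f, hf, e'⟩ := e'
    have hbw := hnw _ hb
    by_cases hcase : b = p ∧ f = d
    · obtain ⟨rfl, rfl⟩ := hcase
      obtain rfl : y = z := Option.some_injective _ (hy.symm.trans e')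
      rcases ih with ⟨rfl, -⟩ | ih
      · exact absurd rfl hpy
      · exact .inl ⟨rfl, ih.tail ⟨f, hA _ _ hbw hf, hs.self⟩⟩
    · have e2 : h'.child b f = some z := by rw [hs.other _ _ hcase, e']
      rcases ih with ⟨rfl, hw'⟩ | ih
      · refine .inr (hw'.tail ⟨f, hAw _ hf, ?_⟩)
        rw [hs.other _ _ (by rintro ⟨rfl, -⟩; exact hpw rfl), hw, e']
      · exact .inr (ih.tail ⟨f, hA _ _ hbw hf, e2⟩)
end

/-! ### The tree invariant -/

/-- The deletions with two children that are between linking the copy and unlinking the successor: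
`P w = some (k, cs)` if `w` is the copy, `k` the deleted key and `cs` the successor, whose key `w`
shares. -/
abbrev Pend := ℕ → Option (Key × ℕ)

/-- The least key of the interval that node `o` stands for: a copy stands for everything between
the deleted key and its own. -/
def lowKey (h : Heap) (P : Pend) (o : ℕ) : Key :=
  match P o with
  | some (k, _) => k
  | none => (h o).key

/-- `z` is the successor in an unfinished deletion, whose copy shares its key. -/
def PendSucc (P : Pend) (z : ℕ) : Prop := ∃ w k, P w = some (k, z)

/-- The state of an unfinished deletion of `k` with two children. The key of the left child keeps
successors of smaller keys below `k`. -/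
structure PendOK (h : Heap) (P : Pend) (w : ℕ) (k : Key) (cs : ℕ) : Prop where
  inTree : InTree h w
  chain : ∃ r, h.child w true = some r ∧ Rch h LeftDir r cs
  left_cs : h.child cs false = none
  lt : k < (h w).key
  key_cs : (h cs).key = (h w).key
  cs_none : P cs = none
  left_w : ∃ a, h.child w false = some a ∧ (h a).key < k

/-- The shape of the shared tree: a binary search tree, up to the duplicate keys of unfinished
deletions. -/
structure TreeInv (h : Heap) (P : Pend) : Prop where
  parent_unique : ∀ {p q d e z}, InTree h p → InTree h q → h.child p d = some z →
    h.child q e = some z → p = q ∧ d = e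
  root_orphan : ∀ {p d}, InTree h p → h.child p d ≠ some rootId
  left_lt : ∀ {q r z}, InTree h q → h.child q false = some r → Rch h AnyDir r z →
    (h z).key < (h q).key
  right_gt : ∀ {q r z}, InTree h q → h.child q true = some r → Rch h AnyDir r z →
    (h q).key < lowKey h P z ∨ ∃ k, P q = some (k, z)
  pend : ∀ {w k cs}, P w = some (k, cs) → PendOK h P w k cs

section
variable {h h' : Heap} {P P' : Pend} {p : ℕ} {d : Bool} {r x y w z cs : ℕ} {k : Key}

theorem PendOK.cs_inTree (H : PendOK h P w k cs) : InTree h cs := by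
  obtain ⟨r, e, hr⟩ := H.chain
  exact (H.inTree.child e).desc hr.toDesc

theorem lowKey_none (e : P z = none) : lowKey h P z = (h z).key := by simp [lowKey, e]

theorem lowKey_some (e : P z = some (k, cs)) : lowKey h P z = k := by simp [lowKey, e]

theorem TreeInv.lowKey_le (T : TreeInv h P) (z : ℕ) : lowKey h P z ≤ (h z).key := by
  unfold lowKey
  split
  · next e => exact (T.pend e).lt.le
  · exact le_rfl

theorem TreeInv.right_gt' (T : TreeInv h P) {q : ℕ} (hq : InTree h q) (e : h.child q true = some r)
    (H : Rch h AnyDir r z) (hz : ¬ PendSucc P z) : (h q).key < (h z).key := by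
  rcases T.right_gt hq e H with H | ⟨k, H⟩
  · exact lt_of_lt_of_le H (T.lowKey_le z)
  · exact absurd ⟨_, _, H⟩ hz

theorem TreeInv.right_ge (T : TreeInv h P) {q : ℕ} (hq : InTree h q) (e : h.child q true = some r)
    (H : Rch h AnyDir r z) : (h q).key ≤ (h z).key := by
  rcases T.right_gt hq e H with H | ⟨k, H⟩
  · exact (lt_of_lt_of_le H (T.lowKey_le z)).le
  · exact (T.pend H).key_cs.ge

/-- A node is not in its own right subtree. -/
theorem TreeInv.right_ne (T : TreeInv h P) {q : ℕ} (hq : InTree h q) (e : h.child q true = some r)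
    (H : Rch h AnyDir r z) : z ≠ q := by
  rintro rfl
  rcases T.right_gt hq e H with H | ⟨k, H⟩
  · exact absurd (T.lowKey_le z) (not_le.2 H)
  · exact absurd (T.pend H).cs_none (by simp [H])

theorem TreeInv.child_ne (T : TreeInv h P) (hq : InTree h p) (e : h.child p d = some z) :
    z ≠ p := by
  cases d
  · rintro rfl
    exact absurd (T.left_lt hq e .refl) (lt_irrefl _)
  · exact T.right_ne hq e .refl

/-- In a tree, every search that reaches `x` passes the ancestors of `x`, in the directions of `x`.
-/
theorem TreeInv.passes (T : TreeInv h P) {A : ℕ → Bool → Prop} {q : ℕ} (hx : Rch h A rootId x)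
    (hq : InTree h q) (e : h.child q d = some r) (H : Rch h AnyDir r x) :
    Rch h A rootId q ∧ A q d := by
  induction H with
  | refl =>
    rcases ReflTransGen.cases_tail hx with rfl | ⟨b, hb, f, hf, e'⟩
    · exact absurd e (T.root_orphan hq)
    · obtain ⟨rfl, rfl⟩ := T.parent_unique (Rch.inTree hb) hq e' e
      exact ⟨hb, hf⟩
  | @tail b x hb e' ih =>
    obtain ⟨f, -, e'⟩ := e'
    have hbt : InTree h b := (hq.child e).desc hb
    rcases ReflTransGen.cases_tail hx with rfl | ⟨b', hb', f', hf', e''⟩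
    · exact absurd e' (T.root_orphan hbt)
    · obtain ⟨rfl, rfl⟩ := T.parent_unique (Rch.inTree hb') hbt e'' e'
      exact ih hb'

/-- A node is on the search path for every key that compares as required with its ancestors. -/
theorem std_of_ancestors (hz : InTree h z)
    (H : ∀ q d r, InTree h q → h.child q d = some r → Rch h AnyDir r z → SDir h k q d) :
    Rch h (SDir h k) rootId z := by
  induction hz with
  | refl => exact .refl
  | @tail b z hb e ih =>
    obtain ⟨f, -, e⟩ := e
    exact (ih fun q d r hq e' hr => H q d r hq e' (hr.tail ⟨f, trivial, e⟩)).tail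
      ⟨f, H _ _ _ hb e .refl, e⟩

/-- Every node of the tree is on the standard search path for its own key, except for the successors
of unfinished deletions: the search for their key ends at the copy. -/
theorem TreeInv.own (T : TreeInv h P) (hz : InTree h z) (hp : ¬ PendSucc P z) :
    Rch h (SDir h (h z).key) rootId z := by
  refine std_of_ancestors hz fun q d r hq e hr => ?_
  cases d
  · exact T.left_lt hq e hr
  · exact T.right_gt' hq e hr hp

/-- The last node of a chain of left pointers is the least one below the first. -/
theorem TreeInv.chain_min (T : TreeInv h P) {c : ℕ} (hc : InTree h c) (hl : Rch h LeftDir c cs)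
    (hn : h.child cs false = none) (hP : P cs = none) (H : Rch h AnyDir c z) :
    z = cs ∨ (h cs).key < lowKey h P z := by
  induction hl using ReflTransGen.head_induction_on with
  | refl =>
    rcases ReflTransGen.cases_head H with rfl | ⟨b, ⟨f, -, e⟩, hb⟩
    · exact .inl rfl
    · cases f
      · simp [hn] at e
      · rcases T.right_gt hc e hb with H | ⟨k, H⟩
        · exact .inr H
        · simp [hP] at H
  | @head c b e hl ih =>
    obtain ⟨f, hf, e⟩ := e
    obtain rfl : f = false := hf
    have hcsc : (h cs).key < (h c).key := T.left_lt hc e (Rch.toDesc hl)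
    rcases ReflTransGen.cases_head H with rfl | ⟨b', ⟨f, -, e'⟩, hb⟩
    · right
      rcases hPc : P c with _ | ⟨k, s⟩
      · rwa [lowKey_none hPc]
      · rw [lowKey_some hPc]
        obtain ⟨a, ea, ha⟩ := (T.pend hPc).left_w
        obtain rfl : a = b := Option.some_injective _ (ea.symm.trans e)
        rcases ReflTransGen.cases_head hl with rfl | ⟨b', ⟨f, hf, e'⟩, hb⟩
        · exact ha
        · obtain rfl : f = false := hf
          exact lt_trans (T.left_lt (hc.child e) e' (Rch.toDesc hb)) ha
    · cases f
      · obtain rfl : b = b' := Option.some_injective _ (e.symm.trans e')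
        exact ih (hc.child e) hb
      · rcases T.right_gt hc e' hb with H | ⟨k, H⟩
        · exact .inr (lt_trans hcsc H)
        · right
          have := T.pend H
          rw [lowKey_none this.cs_none, this.key_cs]
          exact hcsc

/-- The tree invariant depends only on the keys and child pointers of the nodes in the tree. -/
theorem TreeInv.congr (T : TreeInv h P)
    (hk : ∀ o, InTree h o → (h' o).key = (h o).key)
    (hc : ∀ o d, InTree h o → h'.child o d = h.child o d) :
    TreeInv h' P ∧ ∀ o, InTree h' o ↔ InTree h o := by
  have desc : ∀ {x z}, InTree h x → Rch h' AnyDir x z → Rch h AnyDir x z := by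
    intro x z hx H
    induction H with
    | refl => exact .refl
    | tail _ e ih =>
      obtain ⟨f, -, e⟩ := e
      rw [hc _ _ (hx.desc ih)] at e
      exact ih.tail ⟨f, trivial, e⟩
  have it : ∀ o, InTree h' o ↔ InTree h o := fun o =>
    ⟨fun H => desc (inTree_root h) H, fun H => H.congr hc fun _ _ _ _ => trivial⟩
  have low : ∀ {z}, InTree h z → lowKey h' P z = lowKey h P z := by
    intro z hz
    simp only [lowKey, hk z hz]
  refine ⟨⟨?_, ?_, ?_, ?_, ?_⟩, it⟩
  · intro p q d e z hp hq e1 e2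
    rw [it] at hp hq
    rw [hc _ _ hp] at e1
    rw [hc _ _ hq] at e2
    exact T.parent_unique hp hq e1 e2
  · intro p d hp
    rw [it] at hp
    rw [hc _ _ hp]
    exact T.root_orphan hp
  · intro q r z hq e H
    rw [it] at hq
    rw [hc _ _ hq] at e
    have H' := desc (hq.child e) H
    rw [hk _ hq, hk _ ((hq.child e).desc H')]
    exact T.left_lt hq e H'
  · intro q r z hq e H
    rw [it] at hq
    rw [hc _ _ hq] at e
    have H' := desc (hq.child e) H
    rw [hk _ hq, low ((hq.child e).desc H')]
    exact T.right_gt hq e H'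
  · intro w k cs hw
    have W := T.pend hw
    obtain ⟨r, e, hr⟩ := W.chain
    obtain ⟨a, ea, ha⟩ := W.left_w
    have hcs := W.cs_inTree
    refine ⟨(it _).2 W.inTree, ⟨r, by rw [hc _ _ W.inTree, e], ?_⟩, by rw [hc _ _ hcs, W.left_cs],
      by rw [hk _ W.inTree]; exact W.lt, by rw [hk _ W.inTree, hk _ hcs, W.key_cs], W.cs_none,
      ⟨a, by rw [hc _ _ W.inTree, ea], by rw [hk _ (W.inTree.child ea)]; exact ha⟩⟩
    have hrt := W.inTree.child e
    clear hcs e W hw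
    induction hr with
    | refl => exact .refl
    | tail hb e ih =>
      obtain ⟨f, hf, e⟩ := e
      exact ih.tail ⟨f, hf, by rw [hc _ _ (hrt.desc (Rch.toDesc hb)), e]⟩

/-- Linking a fresh leaf `z` where the search for its key ends preserves the tree invariant. -/
theorem TreeInv.insert (T : TreeInv h P) (hs : SetChild h h' p d (some z))
    (h0 : h.child p d = none) (hp : Rch h (SDir h (h z).key) rootId p)
    (hd : SDir h (h z).key p d) (hz : ¬ InTree h z) (hleaf : ∀ e, h.child z e = none)
    (hpend : ¬ PendSucc P p) :
    TreeInv h' P ∧ ∀ o, InTree h' o ↔ InTree h o ∨ o = z := by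
  have hpt := hp.inTree
  have hzr : z ≠ rootId := by rintro rfl; exact hz (inTree_root h)
  have hpz : p ≠ z := by rintro rfl; exact hz hpt
  have fwd : ∀ {A : ℕ → Bool → Prop} {x z}, Rch h A x z → Rch h' A x z :=
    fun H => insert_forward hs h0 (fun _ _ H => H) H
  have child' : ∀ {q e s}, InTree h q → h'.child q e = some s →
      h.child q e = some s ∨ (q = p ∧ e = d ∧ s = z) := by
    intro q e s hq H
    by_cases hc : q = p ∧ e = d
    · obtain ⟨rfl, rfl⟩ := hc
      rw [hs.self] at H
      exact .inr ⟨rfl, rfl, (Option.some_injective _ H).symm⟩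
    · rw [hs.other _ _ hc] at H
      exact .inl H
  have leaf' : ∀ e, h'.child z e = none := by
    intro e
    rw [hs.other _ _ (by rintro ⟨rfl, -⟩; exact hpz rfl), hleaf]
  have desc : ∀ {x s}, InTree h x → Rch h' AnyDir x s →
      (Rch h AnyDir x s ∨ (s = z ∧ Rch h AnyDir x p)) := by
    intro x s hx H
    induction H with
    | refl => exact .inl .refl
    | @tail b c _ e ih =>
      obtain ⟨f, -, e⟩ := e
      rcases ih with ih | ⟨rfl, ih⟩
      · rcases child' (hx.desc ih) e with e | ⟨rfl, rfl, rfl⟩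
        · exact .inl (ih.tail ⟨f, trivial, e⟩)
        · exact .inr ⟨rfl, ih⟩
      · simp [leaf'] at e
  have it : ∀ o, InTree h' o ↔ InTree h o ∨ o = z := by
    intro o
    constructor
    · intro H
      rcases desc (inTree_root h) H with H | ⟨rfl, -⟩
      · exact .inl H
      · exact .inr rfl
    · rintro (H | rfl)
      · exact fwd H
      · exact InTree.child (fwd hpt) hs.self
  have low : ∀ o, lowKey h' P o = lowKey h P o := fun o => by simp only [lowKey, hs.key]
  have hPz : P z = none := by
    rcases e : P z with _ | ⟨k, cs⟩
    · rfl
    · exact absurd (T.pend e).inTree hz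
  have nz : ∀ {q e s}, InTree h' q → h'.child q e = some s → InTree h q := by
    intro q e s hq H
    rcases (it q).1 hq with hq | rfl
    · exact hq
    · simp [leaf'] at H
  -- the new leaf compares with its ancestors as the search for its key does
  have key : ∀ {q e s x}, InTree h' q → h'.child q e = some s → Rch h' AnyDir s x →
      (InTree h q ∧ h.child q e = some s ∧ Rch h AnyDir s x) ∨
      (InTree h q ∧ x = z ∧ SDir h (h z).key q e) := by
    intro q e s x hq H Hx
    have hqt := nz hq H
    rcases child' hqt H with H | ⟨rfl, rfl, rfl⟩
    · rcases desc (hqt.child H) Hx with Hx | ⟨rfl, Hx⟩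
      · exact .inl ⟨hqt, H, Hx⟩
      · exact .inr ⟨hqt, rfl, (T.passes hp hqt H Hx).2⟩
    · rcases ReflTransGen.cases_head Hx with rfl | ⟨b, ⟨f, -, e⟩, hb⟩
      · exact .inr ⟨hqt, rfl, hd⟩
      · simp [leaf'] at e
  refine ⟨⟨?_, ?_, ?_, ?_, ?_⟩, it⟩
  · intro q q' e e' s hq hq' e1 e2
    rcases child' (nz hq e1) e1 with H1 | ⟨rfl, rfl, rfl⟩ <;>
      rcases child' (nz hq' e2) e2 with H2 | ⟨rfl, rfl, H2⟩
    · exact T.parent_unique (nz hq e1) (nz hq' e2) H1 H2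
    · subst H2; exact absurd ((nz hq e1).child H1) hz
    · exact absurd ((nz hq' e2).child H2) hz
    · exact ⟨rfl, rfl⟩
  · intro q e hq H
    rcases child' (nz hq H) H with H1 | ⟨-, -, H1⟩
    · exact T.root_orphan (nz hq H) H1
    · exact hzr H1.symm
  · intro q s x hq e H
    rw [hs.key, hs.key]
    rcases key hq e H with ⟨hq, e, H⟩ | ⟨hq, rfl, H⟩
    · exact T.left_lt hq e H
    · exact H
  · intro q s x hq e H
    rw [hs.key, low]
    rcases key hq e H with ⟨hq, e, H⟩ | ⟨hq, rfl, H⟩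
    · exact T.right_gt hq e H
    · exact .inl (by rw [lowKey_none hPz]; exact H)
  · intro w k cs hw
    have W := T.pend hw
    obtain ⟨r, e, hr⟩ := W.chain
    obtain ⟨a, ea, ha⟩ := W.left_w
    have keep : ∀ {q e s}, h.child q e = some s → h'.child q e = some s := by
      intro q e s H
      rw [hs.other _ _ (by rintro ⟨rfl, rfl⟩; simp [h0] at H), H]
    refine ⟨(it _).2 (.inl W.inTree), ⟨r, keep e, fwd hr⟩, ?_, by rw [hs.key]; exact W.lt,
      by rw [hs.key, hs.key, W.key_cs], W.cs_none, ⟨a, keep ea, by rw [hs.key]; exact ha⟩⟩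
    rw [hs.other _ _ (by rintro ⟨rfl, -⟩; exact hpend ⟨_, _, hw⟩), W.left_cs]
end

/-! ### Unlinking a node and linking a copy -/

section
variable {h h' : Heap} {P P' : Pend} {p : ℕ} {d : Bool} {c : Ptr} {r x y w z cs : ℕ} {k : Key}

/-- Unlinking a node `y` with a null child preserves the tree invariant. If `y` is the successor of
an unfinished deletion, then this finishes the deletion. -/
theorem TreeInv.splice (T : TreeInv h P) {e : Bool} (hs : SetChild h h' p d c)
    (hp : InTree h p) (hy : h.child p d = some y) (hc : h.child y e = c)
    (hn : h.child y (!e) = none) (hPy : P y = none)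
    (hP : ∀ w k z, P' w = some (k, z) → P w = some (k, z) ∧ z ≠ y ∧ w ≠ p ∧ z ≠ p)
    (hP' : ∀ w k z, P w = some (k, z) → P' w = some (k, z) ∨ (P' w = none ∧ z = y)) :
    TreeInv h' P' ∧ ∀ o, InTree h' o ↔ InTree h o ∧ o ≠ y := by
  have hyp : y ≠ p := T.child_ne hp hy
  have hyr : y ≠ rootId := by rintro rfl; exact T.root_orphan hp hy
  have hyt := hp.child hy
  have hyc : ∀ {f}, h.child y f ≠ some y := fun H => T.child_ne hyt H rfl
  -- a pointer of the new heap is an old one, or it bypasses `y`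
  have child' : ∀ {q f s}, h'.child q f = some s →
      (¬ (q = p ∧ f = d) ∧ h.child q f = some s) ∨ (q = p ∧ f = d ∧ h.child y e = some s) := by
    intro q f s H
    by_cases hcase : q = p ∧ f = d
    · obtain ⟨rfl, rfl⟩ := hcase
      rw [hs.self] at H
      exact .inr ⟨rfl, rfl, by rw [hc, H]⟩
    · rw [hs.other _ _ hcase] at H
      exact .inl ⟨hcase, H⟩
  have desc : ∀ {x s}, Rch h' AnyDir x s → Rch h AnyDir x s := by
    intro x s H
    induction H with
    | refl => exact .refl
    | tail _ e' ih =>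
      obtain ⟨f, -, e'⟩ := e'
      rcases child' e' with ⟨-, e'⟩ | ⟨rfl, rfl, e'⟩
      · exact ih.tail ⟨f, trivial, e'⟩
      · exact (ih.tail ⟨_, trivial, hy⟩).tail ⟨_, trivial, e'⟩
  have noty : ∀ {q f}, InTree h q → h'.child q f ≠ some y := by
    intro q f hq H
    rcases child' H with ⟨hne, H⟩ | ⟨-, -, H⟩
    · exact hne (T.parent_unique hq hp H hy)
    · exact hyc H
  have it : ∀ o, InTree h' o ↔ InTree h o ∧ o ≠ y := by
    intro o
    constructor
    · intro H
      refine ⟨desc H, ?_⟩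
      rintro rfl
      rcases ReflTransGen.cases_tail H with H | ⟨b, hb, f, -, H⟩
      · exact hyr H
      · exact noty (desc hb) H
    · rintro ⟨H, hne⟩
      rcases splice_forward hs hy hc hn hyp.symm (fun _ _ H => H) H with H | H
      · exact absurd H.1 hne
      · exact H
  have sub : ∀ {q f s x}, h'.child q f = some s → Rch h' AnyDir s x →
      ∃ s', h.child q f = some s' ∧ Rch h AnyDir s' x := by
    intro q f s x H Hx
    rcases child' H with ⟨-, H⟩ | ⟨rfl, rfl, H⟩
    · exact ⟨s, H, desc Hx⟩
    · exact ⟨y, hy, (desc Hx).head ⟨_, trivial, H⟩⟩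
  have low : ∀ o, o ≠ y → lowKey h P o ≤ lowKey h' P' o := by
    intro o ho
    rcases e1 : P o with _ | ⟨k, s⟩
    · have : P' o = none := by
        rcases e2 : P' o with _ | ⟨k, s⟩
        · rfl
        · have := (hP _ _ _ e2).1
          simp [e1] at this
      rw [lowKey_none e1, lowKey_none this, hs.key]
    · rcases hP' _ _ _ e1 with e2 | ⟨e2, -⟩
      · rw [lowKey_some e1, lowKey_some e2]
      · rw [lowKey_some e1, lowKey_none e2, hs.key]
        exact (T.pend e1).lt.le
  refine ⟨⟨?_, ?_, ?_, ?_, ?_⟩, it⟩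
  · intro q q' f f' s hq hq' e1 e2
    have hq := ((it _).1 hq).1
    have hq' := ((it _).1 hq').1
    have hsy : s ≠ y := by rintro rfl; exact noty hq e1
    rcases child' e1 with ⟨h1, H1⟩ | ⟨rfl, rfl, H1⟩ <;>
      rcases child' e2 with ⟨h2, H2⟩ | ⟨rfl, rfl, H2⟩
    · exact T.parent_unique hq hq' H1 H2
    · exact absurd (T.parent_unique hq hyt H1 H2).1 (by
        rintro rfl
        rename_i hqq _
        exact ((it _).1 hqq).2 rfl)
    · exact absurd (T.parent_unique hq' hyt H2 H1).1 (by
        rintro rfl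
        rename_i hqq
        exact ((it _).1 hqq).2 rfl)
    · exact ⟨rfl, rfl⟩
  · intro q f hq H
    have hq := ((it _).1 hq).1
    rcases child' H with ⟨-, H⟩ | ⟨-, -, H⟩
    · exact T.root_orphan hq H
    · exact T.root_orphan hyt H
  · intro q s x hq H Hx
    obtain ⟨s', H, Hx⟩ := sub H Hx
    rw [hs.key, hs.key]
    exact T.left_lt ((it _).1 hq).1 H Hx
  · intro q s x hq H Hx
    have hxy : x ≠ y := ((it _).1 ((hq.child H).desc Hx)).2
    obtain ⟨s', H, Hx⟩ := sub H Hx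
    rw [hs.key]
    rcases T.right_gt ((it _).1 hq).1 H Hx with H | ⟨k, H⟩
    · exact .inl (lt_of_lt_of_le H (low x hxy))
    · rcases hP' _ _ _ H with H | ⟨-, rfl⟩
      · exact .inr ⟨k, H⟩
      · exact absurd rfl hxy
  · intro w k cs hw'
    obtain ⟨hw, hcsy, hwp, hcsp⟩ := hP _ _ _ hw'
    have W := T.pend hw
    obtain ⟨r, er, hr⟩ := W.chain
    obtain ⟨a, ea, ha⟩ := W.left_w
    have hry : r ≠ y := by
      rintro rfl
      exact hwp (T.parent_unique W.inTree hp er hy).1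
    refine ⟨(it _).2 ⟨W.inTree, by rintro rfl; simp [hPy] at hw⟩, ⟨r, ?_, ?_⟩, ?_,
      by rw [hs.key]; exact W.lt, by rw [hs.key, hs.key, W.key_cs], ?_,
      ⟨a, ?_, by rw [hs.key]; exact ha⟩⟩
    · rw [hs.other _ _ (fun H => hwp H.1), er]
    · rcases splice_forward hs hy hc hn hyp.symm (fun _ _ H => H) hr with H | H
      · exact absurd H.1 hcsy
      · exact H
    · rw [hs.other _ _ (fun H => hcsp H.1), W.left_cs]
    · rcases e2 : P' cs with _ | ⟨k, s⟩
      · rfl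
      · have := (hP _ _ _ e2).1
        simp [W.cs_none] at this
    · rw [hs.other _ _ (fun H => hwp H.1), ea]

/-- Replacing a node `y` with two children by a copy `w` of it that has the key of the successor of
`y` preserves the tree invariant and starts the second phase of the deletion. -/
theorem TreeInv.link (T : TreeInv h P) (hs : SetChild h h' p d (some w))
    (hp : InTree h p) (hy : h.child p d = some y) (hw : ∀ e, h.child w e = h.child y e)
    (hwt : ¬ InTree h w) (hPy : P y = none) (hyS : ¬ PendSucc P y)
    (hpend : ∀ w' k z, P w' = some (k, z) → w' ≠ p ∧ z ≠ p)
    (hch : ∃ r, h.child y true = some r ∧ Rch h LeftDir r cs) (hcs : h.child cs false = none)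
    (hPcs : P cs = none) (hcsS : ¬ PendSucc P cs) (hl : h.child y false ≠ none)
    (hkw : (h w).key = (h cs).key) :
    TreeInv h' (Function.update P w (some ((h y).key, cs))) ∧
      ∀ o, InTree h' o ↔ (InTree h o ∧ o ≠ y) ∨ o = w := by
  have hyp : y ≠ p := T.child_ne hp hy
  have hyr : y ≠ rootId := by rintro rfl; exact T.root_orphan hp hy
  have hyt := hp.child hy
  have hyc : ∀ {f}, h.child y f ≠ some y := fun H => T.child_ne hyt H rfl
  have hwp : w ≠ p := by rintro rfl; exact hwt hp
  have hwy : w ≠ y := by rintro rfl; exact hwt hyt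
  have hwr : w ≠ rootId := by rintro rfl; exact hwt (inTree_root h)
  obtain ⟨r, er, hr⟩ := hch
  obtain ⟨a, ea⟩ := Option.ne_none_iff_exists'.1 hl
  have hrt : InTree h r := hyt.child er
  have hcst : InTree h cs := hrt.desc (Rch.toDesc hr)
  have hcsw : cs ≠ w := by rintro rfl; exact hwt hcst
  have hcsy : cs ≠ y := T.right_ne hyt er (Rch.toDesc hr)
  -- `σ` maps the copy to the original
  obtain ⟨σ, hσw, hσ⟩ : ∃ σ : ℕ → ℕ, σ w = y ∧ ∀ o, o ≠ w → σ o = o :=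
    ⟨fun o => if o = w then y else o, by simp, fun o ho => by simp [ho]⟩
  have hww : ∀ f, h'.child w f = h.child y f := by
    intro f
    rw [hs.other _ _ (fun H => hwp H.1), hw]
  have child' : ∀ {q f s}, InTree h (σ q) → h'.child q f = some s →
      h.child (σ q) f = some (σ s) ∧ (s = w → q = p ∧ f = d) := by
    intro q f s hq H
    by_cases hcase : q = p ∧ f = d
    · obtain ⟨rfl, rfl⟩ := hcase
      rw [hs.self] at H
      obtain rfl := Option.some_injective _ H
      rw [hσ _ hwp.symm, hσw]
      exact ⟨hy, fun _ => ⟨rfl, rfl⟩⟩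
    · have key : h.child (σ q) f = some s := by
        by_cases hqw : q = w
        · subst hqw
          rw [hσw, ← hww, H]
        · rw [hσ _ hqw, ← hs.other _ _ hcase, H]
      have hsw : s ≠ w := by rintro rfl; exact hwt (hq.child key)
      rw [hσ _ hsw]
      exact ⟨key, fun H => absurd H hsw⟩
  have desc : ∀ {x s}, InTree h (σ x) → Rch h' AnyDir x s → Rch h AnyDir (σ x) (σ s) := by
    intro x s hx H
    induction H with
    | refl => exact .refl
    | tail _ e ih =>
      obtain ⟨f, -, e⟩ := e
      exact ih.tail ⟨f, trivial, (child' (hx.desc ih) e).1⟩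
  have hσt : ∀ {o}, InTree h' o → InTree h (σ o) := by
    intro o H
    have := desc (x := rootId) (by rw [hσ _ hwr.symm]; exact inTree_root h) H
    rwa [hσ _ hwr.symm] at this
  have noty : ∀ {q f}, InTree h (σ q) → h'.child q f ≠ some y := by
    intro q f hq H
    have h1 := child' hq H
    rw [hσ _ hwy.symm] at h1
    obtain ⟨h2, rfl⟩ := T.parent_unique hq hp h1.1 hy
    have h3 : q = p := by
      by_cases hqw : q = w
      · subst hqw; rw [hσw] at h2; exact absurd h2 hyp
      · rwa [hσ _ hqw] at h2
    subst h3
    rw [hs.self] at H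
    exact hwy (Option.some_injective _ H)
  have fwd : ∀ {x z}, InTree h x → Rch h AnyDir x z → (z = y ∧ Rch h' AnyDir x w) ∨ Rch h' AnyDir x z :=
    fun hx H => link_forward hs hy hw hwp.symm hyp.symm (fun _ _ _ H => H) (fun _ H => H)
      (fun z hz => by rintro rfl; exact hwt (hx.desc hz)) H
  have hyt' : ∀ {o}, InTree h' o → o ≠ y := by
    rintro _ H rfl
    rcases ReflTransGen.cases_tail H with H | ⟨b, hb, f, -, H⟩
    · exact hyr H
    · exact noty (hσt hb) H
  have hpt' : InTree h' p := by
    rcases fwd (inTree_root h) hp with H | H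
    · exact absurd H.1 hyp.symm
    · exact H
  have it : ∀ o, InTree h' o ↔ (InTree h o ∧ o ≠ y) ∨ o = w := by
    intro o
    constructor
    · intro H
      by_cases ho : o = w
      · exact .inr ho
      · have := hσt H
        rw [hσ _ ho] at this
        exact .inl ⟨this, hyt' H⟩
    · rintro (⟨H, hne⟩ | rfl)
      · rcases fwd (inTree_root h) H with H | H
        · exact absurd H.1 hne
        · exact H
      · exact hpt'.child hs.self
  have lowσ : ∀ o, o ≠ y → lowKey h' (Function.update P w (some ((h y).key, cs))) o
      = lowKey h P (σ o) := by
    intro o ho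
    by_cases how : o = w
    · subst how
      rw [hσw, lowKey_none hPy, lowKey_some (Function.update_self ..)]
    · rw [hσ _ how]
      simp only [lowKey, Function.update_of_ne how, hs.key]
  have hky : (h y).key < (h cs).key := by
    rcases T.right_gt hyt er (Rch.toDesc hr) with H | ⟨k, H⟩
    · rwa [lowKey_none hPcs] at H
    · exact absurd ⟨_, _, H⟩ hcsS
  refine ⟨⟨?_, ?_, ?_, ?_, ?_⟩, it⟩
  · intro q q' f f' s hq hq' e1 e2
    have h1 := child' (hσt hq) e1
    have h2 := child' (hσt hq') e2
    obtain ⟨h3, rfl⟩ := T.parent_unique (hσt hq) (hσt hq') h1.1 h2.1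
    refine ⟨?_, rfl⟩
    by_cases h5 : q = w <;> by_cases h6 : q' = w
    · rw [h5, h6]
    · subst h5
      rw [hσw, hσ _ h6] at h3
      exact absurd h3.symm (hyt' hq')
    · subst h6
      rw [hσw, hσ _ h5] at h3
      exact absurd h3 (hyt' hq)
    · rwa [hσ _ h5, hσ _ h6] at h3
  · intro q f hq H
    have := (child' (hσt hq) H).1
    rw [hσ _ hwr.symm] at this
    exact T.root_orphan (hσt hq) this
  · intro q s x hq e H
    have e1 := (child' (hσt hq) e).1
    have H1 := desc ((hσt hq).child e1) H
    have hxt := (hq.child e).desc H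
    have lt := T.left_lt (hσt hq) e1 H1
    rw [hs.key, hs.key]
    by_cases h5 : q = w
    · subst h5
      have hxw : x ≠ q := by
        rintro rfl
        rw [hσw] at lt
        exact lt_irrefl _ lt
      rw [hσw, hσ _ hxw] at lt
      rw [hkw]
      exact lt_trans lt hky
    · rw [hσ _ h5] at lt e1
      by_cases h6 : x = w
      · subst h6
        rw [hσw] at H1
        rw [hkw]
        exact T.left_lt (by rw [← hσ _ h5]; exact hσt hq) e1
          (H1.trans ((Rch.toDesc hr).head ⟨_, trivial, er⟩))
      · rwa [hσ _ h6] at lt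
  · intro q s x hq e H
    have e1 := (child' (hσt hq) e).1
    have H1 := desc ((hσt hq).child e1) H
    have hxt := (hq.child e).desc H
    rw [hs.key, lowσ _ (hyt' hxt)]
    by_cases h5 : q = w
    · subst h5
      rw [hσw, er] at e1
      obtain h8 := Option.some_injective _ e1
      rw [← h8] at H1
      have hxw : x ≠ q := by
        rintro rfl
        rw [hσw] at H1
        exact T.right_ne hyt er H1 rfl
      rw [hσ _ hxw] at H1 ⊢
      rcases T.chain_min hrt hr hcs hPcs H1 with rfl | H
      · exact .inr ⟨_, Function.update_self ..⟩
      · left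
        rwa [hkw]
    · rw [hσ _ h5] at e1
      have hqt : InTree h q := by rw [← hσ _ h5]; exact hσt hq
      rcases T.right_gt hqt e1 H1 with H | ⟨k, H⟩
      · exact .inl H
      · by_cases h6 : x = w
        · subst h6
          rw [hσw] at H
          exact absurd ⟨_, _, H⟩ hyS
        · rw [hσ _ h6] at H
          exact .inr ⟨k, by rw [Function.update_of_ne h5, H]⟩
  · intro w' k z hP
    by_cases h5 : w' = w
    · subst h5
      rw [Function.update_self] at hP
      simp only [Option.some.injEq, Prod.mk.injEq] at hP
      obtain ⟨rfl, rfl⟩ := hP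
      refine ⟨(it _).2 (.inr rfl), ⟨r, by rw [hww, er], ?_⟩, ?_, ?_, ?_, ?_, ⟨a, by rw [hww, ea],
        ?_⟩⟩
      · rcases link_forward (A' := LeftDir) hs hy hw hwp.symm hyp.symm (fun _ _ _ H => H)
          (fun _ H => H) (fun z hz => by rintro rfl; exact hwt (hrt.desc (Rch.toDesc hz))) hr with H | H
        · exact absurd H.1 hcsy
        · exact H
      · rw [hs.other _ _ (by rintro ⟨rfl, rfl⟩; simp [hcs] at hy), hcs]
      · rw [hs.key, hkw]; exact hky
      · rw [hs.key, hs.key, hkw]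
      · rw [Function.update_of_ne hcsw, hPcs]
      · rw [hs.key]
        exact T.left_lt hyt ea .refl
    · rw [Function.update_of_ne h5] at hP
      have W := T.pend hP
      obtain ⟨hw'p, hzp⟩ := hpend _ _ _ hP
      obtain ⟨r', er', hr'⟩ := W.chain
      obtain ⟨a', ea', ha'⟩ := W.left_w
      have hzw : z ≠ w := by rintro rfl; exact hwt W.cs_inTree
      refine ⟨(it _).2 (.inl ⟨W.inTree, by rintro rfl; simp [hPy] at hP⟩),
        ⟨r', by rw [hs.other _ _ (fun H => hw'p H.1), er'], ?_⟩,
        by rw [hs.other _ _ (fun H => hzp H.1), W.left_cs], by rw [hs.key]; exact W.lt,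
        by rw [hs.key, hs.key, W.key_cs], by rw [Function.update_of_ne hzw, W.cs_none],
        ⟨a', by rw [hs.other _ _ (fun H => hw'p H.1), ea'], by rw [hs.key]; exact ha'⟩⟩
      rcases link_forward (A' := LeftDir) hs hy hw hwp.symm hyp.symm (fun _ _ _ H => H)
          (fun _ H => H) (fun z hz => by
            rintro rfl
            exact hwt ((W.inTree.child er').desc (Rch.toDesc hz))) hr' with H | H
      · obtain ⟨rfl, -⟩ := H
        exact absurd ⟨_, _, hP⟩ hyS
      · exact H

/-- Linking the copy takes away standard reachability, for the keys from the deleted one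
(exclusively) to that of the successor, along the chain of left pointers to the successor. -/
theorem TreeInv.link_std (T : TreeInv h P) (hs : SetChild h h' p d (some w))
    (hp : InTree h p) (hy : h.child p d = some y) (hw : ∀ e, h.child w e = h.child y e)
    (hwt : ¬ InTree h w) (er : h.child y true = some r) (hr : Rch h LeftDir r cs)
    (hcs : h.child cs false = none)
    (hkw : (h w).key = (h cs).key) (hky : (h y).key < (h cs).key)
    (H : Rch h (SDir h k) rootId x) :
    x = y ∨ Rch h' (SDir h' k) rootId x ∨
      (k ≤ (h cs).key ∧ Rch h LeftDir r x ∧ Rch h LeftDir x cs) := by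
  have hyp : y ≠ p := T.child_ne hp hy
  have hyt := hp.child hy
  have hrt := hyt.child er
  have hwp : w ≠ p := by rintro rfl; exact hwt hp
  have hA : ∀ o f, SDir h k o f → SDir h' k o f := fun o f H => by
    cases f <;> simpa only [SDir, hs.key] using H
  by_cases hk : (h y).key < k ∧ k ≤ (h cs).key
  · induction H with
    | refl => exact .inr (.inl .refl)
    | @tail b z hb e ih =>
      obtain ⟨f, hf, e⟩ := e
      rcases ih with rfl | ih | ⟨-, h1, h2⟩
      · cases f
        · exact absurd (lt_trans hf hk.1) (lt_irrefl _)
        · obtain rfl := Option.some_injective _ (er.symm.trans e)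
          exact .inr (.inr ⟨hk.2, .refl, hr⟩)
      · by_cases hcase : b = p ∧ f = d
        · obtain ⟨rfl, rfl⟩ := hcase
          exact .inl (Option.some_injective _ (hy.symm.trans e)).symm
        · exact .inr (.inl (ih.tail ⟨f, hA _ _ hf, by rw [hs.other _ _ hcase, e]⟩))
      · right; right
        have hbt : InTree h b := hrt.desc (Rch.toDesc h1)
        rcases ReflTransGen.cases_head h2 with rfl | ⟨b', ⟨f', hf', e'⟩, hb'⟩
        · cases f
          · simp [hcs] at e
          · exact absurd (lt_of_lt_of_le hf hk.2) (lt_irrefl _)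
        · obtain rfl : f' = false := hf'
          have hlt : (h cs).key < (h b).key := T.left_lt hbt e' (Rch.toDesc hb')
          cases f
          · obtain rfl := Option.some_injective _ (e.symm.trans e')
            exact ⟨hk.2, h1.tail ⟨false, rfl, e⟩, hb'⟩
          · exact absurd (lt_trans (lt_of_lt_of_le hf hk.2) hlt) (lt_irrefl _)
  · have hAw : ∀ f, SDir h k y f → SDir h' k w f := by
      intro f hf
      cases f
      · simp only [SDir, cond_false, hs.key, hkw] at hf ⊢
        exact lt_trans hf hky
      · simp only [SDir, cond_true, hs.key, hkw] at hf ⊢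
        by_contra hcon
        exact hk ⟨hf, not_lt.1 hcon⟩
    rcases link_forward (A' := SDir h' k) hs hy hw hwp.symm hyp.symm (fun o f _ H => hA o f H)
      hAw (fun z hz => by rintro rfl; exact hwt (Rch.inTree hz)) H with H | H
    · exact .inl H.1
    · exact .inr (.inl H)

/-! ### Weak reachability -/

/-- The ghost key of a node is its key or, if it is the copy in an unfinished deletion, possibly the
deleted key. -/
def GhostOK (h : Heap) (P : Pend) (g : ℕ → Key) : Prop :=
  ∀ o, g o = (h o).key ∨ ∃ k cs, P o = some (k, cs) ∧ g o = k

theorem GhostOK.le {g : ℕ → Key} (G : GhostOK h P g) (T : TreeInv h P) (o : ℕ) :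
    g o ≤ (h o).key := by
  rcases G o with H | ⟨k, cs, H, e⟩
  · exact H.le
  · rw [e]; exact (T.pend H).lt.le

theorem GhostOK.low_le {g : ℕ → Key} (G : GhostOK h P g) (T : TreeInv h P) (o : ℕ) :
    lowKey h P o ≤ g o := by
  rcases G o with H | ⟨k, cs, H, e⟩
  · rw [H]; exact T.lowKey_le o
  · rw [e, lowKey_some H]

/-- The weak `k`-search deviates to the right from the standard one at the copy `w` of an unfinished
deletion with successor `cs`. -/
structure Deviates (h : Heap) (P : Pend) (g : ℕ → Key) (k : Key) (w cs : ℕ) : Prop where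
  pend : P w = some (g w, cs)
  lt : g w < k
  le : k ≤ (h w).key
  std : Rch h (SDir h k) rootId w

/-- After a deviation at `w`, a weak search follows the chain of left pointers to the successor. -/
theorem weak_cases (T : TreeInv h P) {g : ℕ → Key} (G : GhostOK h P g)
    (H : Rch h (WDir h g k) rootId x) :
    Rch h (SDir h k) rootId x ∨ ∃ w cs r, Deviates h P g k w cs ∧ h.child w true = some r ∧
      Rch h LeftDir r x ∧ Rch h LeftDir x cs ∧ Rch h (SDir h k) r x := by
  induction H with
  | refl => exact .inl .refl
  | @tail b z hb e ih =>
    obtain ⟨f, hf, e⟩ := e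
    rcases ih with ih | ⟨w, cs, r, D, er, h1, h2, h3⟩
    · by_cases hs : SDir h k b f
      · exact .inl (ih.tail ⟨f, hs, e⟩)
      · right
        cases f
        · exact absurd hf hs
        · simp only [SDir, cond_true, not_lt] at hs
          simp only [WDir, cond_true] at hf
          rcases G b with hg | ⟨k', cs, hP, hg⟩
          · rcases hf with ⟨h1, h2⟩ | ⟨-, h2⟩
            · rw [hg] at h1
              exact absurd h1 (not_lt.2 hs)
            · exact absurd hg h2
          · have W := T.pend hP
            obtain ⟨r, er, hr⟩ := W.chain
            obtain rfl := Option.some_injective _ (er.symm.trans e)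
            refine ⟨b, cs, r, ⟨by rw [hP, hg], ?_, hs, ih⟩, er, .refl, hr, .refl⟩
            rcases hf with ⟨h1, -⟩ | ⟨h1, -⟩
            · exact h1
            · rw [hg, h1]; exact W.lt
    · right
      have W := T.pend D.pend
      have hrt := W.inTree.child er
      have hbt := hrt.desc (Rch.toDesc h1)
      have hcond : SDir h k b f := by
        cases f
        · exact hf
        · exfalso
          simp only [WDir, cond_true] at hf
          rcases T.right_gt W.inTree er (Rch.toDesc h1) with hlt | ⟨k', hP⟩
          · have hkb : k < g b := lt_of_le_of_lt D.le (lt_of_lt_of_le hlt (G.low_le T b))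
            rcases hf with ⟨h4, -⟩ | ⟨h4, h5⟩
            · exact lt_asymm hkb h4
            · rw [h4] at hkb
              exact absurd (G.le T b) (not_le.2 hkb)
          · have hb' : g b = (h b).key := by
              rcases G b with hg | ⟨k2, cs2, hP2, -⟩
              · exact hg
              · simp [(T.pend hP).cs_none] at hP2
            rcases hf with ⟨h4, -⟩ | ⟨-, h5⟩
            · rw [hb', (T.pend hP).key_cs] at h4
              exact absurd h4 (not_lt.2 D.le)
            · exact h5 hb'
      cases f
      · rcases ReflTransGen.cases_head h2 with rfl | ⟨b', ⟨f', hf', e'⟩, hb'⟩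
        · simp [W.left_cs] at e
        · obtain rfl : f' = false := hf'
          obtain rfl := Option.some_injective _ (e.symm.trans e')
          exact ⟨w, cs, r, D, er, h1.tail ⟨false, rfl, e⟩, hb', h3.tail ⟨false, hcond, e⟩⟩
      · -- nodes of the chain have keys at least `k`
        exfalso
        have : (h w).key ≤ (h b).key := T.right_ge W.inTree er (Rch.toDesc h1)
        exact absurd (lt_of_le_of_lt this hcond) (not_lt.2 D.le)

/-- A search for a key up to that of the successor, from the right child of the copy, follows the
chain of left pointers. -/
theorem TreeInv.chain_std (T : TreeInv h P) (hc : InTree h r) (hr : Rch h LeftDir r cs)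
    (hk : k ≤ (h cs).key) : Rch h (SDir h k) r cs := by
  induction hr using ReflTransGen.head_induction_on with
  | refl => exact .refl
  | @head b b' e hl ih =>
    obtain ⟨f, hf, e⟩ := e
    obtain rfl : f = false := hf
    exact (ih (hc.child e)).head
      ⟨false, lt_of_le_of_lt hk (T.left_lt hc e (Rch.toDesc hl)), e⟩
end

/-! ### Hindsight -/

/-- `x` has the property `R`, or it is a frozen node (`Z`) all of whose successors (`N`) are again
such. If nodes lose `R` only after they were frozen, then this is stable, and it holds for all the
nodes that a traversal visits. -/
def Hind (R Z : ℕ → Prop) (N : ℕ → ℕ → Prop) (x : ℕ) : Prop :=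
  ∃ S : Set ℕ, x ∈ S ∧ ∀ x ∈ S, R x ∨ (Z x ∧ ∀ z, N x z → z ∈ S)

section
variable {R Z R' Z' : ℕ → Prop} {N N' : ℕ → ℕ → Prop} {x z : ℕ}

theorem Hind.of (h : R x) : Hind R Z N x := ⟨{x}, rfl, by rintro _ rfl; exact .inl h⟩

theorem Hind.or (H : Hind R Z N x) : R x ∨ Z x := by
  obtain ⟨S, hx, hS⟩ := H
  exact (hS x hx).imp_right And.left

theorem Hind.next (H : Hind R Z N x) (h : N x z) (c : ∀ x z, R x → N x z → R z) :
    Hind R Z N z := by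
  obtain ⟨S, hx, hS⟩ := H
  rcases hS x hx with H | ⟨-, H⟩
  · exact .of (c _ _ H h)
  · exact ⟨S, H _ h, hS⟩

theorem Hind.stable (H : Hind R Z N x) (hR : ∀ x, R x → R' x ∨ Z x) (hZ : ∀ x, Z x → Z' x)
    (hN : ∀ x z, Z x → N' x z → N x z) (c : ∀ x z, R x → N x z → R z) : Hind R' Z' N' x := by
  obtain ⟨S, hx, hS⟩ := H
  refine ⟨S ∪ {x | R x}, .inl hx, ?_⟩
  have lost : ∀ x, R x → R' x ∨ (Z' x ∧ ∀ z, N' x z → z ∈ S ∪ {x | R x}) := fun x hx =>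
    (hR x hx).imp_right fun h => ⟨hZ _ h, fun z hz => .inr (c _ _ hx (hN _ _ h hz))⟩
  rintro x (hx | hx)
  · rcases hS x hx with H | ⟨h1, h2⟩
    · exact lost x H
    · exact .inr ⟨hZ _ h1, fun z hz => .inl (h2 _ (hN _ _ h1 hz))⟩
  · exact lost x hx
end

/-! ### The invariant of the algorithm -/

/-- The thread is in an RCU read section. -/
def PC.inSection : PC → Bool
  | .locTest .. | .locRight .. | .locLeft .. | .locTag .. | .locUnlock .. => true
  | _ => false

/-- The copy that the thread has linked in a deletion whose successor it has not unlinked yet. -/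
def PC.copy : PC → Option ℕ
  | .syncCall _ _ _ _ w | .syncWait _ _ _ _ w | .csMark _ _ _ _ w | .csRight _ _ _ _ w
  | .unlinkW _ w _ | .unlinkPs _ _ w _ => some w
  | _ => none

/-- The node that the thread has allocated and not yet linked. -/
def PC.fresh : PC → Option ℕ
  | .insWriteLeft _ _ _ n | .insWriteRight _ _ _ n => some n
  | .dupMark _ _ _ _ _ w | .dupLock _ _ _ _ _ w | .linkCmp _ _ _ _ _ w | .linkLeft _ _ _ _ _ w
  | .linkRight _ _ _ _ _ w => some w
  | _ => none

/-- The node whose tag the thread is about to increment. -/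
def PC.bump : PC → Option ℕ
  | .tagRead _ x | .tagWrite _ x _ => some x
  | _ => none

/-- Some thread is about to increment the tag of `x`, since it has set the left child of `x` to
null. -/
def TagPend (c : Config) (x : ℕ) : Prop := ∃ j, (c.pc j).bump = some x

/-- Node `x` is on the weak search path for `k`, for the traversal of thread `i`. -/
def WeakN (s : Shared) (i : Tid) (k : Key) (x : ℕ) : Prop :=
  Rch s.heap (WDir s.heap (s.ghost i) k) rootId x

/-- Node `x` is on the standard search path for `k`. -/
def StdN (h : Heap) (k : Key) (x : ℕ) : Prop := Rch h (SDir h k) rootId x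

/-- What a traversal for `k` by thread `i` knows of the nodes that it visits. -/
def Visited (s : Shared) (i : Tid) (k : ℕ) (x : ℕ) : Prop :=
  Hind (WeakN s i (userKey k)) (fun o => (s.heap o).rem = true)
    (Edge s.heap (SDir s.heap (userKey k))) x

/-- `c` is on the chain of left pointers from the right child of `y`. -/
def OnChain (h : Heap) (y c : ℕ) : Prop := ∃ r, h.child y true = some r ∧ Rch h LeftDir r c

/-- What the search for the successor of `y` knows of the nodes that it visits. -/
def Walked (s : Shared) (y c : ℕ) : Prop :=
  Hind (OnChain s.heap y) (fun o => (s.heap o).rem = true) (Edge s.heap LeftDir) c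

/-- `x` is or was in the tree. A node leaves the tree only after it was marked. -/
def Published (s : Shared) (x : ℕ) : Prop := InTree s.heap x ∨ (s.heap x).rem = true

/-- Unless it is marked, a node that was `k`-reachable with the tag `v` still is, as long as its
left child is null and its tag is `v`, apart from two kinds of locked nodes: those whose tag is
about to be incremented, and the successors of unfinished deletions. -/
def TagStable (c : Config) (P : Pend) (k : Key) (x v : ℕ) : Prop :=
  x < c.shared.next ∧ v ≤ (c.shared.heap x).tag ∧
  ((c.shared.heap x).rem = true ∨ v < (c.shared.heap x).tag ∨ TagPend c x ∨
    (c.shared.heap x).left ≠ none ∨ PendSucc P x ∨ StdN c.shared.heap k x)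

/-- Unless it is marked, `x` is on the standard search path for `k` if that path turns right at `x`.
No exceptions as in `TagStable` are needed, since the nodes that linking a copy removes from the
path for `k` have keys of at least `k`. -/
def RightStable (s : Shared) (k : Key) (x : ℕ) : Prop :=
  x < s.next ∧ ((s.heap x).key < k → (s.heap x).rem = true ∨ StdN s.heap k x)

/-- `x` is a node with key `k` that is or was in the tree. -/
def OwnNode (s : Shared) (k x : ℕ) : Prop := (s.heap x).key = userKey k ∧ Published s x

/-- A deletion of `k` has locked and validated `x` and its child `y`. -/
structure Held (s : Shared) (i : Tid) (k x y : ℕ) : Prop where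
  lock_x : s.lock x = some i
  lock_y : s.lock y = some i
  rem_x : (s.heap x).rem = false
  tree_x : InTree s.heap x
  key_y : (s.heap y).key = userKey k
  child : ∃ d, s.heap.child x d = some y

/-- One child of `y` is null, and `c` is the other one, possibly null too. -/
def OtherChild (s : Shared) (y : ℕ) (c : Ptr) : Prop :=
  ∃ e, s.heap.child y e = c ∧ s.heap.child y (!e) = none

/-- The walk to the successor of `y` has arrived at `cs` from its predecessor `ps`. Both were on the
chain of left pointers below the right child of `y`, unless `ps` is `y` itself. -/
def Walk (s : Shared) (y ps cs : ℕ) : Prop :=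
  Walked s y cs ∧ (ps = y ∧ s.heap.child y true = some cs ∨ ps ≠ y ∧ Walked s y ps)

/-- A deletion has locked and validated the successor `cs` of `y` and the parent `ps` of `cs`. -/
structure Dup (s : Shared) (i : Tid) (k x y ps cs : ℕ) : Prop where
  held : Held s i k x y
  left_y : (s.heap y).left ≠ none
  walk : Walk s y ps cs
  lock_ps : s.lock ps = some i
  lock_cs : s.lock cs = some i
  rem_cs : (s.heap cs).rem = false
  left_cs : (s.heap cs).left = none
  ps_ne : ps ≠ y → (s.heap ps).rem = false ∧ (s.heap ps).left = some cs

/-- `w` is a private copy of `y` with the key and data of `cs`. -/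
structure Copy (s : Shared) (y cs w : ℕ) : Prop where
  lt : w < s.next
  tree : ¬ InTree s.heap w
  rem : (s.heap w).rem = false
  key : (s.heap w).key = (s.heap cs).key
  data : (s.heap w).data = (s.heap cs).data
  child : ∀ e, s.heap.child w e = s.heap.child y e

/-- `n` is a private new leaf. -/
structure Leaf (s : Shared) (k d n : ℕ) : Prop where
  lt : n < s.next
  tree : ¬ InTree s.heap n
  eq : s.heap n = ⟨userKey k, d, none, none, 0, false⟩

/-- A deletion with two children has linked the copy `w`. -/
structure Linked (s : Shared) (P : Pend) (i : Tid) (k y ps cs w : ℕ) : Prop where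
  lock_w : s.lock w = some i
  lock_cs : s.lock cs = some i
  rem_w : (s.heap w).rem = false
  pend : P w = some (userKey k, cs)
  ps : (ps = y ∧ (s.heap w).right = some cs) ∨ (ps ≠ y ∧ s.lock ps = some i ∧
    (s.heap ps).rem = false ∧ InTree s.heap ps ∧ (s.heap ps).left = some cs)

/-- What a thread knows at each of its control points. -/
def PCInv (c : Config) (P : Pend) (i : Tid) : PC → Prop
  | .locTest op x y => Visited c.shared i op.key x ∧ (c.shared.heap x).key ≠ userKey op.key ∧
      ∀ z, y = some z → Visited c.shared i op.key z
  | .locRight op x => Visited c.shared i op.key x ∧ (c.shared.heap x).key < userKey op.key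
  | .locLeft op x => Visited c.shared i op.key x ∧ userKey op.key < (c.shared.heap x).key
  | .locTag op x y => Visited c.shared i op.key x ∧ (c.shared.heap x).key ≠ userKey op.key ∧
      ∀ z, y = some z → OwnNode c.shared op.key z
  | .locUnlock op x tag y | .located op x tag y =>
      (TagStable c P (userKey op.key) x tag ∧ RightStable c.shared (userKey op.key) x) ∧
      (Published c.shared x ∧ (c.shared.heap x).key ≠ userKey op.key) ∧
      ∀ z, y = some z → OwnNode c.shared op.key z
  | .insLock k _ x tag => TagStable c P (userKey k) x tag ∧ RightStable c.shared (userKey k) x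
  | .insRem k _ x tag => (TagStable c P (userKey k) x tag ∧ RightStable c.shared (userKey k) x) ∧
      c.shared.lock x = some i
  | .insKey k _ x tag => (TagStable c P (userKey k) x tag ∧ RightStable c.shared (userKey k) x) ∧
      c.shared.lock x = some i ∧ (c.shared.heap x).rem = false
  | .insLeft k _ x tag => TagStable c P (userKey k) x tag ∧
      c.shared.lock x = some i ∧ (c.shared.heap x).rem = false ∧
      userKey k < (c.shared.heap x).key
  | .insTag k _ x tag => TagStable c P (userKey k) x tag ∧
      c.shared.lock x = some i ∧ (c.shared.heap x).rem = false ∧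
      userKey k < (c.shared.heap x).key ∧ (c.shared.heap x).left = none
  | .insNewLeft k _ x => StdN c.shared.heap (userKey k) x ∧
      c.shared.lock x = some i ∧ (c.shared.heap x).rem = false ∧
      userKey k < (c.shared.heap x).key ∧ (c.shared.heap x).left = none
  | .insWriteLeft k d x n => (StdN c.shared.heap (userKey k) x ∧
      c.shared.lock x = some i ∧ (c.shared.heap x).rem = false ∧
      userKey k < (c.shared.heap x).key ∧ (c.shared.heap x).left = none) ∧ Leaf c.shared k d n
  | .insRight k _ x => StdN c.shared.heap (userKey k) x ∧
      c.shared.lock x = some i ∧ (c.shared.heap x).rem = false ∧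
      (c.shared.heap x).key < userKey k
  | .insNewRight k _ x => (StdN c.shared.heap (userKey k) x ∧
      c.shared.lock x = some i ∧ (c.shared.heap x).rem = false ∧
      (c.shared.heap x).key < userKey k) ∧ (c.shared.heap x).right = none
  | .insWriteRight k d x n => ((StdN c.shared.heap (userKey k) x ∧
      c.shared.lock x = some i ∧ (c.shared.heap x).rem = false ∧
      (c.shared.heap x).key < userKey k) ∧ (c.shared.heap x).right = none) ∧
      Leaf c.shared k d n
  | .delLockX k x y => Published c.shared x ∧ OwnNode c.shared k y
  | .delLockY k x y => (Published c.shared x ∧ OwnNode c.shared k y) ∧ c.shared.lock x = some i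
  | .delRemY k x y => (Published c.shared x ∧ OwnNode c.shared k y) ∧ c.shared.lock x = some i ∧
      c.shared.lock y = some i
  | .delRemX k x y => (Published c.shared x ∧ OwnNode c.shared k y) ∧ c.shared.lock x = some i ∧
      c.shared.lock y = some i ∧ (c.shared.heap y).rem = false
  | .delParLeft k x y | .delParRight k x y =>
      (Published c.shared x ∧ OwnNode c.shared k y) ∧ c.shared.lock x = some i ∧
      c.shared.lock y = some i ∧ (c.shared.heap y).rem = false ∧ (c.shared.heap x).rem = false
  | .delLeft k x y => Held c.shared i k x y ∧ (c.shared.heap y).rem = false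
  | .delRight k x y l => Held c.shared i k x y ∧ (c.shared.heap y).rem = false ∧
      (c.shared.heap y).left = l
  | .bypMark k x y p => Held c.shared i k x y ∧ (c.shared.heap y).rem = false ∧
      OtherChild c.shared y p
  | .bypCmp k x y p => Held c.shared i k x y ∧ (c.shared.heap y).rem = true ∧
      OtherChild c.shared y p
  | .bypLeft k x y p => Held c.shared i k x y ∧ (c.shared.heap y).rem = true ∧
      OtherChild c.shared y p ∧ c.shared.heap.child x false = some y
  | .bypRight k x y p => Held c.shared i k x y ∧ (c.shared.heap y).rem = true ∧
      OtherChild c.shared y p ∧ c.shared.heap.child x true = some y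
  | .tagRead _ x => c.shared.lock x = some i ∧ InTree c.shared.heap x ∧
      (c.shared.heap x).rem = false
  | .tagWrite _ x v => c.shared.lock x = some i ∧ InTree c.shared.heap x ∧
      (c.shared.heap x).rem = false ∧ (c.shared.heap x).tag = v
  | .sucRight k x y => Held c.shared i k x y ∧ (c.shared.heap y).rem = false ∧
      (c.shared.heap y).left ≠ none
  | .sucLeft k x y ps cs | .sucLockPs k x y ps cs =>
      (Held c.shared i k x y ∧ (c.shared.heap y).rem = false ∧
      (c.shared.heap y).left ≠ none) ∧ Walk c.shared y ps cs
  | .sucLockCs k x y ps cs => ((Held c.shared i k x y ∧ (c.shared.heap y).rem = false ∧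
      (c.shared.heap y).left ≠ none) ∧ Walk c.shared y ps cs) ∧ c.shared.lock ps = some i
  | .sucRemPs k x y ps cs => ((Held c.shared i k x y ∧ (c.shared.heap y).rem = false ∧
      (c.shared.heap y).left ≠ none) ∧ Walk c.shared y ps cs) ∧ c.shared.lock ps = some i ∧
      c.shared.lock cs = some i
  | .sucRemCs k x y ps cs => ((Held c.shared i k x y ∧ (c.shared.heap y).rem = false ∧
      (c.shared.heap y).left ≠ none) ∧ Walk c.shared y ps cs) ∧ c.shared.lock ps = some i ∧
      c.shared.lock cs = some i ∧ (c.shared.heap ps).rem = false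
  | .sucPar k x y ps cs => ((Held c.shared i k x y ∧ (c.shared.heap y).rem = false ∧
      (c.shared.heap y).left ≠ none) ∧ Walk c.shared y ps cs) ∧ c.shared.lock ps = some i ∧
      c.shared.lock cs = some i ∧ (c.shared.heap ps).rem = false ∧ (c.shared.heap cs).rem = false
  | .sucNull k x y ps cs => (((Held c.shared i k x y ∧ (c.shared.heap y).rem = false ∧
      (c.shared.heap y).left ≠ none) ∧ Walk c.shared y ps cs) ∧ c.shared.lock ps = some i ∧
      c.shared.lock cs = some i ∧ (c.shared.heap ps).rem = false ∧
      (c.shared.heap cs).rem = false) ∧ (ps ≠ y → (c.shared.heap ps).left = some cs)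
  | .dupKey k x y ps cs => Dup c.shared i k x y ps cs ∧ (c.shared.heap y).rem = false
  | .dupData k x y ps cs m => (Dup c.shared i k x y ps cs ∧ (c.shared.heap y).rem = false) ∧
      m = (c.shared.heap cs).key
  | .dupNew k x y ps cs m d => (Dup c.shared i k x y ps cs ∧ (c.shared.heap y).rem = false) ∧
      m = (c.shared.heap cs).key ∧ d = (c.shared.heap cs).data
  | .dupMark k x y ps cs w => (Dup c.shared i k x y ps cs ∧ (c.shared.heap y).rem = false) ∧
      Copy c.shared y cs w
  | .dupLock k x y ps cs w => (Dup c.shared i k x y ps cs ∧ (c.shared.heap y).rem = true) ∧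
      Copy c.shared y cs w
  | .linkCmp k x y ps cs w => ((Dup c.shared i k x y ps cs ∧ (c.shared.heap y).rem = true) ∧
      Copy c.shared y cs w) ∧ c.shared.lock w = some i
  | .linkLeft k x y ps cs w => (((Dup c.shared i k x y ps cs ∧ (c.shared.heap y).rem = true) ∧
      Copy c.shared y cs w) ∧ c.shared.lock w = some i) ∧ c.shared.heap.child x false = some y
  | .linkRight k x y ps cs w => (((Dup c.shared i k x y ps cs ∧ (c.shared.heap y).rem = true) ∧
      Copy c.shared y cs w) ∧ c.shared.lock w = some i) ∧ c.shared.heap.child x true = some y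
  | .syncCall k y ps cs w | .syncWait k y ps cs w | .csMark k y ps cs w =>
      Linked c.shared P i k y ps cs w ∧ (c.shared.heap cs).rem = false
  | .csRight k y ps cs w => Linked c.shared P i k y ps cs w ∧ (c.shared.heap cs).rem = true
  | .unlinkW k w r => ∃ y ps cs, Linked c.shared P i k y ps cs w ∧ ps = y ∧
      (c.shared.heap cs).rem = true ∧ (c.shared.heap cs).right = r
  | .unlinkPs k ps w r => ∃ y cs, Linked c.shared P i k y ps cs w ∧ ps ≠ y ∧
      (c.shared.heap cs).rem = true ∧ (c.shared.heap cs).right = r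
  | .finish r => r = .bool true
  | _ => True

/-- The ghost keys of the traversals in progress differ from the keys only at copies whose deletions
still wait for the traversal. -/
def GhostWaits (c : Config) (P : Pend) (i : Tid) (o : ℕ) : Prop :=
  ∃ k cs, P o = some (k, cs) ∧ c.shared.ghost i o = k ∧
    ∃ j k' y ps cs', c.pc j = .syncCall k' y ps cs' o ∨
      (c.pc j = .syncWait k' y ps cs' o ∧ i ∈ c.shared.waiting j)

/-- The global invariant. The unfinished deletions `P` are not determined by the heap: they are
ghost state, which changes when a copy is linked and when a successor is unlinked. -/
structure Inv (c : Config) (P : Pend) : Prop where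
  root : (c.shared.heap rootId).key = ((-1 : ℤ) : WithTop ℤ)
  tree : TreeInv c.shared.heap P
  tree_lt : ∀ o, InTree c.shared.heap o → o < c.shared.next
  lock_lt : ∀ o j, c.shared.lock o = some j → o < c.shared.next
  unalloc : ∀ o, c.shared.next ≤ o → (c.shared.heap o).rem = false
  ghost : ∀ i o, c.shared.reader i = true → c.shared.ghost i o = (c.shared.heap o).key ∨
    GhostWaits c P i o
  reader : ∀ i, c.shared.reader i = (c.pc i).inSection
  pc : ∀ i, PCInv c P i (c.pc i)
  pend : ∀ w k cs, P w = some (k, cs) → ∃ j, (c.pc j).copy = some w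
  fresh : ∀ i j n, (c.pc i).fresh = some n → (c.pc j).fresh = some n → i = j

/-- What a step of thread `j` guarantees to the other threads. -/
structure Grt (j : Tid) (c : Config) (P : Pend) (c' : Config) (P' : Pend) : Prop where
  next_le : c.shared.next ≤ c'.shared.next
  key : ∀ o < c.shared.next, (c'.shared.heap o).key = (c.shared.heap o).key
  data : ∀ o < c.shared.next, (c'.shared.heap o).data = (c.shared.heap o).data
  frozen : ∀ o, (c.shared.heap o).rem = true → c'.shared.heap o = c.shared.heap o
  tag_le : ∀ o < c.shared.next, (c.shared.heap o).tag ≤ (c'.shared.heap o).tag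
  locked : ∀ i o, i ≠ j → c.shared.lock o = some i →
    c'.shared.lock o = some i ∧ c'.shared.heap o = c.shared.heap o
  priv : ∀ n < c.shared.next, ¬ InTree c.shared.heap n → (c.shared.heap n).rem = false →
    (c.pc j).fresh ≠ some n → c'.shared.heap n = c.shared.heap n ∧ ¬ InTree c'.shared.heap n
  tree : ∀ o, InTree c.shared.heap o → InTree c'.shared.heap o ∨ (c.shared.heap o).rem = true
  reader_eq : ∀ i, i ≠ j → c'.shared.reader i = c.shared.reader i
  weak : ∀ i k o, c.shared.reader i = true → c'.shared.reader i = true → WeakN c.shared i k o →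
    WeakN c'.shared i k o ∨ (c.shared.heap o).rem = true
  chain : ∀ y o, InTree c.shared.heap y →
    c'.shared.heap.child y true = c.shared.heap.child y true → OnChain c.shared.heap y o →
    OnChain c'.shared.heap y o ∨ (c.shared.heap o).rem = true
  std : ∀ k o, StdN c.shared.heap k o → StdN c'.shared.heap k o ∨ (c.shared.heap o).rem = true ∨
    (k ≤ (c.shared.heap o).key ∧
      (((c.shared.heap o).left ≠ none ∧ (c'.shared.heap o).left ≠ none) ∨
        (PendSucc P' o ∧ c.shared.lock o = some j)))
  left_null : ∀ o < c.shared.next, (c.shared.heap o).left ≠ none →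
    (c'.shared.heap o).left ≠ none ∨ TagPend c' o
  bump : ∀ o, TagPend c o → TagPend c' o ∨ (c.shared.heap o).tag < (c'.shared.heap o).tag
  pendS : ∀ o, PendSucc P o → PendSucc P' o ∨ (c.shared.heap o).rem = true
  pend : ∀ i w, i ≠ j → c.shared.lock w = some i → P' w = P w

/-! ### Stability -/

section
variable {c c' : Config} {P P' : Pend} {i j : Tid} {k x y z w v ps cs d n : ℕ} {q : Key}

theorem WeakN.inTree {s : Shared} (H : WeakN s i q x) : InTree s.heap x := Rch.inTree H

theorem StdN.inTree {h : Heap} (H : StdN h q x) : InTree h x := Rch.inTree H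

theorem Inv.rem_lt (I : Inv c P) (H : (c.shared.heap x).rem = true) : x < c.shared.next := by
  by_contra hcon
  simp [I.unalloc x (not_lt.1 hcon)] at H

theorem Inv.published_lt (I : Inv c P) (H : Published c.shared x) : x < c.shared.next :=
  H.elim (I.tree_lt x) I.rem_lt

theorem Inv.ghostOK (I : Inv c P) (hi : c.shared.reader i = true) :
    GhostOK c.shared.heap P (c.shared.ghost i) := fun o =>
  (I.ghost i o hi).imp_right fun ⟨k, cs, h1, h2, _⟩ => ⟨k, cs, h1, h2⟩

theorem Inv.std_weak (I : Inv c P) (hi : c.shared.reader i = true)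
    (H : StdN c.shared.heap q x) : WeakN c.shared i q x :=
  ReflTransGen.mono (fun _ _ ⟨d, hd, e⟩ => ⟨d, hd.wdir ((I.ghostOK hi).le I.tree _), e⟩) _ _ H

theorem Inv.weak_next (I : Inv c P) (hi : c.shared.reader i = true) (x z : ℕ)
    (H : WeakN c.shared i q x) (e : Edge c.shared.heap (SDir c.shared.heap q) x z) :
    WeakN c.shared i q z := by
  obtain ⟨d, hd, e⟩ := e
  exact ReflTransGen.tail H ⟨d, hd.wdir ((I.ghostOK hi).le I.tree _), e⟩

theorem onChain_next {h : Heap} (y x z : ℕ) (H : OnChain h y x) (e : Edge h LeftDir x z) :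
    OnChain h y z := by
  obtain ⟨r, e1, h1⟩ := H
  exact ⟨r, e1, h1.tail e⟩

theorem OnChain.inTree {h : Heap} (H : OnChain h y x) (hy : InTree h y) : InTree h x := by
  obtain ⟨r, e, hr⟩ := H
  exact (hy.child e).desc (Rch.toDesc hr)

theorem Visited.published {s : Shared} (H : Visited s i k x) : Published s x :=
  (Hind.or H).imp_left WeakN.inTree

theorem Walked.published {s : Shared} (H : Walked s y x) (hy : InTree s.heap y) :
    Published s x :=
  (Hind.or H).imp_left fun H => H.inTree hy

section
variable (G : Grt j c P c' P') (I : Inv c P)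
include G
theorem Grt.rem (H : (c.shared.heap x).rem = true) : (c'.shared.heap x).rem = true := by
  rw [G.frozen x H, H]

theorem Grt.published (H : Published c.shared x) : Published c'.shared x :=
  H.elim (fun H => (G.tree x H).imp_right G.rem) fun H => .inr (G.rem H)

theorem Grt.heap (hij : i ≠ j) (H : c.shared.lock x = some i) :
    c'.shared.heap x = c.shared.heap x := (G.locked i x hij H).2

theorem Grt.lock (hij : i ≠ j) (H : c.shared.lock x = some i) :
    c'.shared.lock x = some i := (G.locked i x hij H).1

theorem Grt.inTree (H : InTree c.shared.heap x) (h : (c.shared.heap x).rem = false) :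
    InTree c'.shared.heap x := (G.tree x H).resolve_right (by simp [h])

include I

omit I in
theorem Grt.edge_frozen (H : (c.shared.heap x).rem = true)
    (e : Edge c'.shared.heap (SDir c'.shared.heap q) x z) :
    Edge c.shared.heap (SDir c.shared.heap q) x z := by
  simpa only [Edge, SDir, Heap.child, G.frozen x H] using e

theorem Grt.visited (hi : c.shared.reader i = true) (hi' : c'.shared.reader i = true)
    (H : Visited c.shared i k x) : Visited c'.shared i k x :=
  Hind.stable H (fun x hx => G.weak _ _ x hi hi' hx) (fun _ => G.rem)
    (fun _ _ hx => G.edge_frozen hx) (I.weak_next hi)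

omit I in
theorem Grt.walked (hy : InTree c.shared.heap y)
    (e : c'.shared.heap.child y true = c.shared.heap.child y true) (H : Walked c.shared y x) :
    Walked c'.shared y x :=
  Hind.stable H (fun x hx => G.chain _ x hy e hx) (fun _ => G.rem)
    (fun x z hx e => by simpa only [Edge, Heap.child, G.frozen x hx] using e) (onChain_next y)

omit I in
theorem Grt.walk (hy : InTree c.shared.heap y)
    (e : c'.shared.heap.child y true = c.shared.heap.child y true) (H : Walk c.shared y ps cs) :
    Walk c'.shared y ps cs := by
  refine ⟨G.walked hy e H.1, ?_⟩
  rw [e]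
  exact H.2.imp_right fun ⟨h1, h2⟩ => ⟨h1, G.walked hy e h2⟩

omit I in
theorem Grt.tagStable (H : TagStable c P q x v) : TagStable c' P' q x v := by
  obtain ⟨hx, hv, H⟩ := H
  have hle := G.tag_le x hx
  refine ⟨lt_of_lt_of_le hx G.next_le, hv.trans hle, ?_⟩
  rcases H with H | H | H | H | H | H
  · exact .inl (G.rem H)
  · exact .inr (.inl (lt_of_lt_of_le H hle))
  · rcases G.bump x H with H | H
    · exact .inr (.inr (.inl H))
    · exact .inr (.inl (lt_of_le_of_lt hv H))
  · rcases G.left_null x hx H with H | H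
    · exact .inr (.inr (.inr (.inl H)))
    · exact .inr (.inr (.inl H))
  · rcases G.pendS x H with H | H
    · exact .inr (.inr (.inr (.inr (.inl H))))
    · exact .inl (G.rem H)
  · rcases G.std _ x H with H | H | ⟨-, H | H⟩
    · exact .inr (.inr (.inr (.inr (.inr H))))
    · exact .inl (G.rem H)
    · exact .inr (.inr (.inr (.inl H.2)))
    · exact .inr (.inr (.inr (.inr (.inl H.1))))

omit I in
theorem Grt.rightStable (H : RightStable c.shared q x) : RightStable c'.shared q x := by
  obtain ⟨hx, H⟩ := H
  refine ⟨lt_of_lt_of_le hx G.next_le, ?_⟩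
  rw [G.key x hx]
  intro hlt
  rcases H hlt with H | H
  · exact .inl (G.rem H)
  · rcases G.std _ x H with H | H | ⟨H, -⟩
    · exact .inr H
    · exact .inl (G.rem H)
    · exact absurd hlt (not_lt.2 H)

theorem Grt.ownNode (H : OwnNode c.shared k x) : OwnNode c'.shared k x :=
  ⟨by rw [G.key x (I.published_lt H.2), H.1], G.published H.2⟩

omit I in
theorem Grt.held (hij : i ≠ j) (H : Held c.shared i k x y) : Held c'.shared i k x y := by
  have hx := G.heap hij H.lock_x
  have hy := G.heap hij H.lock_y
  refine ⟨G.lock hij H.lock_x, G.lock hij H.lock_y, by rw [hx, H.rem_x], G.inTree H.tree_x H.rem_x,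
    by rw [hy, H.key_y], ?_⟩
  simpa only [Heap.child, hx] using H.child

omit G I in
theorem Held.tree_y {s : Shared} (H : Held s i k x y) : InTree s.heap y := by
  obtain ⟨d, e⟩ := H.child
  exact H.tree_x.child e

omit I in
theorem Grt.dup (hij : i ≠ j) (H : Dup c.shared i k x y ps cs) : Dup c'.shared i k x y ps cs := by
  have hy := G.heap hij H.held.lock_y
  have hps := G.heap hij H.lock_ps
  have hcs := G.heap hij H.lock_cs
  refine ⟨G.held hij H.held, by rw [hy]; exact H.left_y,
    G.walk H.held.tree_y (by simp only [Heap.child, hy]) H.walk, G.lock hij H.lock_ps,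
    G.lock hij H.lock_cs, by rw [hcs, H.rem_cs], by rw [hcs, H.left_cs], ?_⟩
  rw [hps]
  exact H.ps_ne

omit I in
theorem Grt.copy (hij : i ≠ j) (hn : (c.pc j).fresh ≠ some w) (hy : c.shared.lock y = some i)
    (hcs : c.shared.lock cs = some i) (H : Copy c.shared y cs w) : Copy c'.shared y cs w := by
  obtain ⟨h1, h2⟩ := G.priv w H.lt H.tree H.rem hn
  have hy := G.heap hij hy
  have hcs := G.heap hij hcs
  refine ⟨lt_of_lt_of_le H.lt G.next_le, h2, by rw [h1, H.rem], by rw [h1, hcs, H.key],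
    by rw [h1, hcs, H.data], fun e => ?_⟩
  have := H.child e
  simpa only [Heap.child, h1, hy] using this

omit I in
theorem Grt.leaf (hn : (c.pc j).fresh ≠ some n)
    (H : Leaf c.shared k d n) : Leaf c'.shared k d n := by
  obtain ⟨h1, h2⟩ := G.priv n H.lt H.tree (by rw [H.eq]) hn
  exact ⟨lt_of_lt_of_le H.lt G.next_le, h2, by rw [h1, H.eq]⟩

omit I in
theorem Grt.linked (hij : i ≠ j) (H : Linked c.shared P i k y ps cs w) :
    Linked c'.shared P' i k y ps cs w := by
  have hw := G.heap hij H.lock_w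
  refine ⟨G.lock hij H.lock_w, G.lock hij H.lock_cs, by rw [hw, H.rem_w],
    by rw [G.pend _ _ hij H.lock_w, H.pend], ?_⟩
  rw [hw]
  refine H.ps.imp_right fun ⟨h1, h2, h3, h4, h5⟩ => ⟨h1, G.lock hij h2, ?_, G.inTree h4 h3, ?_⟩
  · rw [G.heap hij h2, h3]
  · rw [G.heap hij h2, h5]

/-- What a thread knows survives the steps of the others. -/
theorem Grt.pcInv (hij : i ≠ j) (hpc : c'.pc i = c.pc i) :
    PCInv c' P' i (c'.pc i) := by
  have H := I.pc i
  have hr := I.reader i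
  have hr' := G.reader_eq i hij
  have hf := I.fresh i j
  rw [hpc]
  generalize c.pc i = p at *
  have stdL : ∀ {k x}, (StdN c.shared.heap (userKey k) x ∧
      c.shared.lock x = some i ∧ (c.shared.heap x).rem = false ∧
      userKey k < (c.shared.heap x).key ∧ (c.shared.heap x).left = none) →
      (StdN c'.shared.heap (userKey k) x ∧
      c'.shared.lock x = some i ∧ (c'.shared.heap x).rem = false ∧
      userKey k < (c'.shared.heap x).key ∧ (c'.shared.heap x).left = none) := by
    rintro k x ⟨h1, h2, h3, h4, h5⟩
    rw [G.heap hij h2]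
    refine ⟨?_, G.lock hij h2, h3, h4, h5⟩
    rcases G.std _ x h1 with H | H | ⟨-, H | H⟩
    · exact H
    · simp [h3] at H
    · exact absurd h5 H.1
    · exact absurd (Option.some_injective _ (h2.symm.trans H.2)) hij
  have stdR : ∀ {k x}, (StdN c.shared.heap (userKey k) x ∧
      c.shared.lock x = some i ∧ (c.shared.heap x).rem = false ∧
      (c.shared.heap x).key < userKey k) →
      (StdN c'.shared.heap (userKey k) x ∧
      c'.shared.lock x = some i ∧ (c'.shared.heap x).rem = false ∧
      (c'.shared.heap x).key < userKey k) := by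
    rintro k x ⟨h1, h2, h3, h4⟩
    rw [G.heap hij h2]
    refine ⟨?_, G.lock hij h2, h3, h4⟩
    rcases G.std _ x h1 with H | H | ⟨H, -⟩
    · exact H
    · simp [h3] at H
    · exact absurd h4 (not_lt.2 H)
  have other : ∀ {y q}, c.shared.lock y = some i → OtherChild c.shared y q →
      OtherChild c'.shared y q := by
    intro y q hy H
    simpa only [OtherChild, Heap.child, G.heap hij hy] using H
  have walk : ∀ {k x y ps cs}, Held c.shared i k x y → Walk c.shared y ps cs →
      Walk c'.shared y ps cs := fun h1 h2 =>
    G.walk h1.tree_y (by simp only [Heap.child, G.heap hij h1.lock_y]) h2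
  have hd : ∀ {k x y}, Held c.shared i k x y → Held c'.shared i k x y := G.held hij
  have hdup : ∀ {k x y ps cs}, Dup c.shared i k x y ps cs → Dup c'.shared i k x y ps cs :=
    G.dup hij
  have hl : ∀ {x}, c.shared.lock x = some i → c'.shared.lock x = some i := G.lock hij
  have hh : ∀ {x}, c.shared.lock x = some i → c'.shared.heap x = c.shared.heap x := G.heap hij
  have key : ∀ {x}, x < c.shared.next → (c'.shared.heap x).key = (c.shared.heap x).key :=
    fun h => G.key _ h
  have plt := fun {x} => I.published_lt (x := x)
  cases p <;> simp only [PCInv, PC.inSection] at H hr ⊢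
  case locTest =>
    have hr2 := hr'.trans hr
    exact ⟨G.visited I hr hr2 H.1, by rw [key (plt H.1.published)]; exact H.2.1,
      fun z hz => G.visited I hr hr2 (H.2.2 z hz)⟩
  case locRight | locLeft =>
    exact ⟨G.visited I hr (hr'.trans hr) H.1, by rw [key (plt H.1.published)]; exact H.2⟩
  case locTag =>
    exact ⟨G.visited I hr (hr'.trans hr) H.1, by rw [key (plt H.1.published)]; exact H.2.1,
      fun z hz => G.ownNode I (H.2.2 z hz)⟩
  case locUnlock | located =>
    exact ⟨⟨G.tagStable H.1.1, G.rightStable H.1.2⟩, ⟨G.published H.2.1.1,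
      by rw [key (plt H.2.1.1)]; exact H.2.1.2⟩, fun z hz => G.ownNode I (H.2.2 z hz)⟩
  case insLock => exact ⟨G.tagStable H.1, G.rightStable H.2⟩
  case insRem => exact ⟨⟨G.tagStable H.1.1, G.rightStable H.1.2⟩, hl H.2⟩
  case insKey => exact ⟨⟨G.tagStable H.1.1, G.rightStable H.1.2⟩, hl H.2.1,
    by rw [hh H.2.1]; exact H.2.2⟩
  case insLeft | insTag => exact ⟨G.tagStable H.1, hl H.2.1, by rw [hh H.2.1]; exact H.2.2⟩
  case insNewLeft => exact stdL H
  case insWriteLeft => exact ⟨stdL H.1, G.leaf (fun h2 => hij (hf _ rfl h2)) H.2⟩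
  case insRight => exact stdR H
  case insNewRight => exact ⟨stdR H.1, by rw [hh H.1.2.1]; exact H.2⟩
  case insWriteRight =>
    exact ⟨⟨stdR H.1.1, by rw [hh H.1.1.2.1]; exact H.1.2⟩,
      G.leaf (fun h2 => hij (hf _ rfl h2)) H.2⟩
  case delLockX => exact ⟨G.published H.1, G.ownNode I H.2⟩
  case delLockY => exact ⟨⟨G.published H.1.1, G.ownNode I H.1.2⟩, hl H.2⟩
  case delRemY => exact ⟨⟨G.published H.1.1, G.ownNode I H.1.2⟩, hl H.2.1, hl H.2.2⟩
  case delRemX =>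
    exact ⟨⟨G.published H.1.1, G.ownNode I H.1.2⟩, hl H.2.1, hl H.2.2.1,
      by rw [hh H.2.2.1]; exact H.2.2.2⟩
  case delParLeft | delParRight =>
    exact ⟨⟨G.published H.1.1, G.ownNode I H.1.2⟩, hl H.2.1, hl H.2.2.1,
      by rw [hh H.2.2.1]; exact H.2.2.2.1, by rw [hh H.2.1]; exact H.2.2.2.2⟩
  case delLeft | delRight | sucRight => exact ⟨hd H.1, by rw [hh H.1.lock_y]; exact H.2⟩
  case bypMark | bypCmp =>
    exact ⟨hd H.1, by rw [hh H.1.lock_y]; exact H.2.1, other H.1.lock_y H.2.2⟩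
  case bypLeft | bypRight =>
    exact ⟨hd H.1, by rw [hh H.1.lock_y]; exact H.2.1, other H.1.lock_y H.2.2.1,
      by simpa only [Heap.child, hh H.1.lock_x] using H.2.2.2⟩
  case tagRead => exact ⟨hl H.1, G.inTree H.2.1 H.2.2, by rw [hh H.1]; exact H.2.2⟩
  case tagWrite => exact ⟨hl H.1, G.inTree H.2.1 H.2.2.1, by rw [hh H.1]; exact H.2.2⟩
  case sucLeft | sucLockPs =>
    exact ⟨⟨hd H.1.1, by rw [hh H.1.1.lock_y]; exact H.1.2⟩, walk H.1.1 H.2⟩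
  case sucLockCs =>
    exact ⟨⟨⟨hd H.1.1.1, by rw [hh H.1.1.1.lock_y]; exact H.1.1.2⟩, walk H.1.1.1 H.1.2⟩, hl H.2⟩
  case sucRemPs =>
    exact ⟨⟨⟨hd H.1.1.1, by rw [hh H.1.1.1.lock_y]; exact H.1.1.2⟩, walk H.1.1.1 H.1.2⟩, hl H.2.1,
      hl H.2.2⟩
  case sucRemCs =>
    exact ⟨⟨⟨hd H.1.1.1, by rw [hh H.1.1.1.lock_y]; exact H.1.1.2⟩, walk H.1.1.1 H.1.2⟩, hl H.2.1,
      hl H.2.2.1, by rw [hh H.2.1]; exact H.2.2.2⟩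
  case sucPar =>
    exact ⟨⟨⟨hd H.1.1.1, by rw [hh H.1.1.1.lock_y]; exact H.1.1.2⟩, walk H.1.1.1 H.1.2⟩, hl H.2.1,
      hl H.2.2.1, by rw [hh H.2.1, hh H.2.2.1]; exact H.2.2.2⟩
  case sucNull =>
    obtain ⟨H, H'⟩ := H
    exact ⟨⟨⟨⟨hd H.1.1.1, by rw [hh H.1.1.1.lock_y]; exact H.1.1.2⟩, walk H.1.1.1 H.1.2⟩, hl H.2.1,
      hl H.2.2.1, by rw [hh H.2.1, hh H.2.2.1]; exact H.2.2.2⟩, by rw [hh H.2.1]; exact H'⟩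
  case dupKey => exact ⟨hdup H.1, by rw [hh H.1.held.lock_y]; exact H.2⟩
  case dupData | dupNew =>
    exact ⟨⟨hdup H.1.1, by rw [hh H.1.1.held.lock_y]; exact H.1.2⟩,
      by rw [hh H.1.1.lock_cs]; exact H.2⟩
  case dupMark | dupLock =>
    exact ⟨⟨hdup H.1.1, by rw [hh H.1.1.held.lock_y]; exact H.1.2⟩,
      G.copy hij (fun h2 => hij (hf _ rfl h2)) H.1.1.held.lock_y H.1.1.lock_cs H.2⟩
  case linkCmp =>
    obtain ⟨H, H'⟩ := H
    exact ⟨⟨⟨hdup H.1.1, by rw [hh H.1.1.held.lock_y]; exact H.1.2⟩,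
      G.copy hij (fun h2 => hij (hf _ rfl h2)) H.1.1.held.lock_y H.1.1.lock_cs H.2⟩, hl H'⟩
  case linkLeft | linkRight =>
    obtain ⟨⟨H, H'⟩, H2⟩ := H
    exact ⟨⟨⟨⟨hdup H.1.1, by rw [hh H.1.1.held.lock_y]; exact H.1.2⟩,
      G.copy hij (fun h2 => hij (hf _ rfl h2)) H.1.1.held.lock_y H.1.1.lock_cs H.2⟩, hl H'⟩,
      by simpa only [Heap.child, hh H.1.1.held.lock_x] using H2⟩
  case syncCall | syncWait | csMark | csRight =>
    exact ⟨G.linked hij H.1, by rw [hh H.1.lock_cs]; exact H.2⟩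
  case unlinkW =>
    obtain ⟨y, ps, cs, H, H'⟩ := H
    exact ⟨y, ps, cs, G.linked hij H, by rw [hh H.lock_cs]; exact H'⟩
  case unlinkPs =>
    obtain ⟨y, cs, H, H'⟩ := H
    exact ⟨y, cs, G.linked hij H, by rw [hh H.lock_cs]; exact H'⟩
  case finish => exact H
end
end

/-! ### Effects of the writes -/

/-- The pair `(k, d)` is in the abstract map, in terms of the nodes of the tree. -/
def Rep (h : Heap) (P : Pend) (k d : ℕ) : Prop :=
  ∃ x, InTree h x ∧ ¬ PendSucc P x ∧ (h x).key = userKey k ∧ (h x).data = d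

theorem userKey_inj {k k' : ℕ} (h : userKey k = userKey k') : k = k' := by
  simpa [userKey] using h

section
variable {c c' : Config} {P P' : Pend} {i j : Tid} {k x y z w v ps cs d n p o : ℕ} {q : Key}

theorem Inv.copy_linked (I : Inv c P) (H : (c.pc j).copy = some w) :
    ∃ k y ps cs, Linked c.shared P j k y ps cs w := by
  have h := I.pc j
  generalize c.pc j = p at *
  cases p <;> simp only [PC.copy, Option.some.injEq, reduceCtorEq] at H <;> subst H <;>
    simp only [PCInv] at h
  case unlinkW => obtain ⟨y, ps, cs, h, -⟩ := h; exact ⟨_, _, _, _, h⟩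
  case unlinkPs => obtain ⟨y, cs, h, -⟩ := h; exact ⟨_, _, _, _, h⟩
  all_goals exact ⟨_, _, _, _, h.1⟩

theorem Inv.pend_locked (I : Inv c P) (H : P w = some (q, cs)) :
    ∃ j, (c.pc j).copy = some w ∧ c.shared.lock w = some j ∧ c.shared.lock cs = some j := by
  obtain ⟨j, hj⟩ := I.pend w q cs H
  obtain ⟨k, y, ps, cs', L⟩ := I.copy_linked hj
  have := L.pend
  rw [H] at this
  simp only [Option.some.injEq, Prod.mk.injEq] at this
  exact ⟨j, hj, L.lock_w, by rw [this.2]; exact L.lock_cs⟩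

/-- A thread does not hold the locks of the copies and successors of the deletions of others. -/
theorem Inv.pend_other (I : Inv c P) (H : P w = some (q, cs)) (hi : (c.pc i).copy ≠ some w)
    (hp : c.shared.lock p = some i) : w ≠ p ∧ cs ≠ p := by
  obtain ⟨j, h1, h2, h3⟩ := I.pend_locked H
  constructor
  · rintro rfl
    obtain rfl := Option.some_injective _ (h2.symm.trans hp)
    exact hi h1
  · rintro rfl
    obtain rfl := Option.some_injective _ (h3.symm.trans hp)
    exact hi h1

theorem Inv.not_pend (I : Inv c P) (hi : (c.pc i).copy = none)
    (hp : c.shared.lock p = some i) : P p = none ∧ ¬ PendSucc P p := by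
  constructor
  · rcases e : P p with _ | ⟨q, cs⟩
    · rfl
    · exact absurd rfl (I.pend_other e (by simp [hi]) hp).1
  · rintro ⟨w, q, e⟩
    exact (I.pend_other e (by simp [hi]) hp).2 rfl

/-- Steps that change neither the heap nor the ghost keys of the traversals in progress. -/
theorem Grt.neutral (hh : c'.shared.heap = c.shared.heap) (hn : c'.shared.next = c.shared.next)
    (hl : ∀ j o, j ≠ i → c.shared.lock o = some j → c'.shared.lock o = some j)
    (hr : ∀ j, j ≠ i → c'.shared.reader j = c.shared.reader j)
    (hg : ∀ j, c.shared.reader j = true → c'.shared.reader j = true →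
      c'.shared.ghost j = c.shared.ghost j)
    (hpc : ∀ j, j ≠ i → c'.pc j = c.pc j)
    (hb : ∀ o, (c.pc i).bump = some o → (c'.pc i).bump = some o) : Grt i c P c' P where
  next_le := hn.ge
  key _ _ := by rw [hh]
  data _ _ := by rw [hh]
  frozen _ _ := by rw [hh]
  tag_le _ _ := by rw [hh]
  locked j o hj ho := ⟨hl j o hj ho, by rw [hh]⟩
  priv n _ h1 _ _ := ⟨by rw [hh], by rwa [hh]⟩
  tree o h := .inl (by rwa [hh])
  reader_eq := hr
  weak j k o h1 h2 h := .inl (by unfold WeakN; rw [hh, hg j h1 h2]; exact h)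
  chain y o _ _ h := .inl (by rwa [hh])
  std k o h := .inl (by rwa [hh])
  left_null o _ h := .inl (by rwa [hh])
  bump o := fun ⟨j, hj⟩ => .inl <| by
    by_cases hji : j = i
    · subst hji
      exact ⟨j, hb o hj⟩
    · exact ⟨j, by rw [hpc j hji]; exact hj⟩
  pendS o h := .inl h
  pend _ _ _ _ := rfl

/-- The parts of the guarantee that are common to all writes: node `p` is written, which the thread
has locked and which is not marked. -/
theorem Grt.ofWrite (hn : c'.shared.next = c.shared.next)
    (hl : c'.shared.lock = c.shared.lock) (hr : c'.shared.reader = c.shared.reader)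
    (hpc : ∀ j, j ≠ i → c'.pc j = c.pc j)
    (hp : c.shared.lock p = some i) (hrem : (c.shared.heap p).rem = false)
    (hpt : InTree c.shared.heap p)
    (hh : ∀ o, o ≠ p → c'.shared.heap o = c.shared.heap o)
    (hk : (c'.shared.heap p).key = (c.shared.heap p).key)
    (hd : (c'.shared.heap p).data = (c.shared.heap p).data)
    (ht : (c.shared.heap p).tag ≤ (c'.shared.heap p).tag)
    (hb : ∀ o, (c.pc i).bump = some o → (c'.pc i).bump = some o ∨
      (c.shared.heap o).tag < (c'.shared.heap o).tag)
    (hln : (c.shared.heap p).left ≠ none → (c'.shared.heap p).left ≠ none ∨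
      (c'.pc i).bump = some p)
    (hback : ∀ o, InTree c'.shared.heap o → InTree c.shared.heap o ∨ (c.pc i).fresh = some o)
    (htree : ∀ o, InTree c.shared.heap o → InTree c'.shared.heap o ∨
      (c.shared.heap o).rem = true)
    (hweak : ∀ i k o, c.shared.reader i = true → WeakN c.shared i k o →
      WeakN c'.shared i k o ∨ (c.shared.heap o).rem = true)
    (hchain : ∀ y o, InTree c.shared.heap y →
      c'.shared.heap.child y true = c.shared.heap.child y true → OnChain c.shared.heap y o →
      OnChain c'.shared.heap y o ∨ (c.shared.heap o).rem = true)
    (hstd : ∀ k o, StdN c.shared.heap k o → StdN c'.shared.heap k o ∨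
      (c.shared.heap o).rem = true ∨ (k ≤ (c.shared.heap o).key ∧
      (((c.shared.heap o).left ≠ none ∧ (c'.shared.heap o).left ≠ none) ∨
        (PendSucc P' o ∧ c.shared.lock o = some i))))
    (hpS : ∀ o, PendSucc P o → PendSucc P' o ∨ (c.shared.heap o).rem = true)
    (hpend : ∀ j w, j ≠ i → c.shared.lock w = some j → P' w = P w) : Grt i c P c' P' where
  next_le := hn.ge
  key o _ := by
    by_cases h : o = p
    · rw [h, hk]
    · rw [hh o h]
  data o _ := by
    by_cases h : o = p
    · rw [h, hd]
    · rw [hh o h]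
  frozen o h := hh o (by rintro rfl; simp [hrem] at h)
  tag_le o _ := by
    by_cases h : o = p
    · rw [h]; exact ht
    · rw [hh o h]
  locked j o hj ho := ⟨by rw [hl, ho], hh o (by
    rintro rfl
    exact hj (Option.some_injective _ (ho.symm.trans hp)))⟩
  priv n _ h1 _ h3 := ⟨hh n (by rintro rfl; exact h1 hpt), fun h =>
    (hback n h).elim h1 h3⟩
  tree := htree
  reader_eq j _ := by rw [hr]
  weak j k o h1 _ := hweak j k o h1
  chain := hchain
  std := hstd
  left_null o _ h := by
    by_cases ho : o = p
    · subst ho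
      exact (hln h).imp_right fun h => ⟨i, h⟩
    · exact .inl (by rwa [hh o ho])
  bump o := fun ⟨j, hj⟩ => by
    by_cases hji : j = i
    · subst hji
      exact (hb o hj).imp_left fun h => ⟨j, h⟩
    · exact .inl ⟨j, by rw [hpc j hji]; exact hj⟩
  pendS := hpS
  pend := hpend

/-- A write to the field `rem` or `tag` of a locked node. -/
theorem Inv.mark (I : Inv c P) (hn : c'.shared.next = c.shared.next)
    (hl : c'.shared.lock = c.shared.lock) (hr : c'.shared.reader = c.shared.reader)
    (hg : c'.shared.ghost = c.shared.ghost)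
    (hpc : ∀ j, j ≠ i → c'.pc j = c.pc j)
    (hp : c.shared.lock p = some i) (hrem : (c.shared.heap p).rem = false)
    (hpt : InTree c.shared.heap p)
    (hh : ∀ o, o ≠ p → c'.shared.heap o = c.shared.heap o)
    (hk : (c'.shared.heap p).key = (c.shared.heap p).key)
    (hd : (c'.shared.heap p).data = (c.shared.heap p).data)
    (hleft : (c'.shared.heap p).left = (c.shared.heap p).left)
    (hright : (c'.shared.heap p).right = (c.shared.heap p).right)
    (ht : (c.shared.heap p).tag ≤ (c'.shared.heap p).tag)
    (hb : ∀ o, (c.pc i).bump = some o → (c'.pc i).bump = some o ∨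
      (c.shared.heap o).tag < (c'.shared.heap o).tag) :
    TreeInv c'.shared.heap P ∧ (∀ o, InTree c'.shared.heap o → InTree c.shared.heap o) ∧
      Grt i c P c' P ∧ ∀ k d, Rep c'.shared.heap P k d ↔ Rep c.shared.heap P k d := by
  have hkey : ∀ o, (c'.shared.heap o).key = (c.shared.heap o).key := fun o => by
    by_cases h : o = p
    · rw [h, hk]
    · rw [hh o h]
  have hdata : ∀ o, (c'.shared.heap o).data = (c.shared.heap o).data := fun o => by
    by_cases h : o = p
    · rw [h, hd]
    · rw [hh o h]
  have hch : ∀ o e, c'.shared.heap.child o e = c.shared.heap.child o e := fun o e => by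
    by_cases h : o = p
    · simp only [Heap.child, h, hleft, hright]
    · simp only [Heap.child, hh o h]
  obtain ⟨T, it⟩ := I.tree.congr (h' := c'.shared.heap) (fun o _ => hkey o) fun o e _ => hch o e
  refine ⟨T, fun o h => (it o).1 h, ?_, fun k d => by simp only [Rep, it, hkey, hdata]⟩
  have hedge : ∀ A, Edge c'.shared.heap A = Edge c.shared.heap A := fun A => by
    funext x z
    simp only [Edge, hch]
  have hS : ∀ k, SDir c'.shared.heap k = SDir c.shared.heap k := fun k => by
    funext x z
    simp only [SDir, hkey]
  have hW : ∀ g k, WDir c'.shared.heap g k = WDir c.shared.heap g k := fun g k => by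
    funext x z
    simp only [WDir, hkey]
  refine Grt.ofWrite hn hl hr hpc hp hrem hpt hh hk hd ht hb (fun h => .inl (by rwa [hleft]))
    (fun o h => .inl ((it o).1 h)) (fun o h => .inl ((it o).2 h)) ?_ ?_ ?_ (fun _ h => .inl h)
    (fun _ _ _ _ => rfl)
  · intro j k o _ h
    left
    simpa only [WeakN, Rch, hedge, hW, hg] using h
  · intro y o _ _ h
    left
    simpa only [OnChain, Rch, hedge, hch] using h
  · intro k o h
    left
    simpa only [StdN, Rch, hedge, hS] using h

/-- Allocation of a node. -/
theorem Inv.alloc (I : Inv c P) {nd : Node} (hn : c'.shared.next = c.shared.next + 1)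
    (hl : c'.shared.lock = c.shared.lock) (hr : c'.shared.reader = c.shared.reader)
    (hg : c'.shared.ghost = fun j => Function.update (c.shared.ghost j) c.shared.next nd.key)
    (hpc : ∀ j, j ≠ i → c'.pc j = c.pc j) (hb : (c.pc i).bump = none)
    (hh : c'.shared.heap = Function.update c.shared.heap c.shared.next nd) :
    TreeInv c'.shared.heap P ∧ (∀ o, InTree c'.shared.heap o ↔ InTree c.shared.heap o) ∧
      Grt i c P c' P ∧ ∀ k d, Rep c'.shared.heap P k d ↔ Rep c.shared.heap P k d := by
  have hlt : ∀ o < c.shared.next, c'.shared.heap o = c.shared.heap o := fun o ho => by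
    rw [hh, Function.update_of_ne (ne_of_lt ho)]
  have hch : ∀ o e, InTree c.shared.heap o →
      c'.shared.heap.child o e = c.shared.heap.child o e := fun o e ho => by
    simp only [Heap.child, hlt o (I.tree_lt o ho)]
  have hkey : ∀ o, InTree c.shared.heap o →
      (c'.shared.heap o).key = (c.shared.heap o).key := fun o ho => by
    rw [hlt o (I.tree_lt o ho)]
  obtain ⟨T, it⟩ := I.tree.congr (h' := c'.shared.heap) hkey hch
  refine ⟨T, it, ?_, ?_⟩
  · constructor
    · omega
    · intro o ho; rw [hlt o ho]
    · intro o ho; rw [hlt o ho]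
    · intro o ho; rw [hlt o (I.rem_lt ho)]
    · intro o ho; rw [hlt o ho]
    · intro j o _ ho; exact ⟨by rw [hl, ho], hlt o (I.lock_lt o j ho)⟩
    · intro n hn h1 _ _; exact ⟨hlt n hn, by rwa [it]⟩
    · intro o ho; exact .inl ((it o).2 ho)
    · intro j _; rw [hr]
    · intro j k o _ _ h
      left
      refine Rch.congr hch (fun o f ho hf => ?_) h
      have : o ≠ c.shared.next := (I.tree_lt o ho).ne
      simpa only [WDir, hkey o ho, hg, Function.update_of_ne this] using hf
    · intro y o hy e ⟨r, h1, h2⟩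
      left
      refine ⟨r, by rw [e, h1], ?_⟩
      have hrt := hy.child h1
      clear h1
      induction h2 with
      | refl => exact .refl
      | tail hb e ih =>
        obtain ⟨f, hf, e⟩ := e
        exact ih.tail ⟨f, hf, by rw [hch _ _ (hrt.desc (Rch.toDesc hb)), e]⟩
    · intro k o h
      left
      exact Rch.congr hch (fun o f ho hf => by simpa only [SDir, hkey o ho] using hf) h
    · intro o ho h; left; rwa [hlt o ho]
    · rintro o ⟨j, hj⟩
      left
      by_cases hji : j = i
      · subst hji; simp [hb] at hj
      · exact ⟨j, by rw [hpc j hji]; exact hj⟩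
    · exact fun _ h => .inl h
    · exact fun _ _ _ _ => rfl
  · intro k d
    constructor
    · rintro ⟨x, h1, h2, h3, h4⟩
      rw [it] at h1
      rw [hlt x (I.tree_lt x h1)] at h3 h4
      exact ⟨x, h1, h2, h3, h4⟩
    · rintro ⟨x, h1, h2, h3, h4⟩
      rw [← hlt x (I.tree_lt x h1)] at h3 h4
      exact ⟨x, (it x).2 h1, h2, h3, h4⟩

/-- The heap after a write to a child field of `p`. -/
structure ChildWrite (c c' : Config) (i : Tid) (p : ℕ) (e : Bool) (b : Ptr) : Prop where
  next : c'.shared.next = c.shared.next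
  lock : c'.shared.lock = c.shared.lock
  reader : c'.shared.reader = c.shared.reader
  pc : ∀ j, j ≠ i → c'.pc j = c.pc j
  lock_p : c.shared.lock p = some i
  rem_p : (c.shared.heap p).rem = false
  other : ∀ o, o ≠ p → c'.shared.heap o = c.shared.heap o
  key : (c'.shared.heap p).key = (c.shared.heap p).key
  data : (c'.shared.heap p).data = (c.shared.heap p).data
  tag : (c'.shared.heap p).tag = (c.shared.heap p).tag
  set : c'.shared.heap.child p e = b
  keep : c'.shared.heap.child p (!e) = c.shared.heap.child p (!e)
  bump : (c.pc i).bump = none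

section
variable {e : Bool} {b : Ptr} (W : ChildWrite c c' i p e b)
include W

theorem ChildWrite.setChild : SetChild c.shared.heap c'.shared.heap p e b := by
  refine ⟨fun o => ?_, fun o f h => ?_, W.set⟩
  · by_cases h : o = p
    · rw [h, W.key]
    · rw [W.other o h]
  · by_cases ho : o = p
    · subst ho
      have : f = !e := by cases f <;> cases e <;> simp_all
      rw [this, W.keep]
    · simp only [Heap.child, W.other o ho]

theorem ChildWrite.data' (o : ℕ) : (c'.shared.heap o).data = (c.shared.heap o).data := by
  by_cases h : o = p
  · rw [h, W.data]
  · rw [W.other o h]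

theorem ChildWrite.sdir {k o f} (H : SDir c.shared.heap k o f) : SDir c'.shared.heap k o f := by
  simpa only [SDir, W.setChild.key] using H

theorem ChildWrite.wdir {g : ℕ → Key} {k o f} (H : WDir c.shared.heap g k o f) :
    WDir c'.shared.heap g k o f := by
  simpa only [WDir, W.setChild.key] using H

theorem ChildWrite.left_null {b' : ℕ} (hb : b = some b') :
    (c.shared.heap o).left ≠ none → (c'.shared.heap o).left ≠ none := by
  intro h
  by_cases ho : o = p
  · subst ho
    have h1 := W.set
    have h2 := W.keep
    cases e
    · simp only [Heap.child, cond_false] at h1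
      simp [h1, hb]
    · simp only [Heap.child, Bool.not_true, cond_false] at h2
      rwa [h2]
  · rwa [W.other o ho]

/-- Linking a new leaf below a locked node where the search for `k` ends adds `k` to the abstract
map, from which it was absent. -/
theorem ChildWrite.insert (I : Inv c P) (hb : b = some n) (h0 : c.shared.heap.child p e = none)
    (hg : c'.shared.ghost = c.shared.ghost)
    (hst : StdN c.shared.heap (userKey k) p) (hd : SDir c.shared.heap (userKey k) p e)
    (hlf : Leaf c.shared k d n) (hcopy : (c.pc i).copy = none) (hf : (c.pc i).fresh = some n) :
    TreeInv c'.shared.heap P ∧ (∀ o, InTree c'.shared.heap o → InTree c.shared.heap o ∨ o = n) ∧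
      Grt i c P c' P ∧ (∀ d, ¬ Rep c.shared.heap P k d) ∧
      ∀ k' d', Rep c'.shared.heap P k' d' ↔ (k' = k ∧ d' = d) ∨
        (k' ≠ k ∧ Rep c.shared.heap P k' d') := by
  subst hb
  have hkn : (c.shared.heap n).key = userKey k := by rw [hlf.eq]
  have hdn : (c.shared.heap n).data = d := by rw [hlf.eq]
  have hs := W.setChild
  obtain ⟨T, it⟩ := I.tree.insert hs h0 (by rw [hkn]; exact hst) (by rw [hkn]; exact hd) hlf.tree
    (fun e => by cases e <;> simp [Heap.child, hlf.eq]) (I.not_pend hcopy W.lock_p).2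
  have hnS : ¬ PendSucc P n := by
    rintro ⟨w, q, H⟩
    exact hlf.tree (I.tree.pend H).cs_inTree
  -- the search for `k` ends at `p`, hence `k` is absent
  have habs : ∀ d, ¬ Rep c.shared.heap P k d := by
    rintro d ⟨x, h1, h2, h3, -⟩
    have h4 := I.tree.own h1 h2
    rw [h3] at h4
    have h5 : StdN c'.shared.heap (userKey k) x := insert_forward hs h0 (fun _ _ => W.sdir) h4
    have h6 : StdN c'.shared.heap (userKey k) n :=
      ReflTransGen.tail (insert_forward hs h0 (fun _ _ => W.sdir) hst) ⟨e, W.sdir hd, W.set⟩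
    have := std_unique h5 h6 (by rw [hs.key, h3]) (by rw [hs.key, hkn])
    subst this
    exact hlf.tree h1
  refine ⟨T, fun o h => (it o).1 h, ?_, habs, ?_⟩
  · refine Grt.ofWrite W.next W.lock W.reader W.pc W.lock_p W.rem_p hst.inTree W.other W.key W.data
      W.tag.ge (by simp [W.bump]) (fun h => .inl (W.left_null rfl h)) ?_
      (fun o h => .inl ((it o).2 (.inl h))) ?_ ?_ ?_ (fun _ h => .inl h) (fun _ _ _ _ => rfl)
    · intro o h
      exact ((it o).1 h).imp_right fun h => by rw [hf, h]
    · intro j k o _ h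
      left
      exact insert_forward hs h0 (fun _ _ H => by rw [hg]; exact W.wdir H) h
    · rintro y o _ h1 ⟨r, h2, h3⟩
      exact .inl ⟨r, by rw [h1, h2], insert_forward hs h0 (fun _ _ H => H) h3⟩
    · intro k o h
      left
      exact insert_forward hs h0 (fun _ _ => W.sdir) h
  · intro k' d'
    simp only [Rep, it, hs.key, W.data']
    constructor
    · rintro ⟨x, h1 | rfl, h2, h3, h4⟩
      · by_cases hk : k' = k
        · subst hk
          exact absurd ⟨x, h1, h2, h3, h4⟩ (habs d')
        · exact .inr ⟨hk, x, h1, h2, h3, h4⟩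
      · left
        exact ⟨userKey_inj (h3.symm.trans hkn), by rw [← h4, hdn]⟩
    · rintro (⟨rfl, rfl⟩ | ⟨-, x, h1, h2, h3, h4⟩)
      · exact ⟨n, .inr rfl, hnS, hkn, hdn⟩
      · exact ⟨x, .inl h1, h2, h3, h4⟩

/-- The common part of bypassing a node with a null child and unlinking a successor. -/
theorem ChildWrite.splice (I : Inv c P) {f : Bool}
    (hpt : InTree c.shared.heap p) (hy : c.shared.heap.child p e = some y)
    (hc : c.shared.heap.child y f = b) (hn : c.shared.heap.child y (!f) = none)
    (hry : (c.shared.heap y).rem = true)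
    (hg : ∀ j, c.shared.reader j = true → c'.shared.ghost j = c.shared.ghost j)
    (hb : e = false → b = none → (c'.pc i).bump = some p)
    (hPy : P y = none)
    (hP : ∀ w k z, P' w = some (k, z) → P w = some (k, z) ∧ z ≠ y ∧ w ≠ p ∧ z ≠ p)
    (hP' : ∀ w k z, P w = some (k, z) → P' w = some (k, z) ∨ (P' w = none ∧ z = y))
    (hpend : ∀ j w, j ≠ i → c.shared.lock w = some j → P' w = P w) :
    TreeInv c'.shared.heap P' ∧ (∀ o, InTree c'.shared.heap o ↔ InTree c.shared.heap o ∧ o ≠ y) ∧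
      Grt i c P c' P' := by
  have hs := W.setChild
  have hyp := I.tree.child_ne hpt hy
  obtain ⟨T, it⟩ := I.tree.splice hs hpt hy hc hn hPy hP hP'
  refine ⟨T, it, ?_⟩
  refine Grt.ofWrite W.next W.lock W.reader W.pc W.lock_p W.rem_p hpt W.other W.key W.data
    W.tag.ge (by simp [W.bump]) ?_ (fun o h => .inl ((it o).1 h).1) ?_ ?_ ?_ ?_ ?_ hpend
  · intro h
    cases e
    · rcases hb' : b with _ | b'
      · exact .inr (hb rfl hb')
      · exact .inl (W.left_null hb' h)
    · have h2 := W.keep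
      simp only [Heap.child, Bool.not_true, cond_false] at h2
      exact .inl (by rwa [h2])
  · intro o h
    by_cases ho : o = y
    · exact .inr (by rw [ho, hry])
    · exact .inl ((it o).2 ⟨h, ho⟩)
  · intro j k o hj h
    rcases splice_forward (A' := WDir c'.shared.heap (c'.shared.ghost j) k) hs hy hc hn hyp.symm
      (fun _ _ H => by rw [hg j hj]; exact W.wdir H) h with H | H
    · exact .inr (by rw [H.1, hry])
    · exact .inl H
  · rintro z o _ h1 ⟨r, h2, h3⟩
    rcases splice_forward (A' := LeftDir) hs hy hc hn hyp.symm (fun _ _ H => H) h3 with H | H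
    · exact .inr (by rw [H.1, hry])
    · exact .inl ⟨r, by rw [h1, h2], H⟩
  · intro k o h
    rcases splice_forward (A' := SDir c'.shared.heap k) hs hy hc hn hyp.symm
      (fun _ _ H => W.sdir H) h with H | H
    · exact .inr (.inl (by rw [H.1, hry]))
    · exact .inl H
  · rintro o ⟨w, k, h⟩
    rcases hP' w k o h with h | ⟨-, rfl⟩
    · exact .inl ⟨w, k, h⟩
    · exact .inr hry

/-- Bypassing a marked node `y` with a null child removes the key of `y` from the abstract map. -/
theorem ChildWrite.bypass (I : Inv c P) {f : Bool}
    (hpt : InTree c.shared.heap p) (hy : c.shared.heap.child p e = some y)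
    (hc : c.shared.heap.child y f = b) (hn : c.shared.heap.child y (!f) = none)
    (hry : (c.shared.heap y).rem = true) (hly : c.shared.lock y = some i)
    (hg : c'.shared.ghost = c.shared.ghost)
    (hb : e = false → b = none → (c'.pc i).bump = some p)
    (hky : (c.shared.heap y).key = userKey k) (hcopy : (c.pc i).copy = none) :
    TreeInv c'.shared.heap P ∧ (∀ o, InTree c'.shared.heap o → InTree c.shared.heap o) ∧
      Grt i c P c' P ∧ (∃ d, Rep c.shared.heap P k d) ∧
      ∀ k' d', Rep c'.shared.heap P k' d' ↔ (k' ≠ k ∧ Rep c.shared.heap P k' d') := by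
  obtain ⟨hPy, hSy⟩ := I.not_pend hcopy hly
  obtain ⟨T, it, G⟩ := W.splice I hpt hy hc hn hry (fun _ _ => by rw [hg]) hb hPy
    (fun w k z H => ⟨H, (I.pend_other H (by simp [hcopy]) hly).2,
      I.pend_other H (by simp [hcopy]) W.lock_p⟩) (fun _ _ _ H => .inl H) (fun _ _ _ _ => rfl)
  refine ⟨T, fun o h => ((it o).1 h).1, G, ⟨_, y, hpt.child hy, hSy, hky, rfl⟩, fun k' d' => ?_⟩
  simp only [Rep, it, W.setChild.key, W.data']
  constructor
  · rintro ⟨x, ⟨h1, h5⟩, h2, h3, h4⟩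
    refine ⟨?_, x, h1, h2, h3, h4⟩
    rintro rfl
    have o1 := I.tree.own h1 h2
    have o2 := I.tree.own (hpt.child hy) hSy
    rw [h3] at o1
    rw [hky] at o2
    exact h5 (std_unique o1 o2 h3 hky)
  · rintro ⟨hk, x, h1, h2, h3, h4⟩
    refine ⟨x, ⟨h1, ?_⟩, h2, h3, h4⟩
    rintro rfl
    exact hk (userKey_inj (h3.symm.trans hky))

/-- Unlinking the marked successor finishes a deletion with two children. The abstract map does not
change: the copy takes over from the successor as the node that represents their common key. -/
theorem ChildWrite.unlink (I : Inv c P)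
    (hpt : InTree c.shared.heap p) (hy : c.shared.heap.child p e = some cs)
    (hc : c.shared.heap.child cs true = b)
    (hry : (c.shared.heap cs).rem = true) (hly : c.shared.lock cs = some i)
    (hg : ∀ j, c.shared.reader j = true → c'.shared.ghost j = c.shared.ghost j)
    (hb : e = false → b = none → (c'.pc i).bump = some p)
    (hPw : P w = some (q, cs)) (hcopy : (c.pc i).copy = some w) (hlw : c.shared.lock w = some i) :
    TreeInv c'.shared.heap (Function.update P w none) ∧
      (∀ o, InTree c'.shared.heap o → InTree c.shared.heap o) ∧
      Grt i c P c' (Function.update P w none) ∧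
      ∀ k' d', Rep c'.shared.heap (Function.update P w none) k' d' ↔ Rep c.shared.heap P k' d' := by
  have L := I.tree.pend hPw
  have hoth : ∀ w' k z, w' ≠ w → P w' = some (k, z) → z ≠ cs ∧ w' ≠ p ∧ z ≠ p := by
    intro w' k z hne H
    have hc : (c.pc i).copy ≠ some w' := by rw [hcopy]; simpa using hne.symm
    exact ⟨(I.pend_other H hc hly).2, I.pend_other H hc W.lock_p⟩
  have hup : ∀ w' k z, Function.update P w none w' = some (k, z) ↔
      (w' ≠ w ∧ P w' = some (k, z)) := by
    intro w' k z
    by_cases h : w' = w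
    · subst h; simp
    · simp [h]
  obtain ⟨T, it, G⟩ := W.splice (P' := Function.update P w none) I hpt hy hc L.left_cs hry hg hb
    L.cs_none
    (fun w' k z H => by
      obtain ⟨h1, h2⟩ := (hup _ _ _).1 H
      exact ⟨h2, hoth _ _ _ h1 h2⟩)
    (fun w' k z H => by
      by_cases h : w' = w
      · subst h
        rw [hPw] at H
        simp only [Option.some.injEq, Prod.mk.injEq] at H
        exact .inr ⟨by simp, H.2.symm⟩
      · exact .inl ((hup _ _ _).2 ⟨h, H⟩))
    (fun j w' hj h => by
      rw [Function.update_of_ne]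
      rintro rfl
      exact hj (Option.some_injective _ (h.symm.trans hlw)))
  refine ⟨T, fun o h => ((it o).1 h).1, G, fun k' d' => ?_⟩
  simp only [Rep, it, W.setChild.key, W.data', PendSucc, hup]
  constructor
  · rintro ⟨x, ⟨h1, h5⟩, h2, h3, h4⟩
    refine ⟨x, h1, ?_, h3, h4⟩
    rintro ⟨w', k, H⟩
    by_cases hw : w' = w
    · subst hw
      rw [hPw] at H
      simp only [Option.some.injEq, Prod.mk.injEq] at H
      exact h5 H.2.symm
    · exact h2 ⟨w', k, hw, H⟩
  · rintro ⟨x, h1, h2, h3, h4⟩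
    refine ⟨x, ⟨h1, ?_⟩, ?_, h3, h4⟩
    · rintro rfl
      exact h2 ⟨_, _, hPw⟩
    · rintro ⟨w', k, -, H⟩
      exact h2 ⟨w', k, H⟩

/-- Linking the copy opens a deletion with two children. It removes the key of `y` from the abstract
map, and the copy now represents the key of the successor. Since the ghost key of the copy is the
key of `y`, weak searches go on as before. -/
theorem ChildWrite.link (I : Inv c P) (D : Dup c.shared i k p y ps cs)
    (hry : (c.shared.heap y).rem = true) (C : Copy c.shared y cs w)
    (hb : b = some w) (hy : c.shared.heap.child p e = some y)
    (hg : ∀ j, c.shared.reader j = true →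
      c'.shared.ghost j = Function.update (c.shared.ghost j) w (userKey k))
    (hlw : c.shared.lock w = some i) (hcopy : (c.pc i).copy = none)
    (hf : (c.pc i).fresh = some w) :
    TreeInv c'.shared.heap (Function.update P w (some (userKey k, cs))) ∧
      (∀ o, InTree c'.shared.heap o → InTree c.shared.heap o ∨ o = w) ∧
      Grt i c P c' (Function.update P w (some (userKey k, cs))) ∧ (∃ d, Rep c.shared.heap P k d) ∧
      ∀ k' d', Rep c'.shared.heap (Function.update P w (some (userKey k, cs))) k' d' ↔
        (k' ≠ k ∧ Rep c.shared.heap P k' d') := by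
  subst hb
  have hs := W.setChild
  have hpt := D.held.tree_x
  have hyt := D.held.tree_y
  have hky := D.held.key_y
  obtain ⟨hPy, hSy⟩ := I.not_pend hcopy D.held.lock_y
  obtain ⟨hPcs, hScs⟩ := I.not_pend hcopy D.lock_cs
  have hyp := I.tree.child_ne hpt hy
  have hwp : w ≠ p := by rintro rfl; exact C.tree hpt
  have hch : OnChain c.shared.heap y cs := by
    rcases Hind.or D.walk.1 with H | H
    · exact H
    · simp [D.rem_cs] at H
  have hcst := hch.inTree hyt
  obtain ⟨r, er, hr⟩ := hch
  have hlt : (c.shared.heap y).key < (c.shared.heap cs).key :=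
    I.tree.right_gt' hyt er (Rch.toDesc hr) hScs
  have hPw : P w = none := by
    rcases e : P w with _ | ⟨q, z⟩
    · rfl
    · exact absurd (I.tree.pend e).inTree C.tree
  obtain ⟨T, it⟩ := I.tree.link hs hpt hy C.child C.tree hPy hSy
    (fun w' q z H => I.pend_other H (by simp [hcopy]) W.lock_p) ⟨r, er, hr⟩ D.left_cs hPcs hScs
    D.left_y C.key
  rw [hky] at T
  have hup : ∀ w' k' z, Function.update P w (some (userKey k, cs)) w' = some (k', z) ↔
      (w' = w ∧ k' = userKey k ∧ z = cs) ∨ P w' = some (k', z) := by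
    intro w' k' z
    by_cases h : w' = w
    · subst h
      simp only [Function.update_self, Option.some.injEq, Prod.mk.injEq, true_and, hPw,
        reduceCtorEq, or_false]
      exact ⟨fun ⟨a, b⟩ => ⟨a.symm, b.symm⟩, fun ⟨a, b⟩ => ⟨a.symm, b.symm⟩⟩
    · simp [h]
  refine ⟨T, fun o h => ((it o).1 h).imp_left And.left, ?_, ⟨_, y, hyt, hSy, hky, rfl⟩, ?_⟩
  · refine Grt.ofWrite W.next W.lock W.reader W.pc W.lock_p W.rem_p hpt W.other W.key W.data
      W.tag.ge (by simp [W.bump]) (fun h => .inl (W.left_null rfl h)) ?_ ?_ ?_ ?_ ?_ ?_ ?_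
    · intro o h
      exact ((it o).1 h).imp And.left fun h => by rw [hf, h]
    · intro o h
      by_cases ho : o = y
      · exact .inr (by rw [ho, hry])
      · exact .inl ((it o).2 (.inl ⟨h, ho⟩))
    · intro j k' o hj h
      have hgy : c.shared.ghost j y = userKey k := by
        rcases I.ghostOK hj y with H | ⟨q, s, H, -⟩
        · rw [H, hky]
        · simp [hPy] at H
      have hAw : ∀ f, WDir c.shared.heap (c.shared.ghost j) k' y f →
          WDir c'.shared.heap (c'.shared.ghost j) k' w f := by
        intro f hf
        rw [hky] at hlt
        cases f
        · simp only [WDir, cond_false, hs.key, C.key, hky] at hf ⊢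
          exact lt_trans hf hlt
        · simp only [WDir, cond_true, hs.key, C.key, hky, hgy, hg j hj, Function.update_self,
            ne_eq, not_true_eq_false, and_false, or_false] at hf ⊢
          by_cases hk : k' = (c.shared.heap cs).key
          · exact .inr ⟨hk, hlt.ne⟩
          · exact .inl ⟨hf.1, hk⟩
      rcases link_forward (A' := WDir c'.shared.heap (c'.shared.ghost j) k') hs hy C.child
        hwp.symm hyp.symm (fun o f ho H => by
          have := W.wdir H
          rw [hg j hj]
          simpa only [WDir, Function.update_of_ne ho] using this) hAw
        (fun z hz => by rintro rfl; exact C.tree (Rch.inTree hz)) h with H | H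
      · exact .inr (by rw [H.1, hry])
      · exact .inl H
    · rintro z o hz h1 ⟨r, h2, h3⟩
      rcases link_forward (A' := LeftDir) hs hy C.child
        hwp.symm hyp.symm (fun _ _ _ H => H) (fun _ H => H)
        (fun x hx => by rintro rfl; exact C.tree ((hz.child h2).desc (Rch.toDesc hx))) h3 with H | H
      · exact .inr (by rw [H.1, hry])
      · exact .inl ⟨r, by rw [h1, h2], H⟩
    · intro k' o h
      rcases I.tree.link_std hs hpt hy C.child C.tree er hr D.left_cs C.key hlt h with
        rfl | H | ⟨h1, h2, h3⟩
      · exact .inr (.inl hry)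
      · exact .inl H
      · right; right
        rcases ReflTransGen.cases_head h3 with rfl | ⟨z, ⟨f, hf, ez⟩, hz⟩
        · exact ⟨h1, .inr ⟨⟨w, _, (hup _ _ _).2 (.inl ⟨rfl, rfl, rfl⟩)⟩, D.lock_cs⟩⟩
        · obtain rfl : f = false := hf
          have hot : InTree c.shared.heap o := (hyt.child er).desc (Rch.toDesc h2)
          have hne : (c.shared.heap o).left ≠ none := by
            have : (c.shared.heap o).left = some z := ez
            simp [this]
          exact ⟨h1.trans (I.tree.left_lt hot ez (Rch.toDesc hz)).le,
            .inl ⟨hne, W.left_null rfl hne⟩⟩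
    · rintro o ⟨w', q, H⟩
      exact .inl ⟨w', q, (hup _ _ _).2 (.inr H)⟩
    · intro j w' hj h
      rw [Function.update_of_ne]
      rintro rfl
      exact hj (Option.some_injective _ (h.symm.trans hlw))
  · intro k' d'
    simp only [Rep, it, hs.key, W.data', PendSucc, hup]
    constructor
    · rintro ⟨x, h1, h2, h3, h4⟩
      rcases h1 with ⟨h1, h5⟩ | rfl
      · have hSx : ¬ PendSucc P x := fun ⟨w', q, H⟩ => h2 ⟨w', q, .inr H⟩
        refine ⟨?_, x, h1, hSx, h3, h4⟩
        rintro rfl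
        have o1 := I.tree.own h1 hSx
        have o2 := I.tree.own hyt hSy
        rw [h3] at o1
        rw [hky] at o2
        exact h5 (std_unique o1 o2 h3 hky)
      · rw [C.key] at h3
        rw [C.data] at h4
        refine ⟨?_, cs, hcst, hScs, h3, h4⟩
        rintro rfl
        rw [hky, h3] at hlt
        exact lt_irrefl _ hlt
    · rintro ⟨hk, x, h1, h2, h3, h4⟩
      by_cases hx : x = cs
      · subst hx
        refine ⟨w, .inr rfl, ?_, by rw [C.key, h3], by rw [C.data, h4]⟩
        rintro ⟨w', q, ⟨-, -, rfl⟩ | H⟩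
        · exact C.tree hcst
        · exact C.tree (I.tree.pend H).cs_inTree
      · refine ⟨x, .inl ⟨h1, ?_⟩, ?_, h3, h4⟩
        · rintro rfl
          exact hk (userKey_inj (h3.symm.trans hky))
        · rintro ⟨w', q, ⟨-, -, rfl⟩ | H⟩
          · exact hx rfl
          · exact h2 ⟨w', q, H⟩
end
end

/-! ### The invariant is inductive -/

/-- The thread of the action `a` is `i`, and the action leads from `c` to `c'`. -/
structure IsStep (i : Tid) (a : Act) (c c' : Config) : Prop where
  local_ : LStep c.shared i (c.pc i) a (c'.pc i)
  other : ∀ j, j ≠ i → c'.pc j = c.pc j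
  shared : c'.shared = applyAct i c.shared a

/-- The unfinished deletions after the step of a thread at a control point. -/
def PC.pendStep : PC → Pend → Pend
  | .linkLeft k _ _ _ cs w, P | .linkRight k _ _ _ cs w, P =>
      Function.update P w (some (userKey k, cs))
  | .unlinkW _ w _, P | .unlinkPs _ _ w _, P => Function.update P w none
  | _, P => P

/-- The operation that takes effect by the step from a control point. -/
def PC.commit : PC → Option Op
  | .insWriteLeft k d _ _ | .insWriteRight k d _ _ => some (.insert k d)
  | .bypLeft k _ _ _ | .bypRight k _ _ _ | .linkLeft k _ _ _ _ _ | .linkRight k _ _ _ _ _ =>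
      some (.delete k)
  | _ => none

/-- The change of the abstract map when the operation, if any, takes effect. -/
def RepStep (R R' : ℕ → ℕ → Prop) : Option Op → Prop
  | none => ∀ k d, R' k d ↔ R k d
  | some (.insert k d) => (∀ d, ¬ R k d) ∧
      ∀ k' d', R' k' d' ↔ (k' = k ∧ d' = d) ∨ (k' ≠ k ∧ R k' d')
  | some (.delete k) => (∃ d, R k d) ∧ ∀ k' d', R' k' d' ↔ (k' ≠ k ∧ R k' d')
  | some (.contains _) => False

section
variable {c c' : Config} {P P' : Pend} {i j : Tid} {k x y z w v ps cs d n p o : ℕ} {q : Key}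
  {a : Act}

/-- A weakly reachable node that is not standardly reachable is on the chain of left pointers to the
successor of an unfinished deletion. -/
theorem Inv.weak_std (I : Inv c P) (hi : c.shared.reader i = true) (H : WeakN c.shared i q x) :
    StdN c.shared.heap q x ∨
      (q ≤ (c.shared.heap x).key ∧ ((c.shared.heap x).left ≠ none ∨ PendSucc P x)) := by
  rcases weak_cases I.tree (I.ghostOK hi) H with H | ⟨w, cs, r, D, er, h1, h2, -⟩
  · exact .inl H
  · have W := I.tree.pend D.pend
    refine .inr ⟨D.le.trans (I.tree.right_ge W.inTree er (Rch.toDesc h1)), ?_⟩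
    rcases ReflTransGen.cases_head h2 with rfl | ⟨z, ⟨f, hf, ez⟩, hz⟩
    · exact .inr ⟨_, _, D.pend⟩
    · obtain rfl : f = false := hf
      have : (c.shared.heap x).left = some z := ez
      exact .inl (by simp [this])

/-- The exceptions in `TagStable` cover the two ways of being weakly but not standardly reachable.
-/
theorem Inv.weak_tagStable (I : Inv c P) (hi : c.shared.reader i = true)
    (H : WeakN c.shared i q x) : TagStable c P q x (c.shared.heap x).tag := by
  refine ⟨I.tree_lt x H.inTree, le_rfl, ?_⟩
  rcases I.weak_std hi H with H | ⟨-, H | H⟩ <;> simp [H]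

theorem Inv.weak_rightStable (I : Inv c P) (hi : c.shared.reader i = true)
    (H : WeakN c.shared i q x) : RightStable c.shared q x := by
  refine ⟨I.tree_lt x H.inTree, fun h => .inr ?_⟩
  rcases I.weak_std hi H with H | ⟨H, -⟩
  · exact H
  · exact absurd h (not_lt.2 H)

theorem Inv.visited_stable (I : Inv c P) (hi : c.shared.reader i = true)
    (H : Visited c.shared i k x) : TagStable c P (userKey k) x (c.shared.heap x).tag ∧
      RightStable c.shared (userKey k) x := by
  rcases Hind.or H with H | H
  · exact ⟨I.weak_tagStable hi H, I.weak_rightStable hi H⟩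
  · exact ⟨⟨I.rem_lt H, le_rfl, .inl H⟩, I.rem_lt H, fun _ => .inl H⟩

/-- What an insertion to the left concludes from the validation of the tag, once it holds the lock:
all the exceptions in `TagStable` are excluded. -/
theorem Inv.tagStable_std (I : Inv c P) (H : TagStable c P q x (c.shared.heap x).tag)
    (hrem : (c.shared.heap x).rem = false) (hl : (c.shared.heap x).left = none)
    (hb : ∀ j, c.shared.lock x = some j → (c.pc j).bump = none ∧ (c.pc j).copy = none) :
    StdN c.shared.heap q x := by
  rcases H.2.2 with H | H | ⟨j, H⟩ | H | ⟨w, k, H⟩ | H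
  · simp [hrem] at H
  · exact absurd H (lt_irrefl _)
  · have h := I.pc j
    have hlk : c.shared.lock x = some j := by
      generalize c.pc j = p at *
      cases p <;> simp only [PC.bump, Option.some.injEq, reduceCtorEq] at H <;>
        subst H <;> exact h.1
    simp [(hb j hlk).1] at H
  · exact absurd hl H
  · obtain ⟨j, h1, -, h3⟩ := I.pend_locked H
    simp [(hb j h3).2] at h1
  · exact H

/-- The side on which `y` is a child of `x` is the one to which `x.key` is compared. -/
theorem Inv.held_side (I : Inv c P) (H : Held c.shared i k x y) (hcopy : (c.pc i).copy = none) :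
    (userKey k < (c.shared.heap x).key → c.shared.heap.child x false = some y) ∧
    (¬ userKey k < (c.shared.heap x).key → c.shared.heap.child x true = some y) := by
  obtain ⟨d, e⟩ := H.child
  obtain ⟨hP, hS⟩ := I.not_pend hcopy H.lock_y
  cases d
  · have := I.tree.left_lt H.tree_x e .refl
    rw [H.key_y] at this
    exact ⟨fun _ => e, fun h => absurd this h⟩
  · have := I.tree.right_gt' H.tree_x e .refl hS
    rw [H.key_y] at this
    exact ⟨fun h => absurd h (not_lt.2 this.le), fun _ => e⟩

theorem Published.inTree {s : Shared} (H : Published s x) (h : (s.heap x).rem = false) :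
    InTree s.heap x := H.resolve_right (by simp [h])

theorem Held.of_lock {s s' : Shared} (H : Held s i k x y) (hh : s'.heap = s.heap)
    (hl : ∀ o, s.lock o = some i → s'.lock o = some i) : Held s' i k x y :=
  ⟨hl _ H.lock_x, hl _ H.lock_y, by rw [hh]; exact H.rem_x, by rw [hh]; exact H.tree_x,
    by rw [hh]; exact H.key_y, by rw [hh]; exact H.child⟩

theorem Dup.of_lock {s s' : Shared} (H : Dup s i k x y ps cs) (hh : s'.heap = s.heap)
    (hl : ∀ o, s.lock o = some i → s'.lock o = some i) : Dup s' i k x y ps cs :=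
  ⟨H.held.of_lock hh hl, by rw [hh]; exact H.left_y, by
    have := H.walk
    simp only [Walk, Walked, hh] at this ⊢
    exact this, hl _ H.lock_ps, hl _ H.lock_cs,
    by rw [hh]; exact H.rem_cs, by rw [hh]; exact H.left_cs, by rw [hh]; exact H.ps_ne⟩

/-- What a thread knows after a step that reads or changes nothing. -/
theorem Inv.own_read (I : Inv c P) (hsh : c'.shared = c.shared)
    (ht : ∀ q x v, TagStable c P q x v → TagStable c' P q x v)
    (S : LStep c.shared i (c.pc i) a (c'.pc i)) (ha : a = .tau ∨ ∃ l, a = .read l) :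
    PCInv c' P i (c'.pc i) := by
  have H := I.pc i
  have hr := I.reader i
  have hside := fun k x y h => I.held_side (i := i) (k := k) (x := x) (y := y) h
  have hstd : ∀ {q x}, TagStable c P q x (c.shared.heap x).tag →
    (c.shared.heap x).rem = false → (c.shared.heap x).left = none →
    c.shared.lock x = some i → (c.pc i).bump = none → (c.pc i).copy = none →
    StdN c.shared.heap q x := fun h1 h2 h3 h4 h5 h6 => I.tagStable_std h1 h2 h3 fun j hj => by
      obtain rfl := Option.some_injective _ (h4.symm.trans hj)
      exact ⟨h5, h6⟩
  generalize c.pc i = p at *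
  generalize c'.pc i = p' at *
  cases S <;> simp only [PCInv, hsh, PC.inSection] at H hr ⊢ <;>
    try simp only [reduceCtorEq, false_or, exists_false] at ha
  case locNull => exact ⟨H.1, H.2.1, by simp⟩
  case locFound e =>
    refine ⟨H.1, H.2.1, ?_⟩
    rintro _ ⟨rfl⟩
    exact ⟨e, (H.2.2 _ rfl).published⟩
  case locGoRight e | locGoLeft e => exact ⟨H.2.2 _ rfl, e⟩
  case locRight => exact ⟨H.1, H.2.ne, fun z hz => H.1.next ⟨true, H.2, hz⟩ (I.weak_next hr)⟩
  case locLeft => exact ⟨H.1, H.2.ne', fun z hz => H.1.next ⟨false, H.2, hz⟩ (I.weak_next hr)⟩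
  case locTag =>
    obtain ⟨h1, h2⟩ := I.visited_stable hr H.1
    exact ⟨⟨ht _ _ _ h1, h2⟩, ⟨H.1.published, H.2.1⟩, H.2.2⟩
  case insNull => exact ⟨ht _ _ _ H.1.1, H.1.2⟩
  case insRemF e => exact ⟨⟨ht _ _ _ H.1.1, H.1.2⟩, H.2, e⟩
  case insKeyL e => exact ⟨ht _ _ _ H.1.1, H.2.1, H.2.2, e⟩
  case insKeyR e => exact ⟨(H.1.2.2 e).resolve_left (by simp [H.2.2]), H.2.1, H.2.2, e⟩
  case insLeftN e => exact ⟨ht _ _ _ H.1, H.2.1, H.2.2.1, H.2.2.2, e⟩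
  case insTagE e =>
    subst e
    exact ⟨hstd H.1 H.2.2.1 H.2.2.2.2 H.2.1 rfl rfl, H.2⟩
  case insRightN e => exact ⟨H, e⟩
  case delFound => exact ⟨H.2.1.1, H.2.2 _ rfl⟩
  case delRemYF e => exact ⟨H.1, H.2.1, H.2.2, e⟩
  case delRemXF e => exact ⟨H.1, H.2.1, H.2.2.1, H.2.2.2, e⟩
  case delParLeftE e =>
    exact ⟨⟨H.2.1, H.2.2.1, H.2.2.2.2, H.1.1.inTree H.2.2.2.2, H.1.2.1, false, e⟩, H.2.2.2.1⟩
  case delParLeftN => exact H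
  case delParRightE e =>
    exact ⟨⟨H.2.1, H.2.2.1, H.2.2.2.2, H.1.1.inTree H.2.2.2.2, H.1.2.1, true, e⟩, H.2.2.2.1⟩
  case delLeft => exact ⟨H.1, H.2, trivial⟩
  case delRightLN => exact ⟨H.1, H.2.1, true, rfl, H.2.2⟩
  case delRightRN e => exact ⟨H.1, H.2.1, false, H.2.2, e⟩
  case delRightTwo => exact ⟨H.1, H.2.1, by simp [H.2.2]⟩
  case bypCmpL e => exact ⟨H.1, H.2.1, H.2.2, (hside _ _ _ H.1 rfl).1 e⟩
  case bypCmpR e => exact ⟨H.1, H.2.1, H.2.2, (hside _ _ _ H.1 rfl).2 e⟩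
  case tagRead => exact ⟨H.1, H.2.1, H.2.2, trivial⟩
  case sucRight e => exact ⟨H, .of ⟨_, e, .refl⟩, .inl ⟨rfl, e⟩⟩
  case sucLeftN => exact H
  case sucLeftS e =>
    refine ⟨H.1, H.2.1.next ⟨false, rfl, e⟩ (onChain_next _), .inr ⟨?_, H.2.1⟩⟩
    rintro rfl
    rcases Hind.or H.2.1 with ⟨r, e1, h1⟩ | h
    · exact I.tree.right_ne H.1.1.tree_y e1 (Rch.toDesc h1) rfl
    · simp [H.1.2.1] at h
  case sucRemPsF e => exact ⟨H.1, H.2.1, H.2.2, e⟩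
  case sucRemCsF e => exact ⟨H.1, H.2.1, H.2.2.1, H.2.2.2, e⟩
  case sucParY => exact ⟨H, fun h => absurd rfl h⟩
  case sucParE e => exact ⟨H, fun _ => e⟩
  case sucNullN e =>
    obtain ⟨⟨⟨⟨h1, h2, h3⟩, h4⟩, h5, h6, h7, h8⟩, h9⟩ := H
    exact ⟨⟨h1, h3, h4, h5, h6, h8, e, fun h => ⟨h7, h9 h⟩⟩, h2⟩
  case dupKey => exact ⟨H, trivial⟩
  case dupData => exact ⟨H.1, H.2, trivial⟩
  case linkCmpL e => exact ⟨H, (hside _ _ _ H.1.1.1.held rfl).1 e⟩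
  case linkCmpR e => exact ⟨H, (hside _ _ _ H.1.1.1.held rfl).2 e⟩
  case csRightW => exact ⟨_, _, _, H.1, rfl, H.2, rfl⟩
  case csRightPs e => exact ⟨_, _, H.1, e, H.2, rfl⟩

/-- What a thread knows after it locked a node. -/
theorem Inv.own_lock (I : Inv c P)
    (hsh : c'.shared = { c.shared with lock := Function.update c.shared.lock o (some i) })
    (ht : ∀ q x v, TagStable c P q x v → TagStable c' P q x v)
    (S : LStep c.shared i (c.pc i) (.lock o) (c'.pc i)) : PCInv c' P i (c'.pc i) := by
  have H := I.pc i
  have hl : ∀ x, c.shared.lock x = some i → c'.shared.lock x = some i := by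
    intro x hx
    rw [hsh]
    by_cases h : x = o
    · simp [h]
    · simp [Function.update_of_ne h, hx]
  have ho : c'.shared.lock o = some i := by simp [hsh]
  have hh : c'.shared.heap = c.shared.heap := by rw [hsh]
  have hn : c'.shared.next = c.shared.next := by rw [hsh]
  have hw : ∀ {y ps cs}, Walk c.shared y ps cs → Walk c'.shared y ps cs := fun h => by
    simpa only [Walk, Walked, hh] using h
  generalize c.pc i = p at *
  generalize c'.pc i = p' at *
  cases S <;> simp only [PCInv] at H ⊢
  case insLock => exact ⟨⟨ht _ _ _ H.1, by simpa only [RightStable, hh, hn] using H.2⟩, ho⟩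
  case delLockX => exact ⟨by simpa only [OwnNode, Published, hh] using H, ho⟩
  case delLockY => exact ⟨by simpa only [OwnNode, Published, hh] using H.1, hl _ H.2, ho⟩
  case sucLockPs =>
    exact ⟨⟨⟨H.1.1.of_lock hh hl, by simpa only [hh] using H.1.2⟩, hw H.2⟩, ho⟩
  case sucLockCs =>
    exact ⟨⟨⟨H.1.1.1.of_lock hh hl, by simpa only [hh] using H.1.1.2⟩, hw H.1.2⟩, hl _ H.2, ho⟩
  case dupLock =>
    obtain ⟨h1, h2, h3, h4, h5, h6⟩ := H.2
    exact ⟨⟨⟨H.1.1.of_lock hh hl, by simpa only [hh] using H.1.2⟩,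
      ⟨by rwa [hn], by rwa [hh], by rwa [hh], by rwa [hh], by rwa [hh], by rwa [hh]⟩⟩, ho⟩

/-- The nodes that a thread locks are allocated. -/
theorem Inv.locks_lt (I : Inv c P) (S : LStep c.shared i (c.pc i) (.lock o) (c'.pc i)) :
    o < c.shared.next := by
  have H := I.pc i
  generalize c.pc i = p at *
  generalize c'.pc i = p' at *
  cases S <;> simp only [PCInv] at H
  case insLock => exact H.1.1
  case delLockX => exact I.published_lt H.1
  case delLockY => exact I.published_lt H.1.2.2
  case sucLockPs =>
    rcases H.2.2 with ⟨rfl, -⟩ | ⟨-, h⟩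
    · exact I.tree_lt _ H.1.1.tree_y
    · exact I.published_lt (h.published H.1.1.tree_y)
  case sucLockCs => exact I.published_lt (H.1.2.1.published H.1.1.1.tree_y)
  case dupLock => exact H.2.lt

theorem Inv.fresh_lt (I : Inv c P) (h : (c.pc i).fresh = some n) :
    n < c.shared.next ∧ (c.shared.heap n).rem = false := by
  have H := I.pc i
  generalize c.pc i = p at *
  cases p <;> simp only [PC.fresh, Option.some.injEq, reduceCtorEq] at h <;> subst h <;>
    simp only [PCInv] at H
  case insWriteLeft | insWriteRight => exact ⟨H.2.lt, by rw [H.2.eq]⟩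
  case dupMark | dupLock => exact ⟨H.2.lt, H.2.rem⟩
  case linkCmp => exact ⟨H.1.2.lt, H.1.2.rem⟩
  case linkLeft | linkRight => exact ⟨H.1.1.2.lt, H.1.1.2.rem⟩

/-- The parts of the invariant that concern threads one by one. -/
theorem Inv.of_grt (I : Inv c P) (S : IsStep i a c c') (T : TreeInv c'.shared.heap P')
    (G : Grt i c P c' P')
    (hback : ∀ o, InTree c'.shared.heap o → InTree c.shared.heap o ∨ (c.pc i).fresh = some o)
    (hlock : ∀ o j, c'.shared.lock o = some j → c.shared.lock o = some j ∨ o < c.shared.next)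
    (hun : ∀ o, c'.shared.next ≤ o → (c'.shared.heap o).rem = true →
      (c.shared.heap o).rem = true ∨ o < c.shared.next)
    (hghost : ∀ j o, c'.shared.reader j = true →
      c'.shared.ghost j o = (c'.shared.heap o).key ∨ GhostWaits c' P' j o)
    (hreader : c'.shared.reader i = (c'.pc i).inSection)
    (hown : PCInv c' P' i (c'.pc i))
    (hpend : ∀ w k cs, P' w = some (k, cs) →
      (P w = some (k, cs) ∧ ((c.pc i).copy = some w → (c'.pc i).copy = some w)) ∨
      (c'.pc i).copy = some w)
    (hfresh : ∀ n, (c'.pc i).fresh = some n → (c.pc i).fresh = some n ∨ c.shared.next ≤ n) :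
    Inv c' P' where
  root := by rw [G.key _ (I.tree_lt _ (inTree_root _)), I.root]
  tree := T
  tree_lt o h := lt_of_lt_of_le ((hback o h).elim (I.tree_lt o) fun h => (I.fresh_lt h).1) G.next_le
  lock_lt o j h := lt_of_lt_of_le ((hlock o j h).elim (I.lock_lt o j) id) G.next_le
  unalloc o h := by
    by_contra hcon
    simp only [Bool.not_eq_false] at hcon
    rcases hun o h hcon with h1 | h1
    · simp [I.unalloc o (G.next_le.trans h)] at h1
    · exact absurd (G.next_le.trans h) (not_le.2 h1)
  ghost j o h := hghost j o h
  reader j := by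
    by_cases hj : j = i
    · rw [hj, hreader]
    · rw [G.reader_eq j hj, I.reader j, S.other j hj]
  pc j := by
    by_cases hj : j = i
    · rw [hj]; exact hown
    · exact G.pcInv I hj (S.other j hj)
  pend w k cs h := by
    rcases hpend w k cs h with ⟨h1, h2⟩ | h1
    · obtain ⟨j, hj⟩ := I.pend w k cs h1
      by_cases hji : j = i
      · subst hji
        exact ⟨j, h2 hj⟩
      · exact ⟨j, by rw [S.other j hji, hj]⟩
    · exact ⟨i, h1⟩
  fresh j j' n h1 h2 := by
    have key : ∀ j, j ≠ i → (c'.pc i).fresh = some n → (c'.pc j).fresh = some n → False := by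
      intro j hj h1 h2
      rw [S.other j hj] at h2
      rcases hfresh n h1 with h1 | h1
      · exact hj (I.fresh j i n h2 h1)
      · exact absurd (I.fresh_lt h2).1 (not_lt.2 h1)
    by_cases hj : j = i <;> by_cases hj' : j' = i
    · rw [hj, hj']
    · subst hj; exact (key j' hj' h1 h2).elim
    · subst hj'; exact (key j hj h2 h1).elim
    · rw [S.other j hj] at h1
      rw [S.other j' hj'] at h2
      exact I.fresh j j' n h1 h2

/-- The ghost keys wait after a step that leaves the ghost keys and the unfinished deletions. -/
theorem Inv.ghost_keep (I : Inv c P) (S : IsStep i a c c')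
    (hr : c'.shared.reader = c.shared.reader)
    (hg : ∀ j o, c'.shared.ghost j o = c.shared.ghost j o)
    (hk : ∀ o, (c'.shared.heap o).key = (c.shared.heap o).key)
    (hw : c'.shared.waiting = c.shared.waiting)
    (hP : ∀ w k cs, P w = some (k, cs) → (c.pc i).copy ≠ some w → P' w = some (k, cs))
    (hns : ∀ k y ps cs w, c.pc i ≠ .syncCall k y ps cs w ∧ c.pc i ≠ .syncWait k y ps cs w) :
    ∀ j o, c'.shared.reader j = true →
      c'.shared.ghost j o = (c'.shared.heap o).key ∨ GhostWaits c' P' j o := by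
  intro j o hj
  rw [hr] at hj
  rw [hg, hk]
  refine (I.ghost j o hj).imp_right ?_
  rintro ⟨k, cs, h1, h2, j', k', y, ps, cs', h3⟩
  have hj' : j' ≠ i := by
    rintro rfl
    have := hns k' y ps cs' o
    rcases h3 with h3 | h3
    · exact this.1 h3
    · exact this.2 h3.1
  refine ⟨k, cs, hP _ _ _ h1 ?_, by rw [hg, h2], j', k', y, ps, cs',
    by rw [S.other j' hj', hw]; exact h3⟩
  intro hcopy
  obtain ⟨_, _, _, _, L⟩ := I.copy_linked hcopy
  have hc' : (c.pc j').copy = some o := by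
    rcases h3 with h3 | ⟨h3, -⟩ <;> simp [h3, PC.copy]
  obtain ⟨_, _, _, _, L'⟩ := I.copy_linked hc'
  exact hj' (Option.some_injective _ (L'.lock_w.symm.trans L.lock_w))

/-- After `synchronize_rcu` no traversal in progress has a ghost key that differs from the key. -/
theorem Inv.ghost_done (I : Inv c P) (hcopy : (c.pc i).copy = some w)
    (hns : ∀ k y ps cs, c.pc i ≠ .syncCall k y ps cs w ∧ c.pc i ≠ .syncWait k y ps cs w)
    (hj : c.shared.reader j = true) : c.shared.ghost j w = (c.shared.heap w).key := by
  rcases I.ghost j w hj with h | ⟨k, cs, h1, h2, j', k', y, ps, cs', h3⟩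
  · exact h
  · exfalso
    obtain ⟨_, _, _, _, L⟩ := I.copy_linked hcopy
    have hc' : (c.pc j').copy = some w := by
      rcases h3 with h3 | ⟨h3, -⟩ <;> simp [h3, PC.copy]
    obtain ⟨_, _, _, _, L'⟩ := I.copy_linked hc'
    obtain rfl := Option.some_injective _ (L'.lock_w.symm.trans L.lock_w)
    have := hns k' y ps cs'
    rcases h3 with h3 | h3
    · exact this.1 h3
    · exact this.2 h3.1
end

/-! ### Steps that write no child pointer -/

/-- The actions by which a thread changes at most its locks. -/
def Act.isLocal : Act → Prop
  | .invoke _ | .respond _ | .tau | .read _ | .lock _ | .unlock _ => True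
  | _ => False

section
variable {c c' : Config} {P P' : Pend} {i j : Tid} {k x y z w v ps cs d n p o : ℕ} {q : Key}
  {a : Act}

/-- Control points around a local action. -/
theorem LStep.local_pc {s : Shared} {p p' : PC} (S : LStep s i p a p') (ha : a.isLocal) (P : Pend) :
    p.pendStep P = P ∧ p.commit = none ∧ (∀ o, p.bump = some o → p'.bump = some o) ∧
    (∀ w, p.copy = some w → p'.copy = some w) ∧ (∀ n, p'.fresh = some n → p.fresh = some n) ∧
    p'.inSection = p.inSection ∧
    ∀ k y ps cs w, p ≠ .syncCall k y ps cs w ∧ p ≠ .syncWait k y ps cs w := by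
  cases S <;> simp only [Act.isLocal] at ha <;>
    simp [PC.pendStep, PC.commit, PC.bump, PC.copy, PC.fresh, PC.inSection]

/-- Of the steps that leave the heap unchanged, those that are not concerned with RCU. -/
theorem Inv.step_local (I : Inv c P) (S : IsStep i a c c') (ha : a.isLocal) :
    Inv c' ((c.pc i).pendStep P) ∧ Grt i c P c' ((c.pc i).pendStep P) ∧
    RepStep (Rep c.shared.heap P) (Rep c'.shared.heap ((c.pc i).pendStep P))
      (c.pc i).commit := by
  obtain ⟨h1, h2, h3, h4, h5, h6, h7⟩ := S.local_.local_pc ha P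
  rw [h1, h2]
  have hh : c'.shared.heap = c.shared.heap := by
    rw [S.shared]; cases a <;> first | rfl | simp [Act.isLocal] at ha
  have hn : c'.shared.next = c.shared.next := by
    rw [S.shared]; cases a <;> first | rfl | simp [Act.isLocal] at ha
  have hg : c'.shared.ghost = c.shared.ghost := by
    rw [S.shared]; cases a <;> first | rfl | simp [Act.isLocal] at ha
  have hr : c'.shared.reader = c.shared.reader := by
    rw [S.shared]; cases a <;> first | rfl | simp [Act.isLocal] at ha
  have hw : c'.shared.waiting = c.shared.waiting := by
    rw [S.shared]; cases a <;> first | rfl | simp [Act.isLocal] at ha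
  have hloc := S.local_
  have hl : ∀ j o, j ≠ i → c.shared.lock o = some j → c'.shared.lock o = some j := by
    intro j o hj ho
    rw [S.shared]
    cases a <;> simp only [Act.isLocal, applyAct] at ha ⊢ <;> try exact ho
    case lock x =>
      rw [Function.update_of_ne, ho]
      rintro rfl
      have : c.shared.lock o = none ∨ c.shared.lock o = some i := by
        generalize c.pc i = p at hloc
        generalize c'.pc i = p' at hloc
        cases hloc <;> assumption
      rw [ho] at this
      simp [hj] at this
    case unlock x =>
      rw [Function.update_of_ne, ho]
      rintro rfl
      have : c.shared.lock o = some i := by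
        generalize c.pc i = p at hloc
        generalize c'.pc i = p' at hloc
        cases hloc <;> assumption
      rw [ho] at this
      simp [hj] at this
  have hl' : ∀ o j, c'.shared.lock o = some j → c.shared.lock o = some j ∨ o < c.shared.next := by
    intro o j ho
    rw [S.shared] at ho
    cases a <;> simp only [Act.isLocal, applyAct] at ha ho <;> try exact .inl ho
    case lock x =>
      by_cases h : o = x
      · subst h; exact .inr (I.locks_lt hloc)
      · rw [Function.update_of_ne h] at ho
        exact .inl ho
    case unlock x =>
      by_cases h : o = x
      · subst h; simp at ho
      · rw [Function.update_of_ne h] at ho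
        exact .inl ho
  have G : Grt i c P c' P := .neutral hh hn hl (fun _ _ => by rw [hr]) (fun _ _ _ => by rw [hg])
    S.other h3
  have hown : PCInv c' P i (c'.pc i) := by
    have hsh := S.shared
    have ht := fun q x v => G.tagStable (q := q) (x := x) (v := v)
    cases a <;> simp only [Act.isLocal, applyAct] at ha hsh
    case tau => exact I.own_read hsh ht hloc (.inl rfl)
    case read l => exact I.own_read hsh ht hloc (.inr ⟨l, rfl⟩)
    case lock o => exact I.own_lock hsh ht hloc
    case unlock o =>
      have H := I.pc i
      generalize c.pc i = p at hloc H
      generalize c'.pc i = p' at hloc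
      cases hloc
      · exact H
      · trivial
    all_goals
      generalize c.pc i = p at hloc
      generalize c'.pc i = p' at hloc
      cases hloc
      trivial
  refine ⟨I.of_grt S (by rw [hh]; exact I.tree) G (fun o h => .inl (by rwa [hh] at h)) hl'
    (fun o _ h => .inl (by rwa [hh] at h))
    (I.ghost_keep S hr (fun _ _ => by rw [hg]) (fun _ => by rw [hh]) hw
      (fun _ _ _ h _ => h) h7) (by rw [hr, h6, I.reader]) hown
    (fun w k cs h => .inl ⟨h, h4 w⟩) (fun n h => .inl (h5 n h)), G, ?_⟩
  intro k d
  rw [hh]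

/-- Steps that enter or leave a read section or belong to `synchronize_rcu`. On entering, the ghost
keys of the thread are reset to the keys, so that unfinished deletions need not wait for it. -/
theorem Inv.step_rcu (I : Inv c P) (S : IsStep i a c c')
    (ha : a = .rcuLock ∨ a = .rcuUnlock ∨ a = .syncCall ∨ a = .syncReturn) :
    Inv c' ((c.pc i).pendStep P) ∧ Grt i c P c' ((c.pc i).pendStep P) ∧
    RepStep (Rep c.shared.heap P) (Rep c'.shared.heap ((c.pc i).pendStep P))
      (c.pc i).commit := by
  have hloc := S.local_
  have hsh := S.shared
  have hown := I.pc i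
  have hread := I.reader i
  have hg0 := I.ghost
  have I' := I
  generalize hp : c.pc i = p at hloc hown hread
  generalize hp' : c'.pc i = p' at hloc
  have hgw : ∀ {j o}, (∀ k y ps cs w, p ≠ .syncCall k y ps cs w ∧ p ≠ .syncWait k y ps cs w) →
      c.shared.heap = c'.shared.heap → c.shared.ghost j o = c'.shared.ghost j o →
      (∀ j', j ∈ c.shared.waiting j' → j ∈ c'.shared.waiting j') → c.shared.reader j = true →
      c'.shared.ghost j o = (c'.shared.heap o).key ∨ GhostWaits c' P j o := by
    intro j o h1 h2 h3 h4 hj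
    rw [← h2, ← h3]
    refine (I.ghost j o hj).imp_right ?_
    rintro ⟨k, cs, e1, e2, j', k', y, ps, cs', e3⟩
    have hj' : j' ≠ i := by
      rintro rfl
      rw [hp] at e3
      rcases e3 with e3 | e3
      · exact (h1 k' y ps cs' o).1 e3
      · exact (h1 k' y ps cs' o).2 e3.1
    exact ⟨k, cs, e1, by rw [← h3, e2], j', k', y, ps, cs', by
      rw [S.other j' hj']; exact e3.imp_right fun e => ⟨e.1, h4 _ e.2⟩⟩
  cases hloc <;> simp only [reduceCtorEq, or_self] at ha <;>
    simp only [PC.pendStep, PC.commit, RepStep, PCInv, PC.inSection, applyAct] at hown hread hsh ⊢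
  case locStart op =>
    have G : Grt i c P c' P := by
      refine .neutral (by rw [hsh]) (by rw [hsh]) (fun j o _ h => by rw [hsh]; exact h)
        (fun j hj => by rw [hsh]; simp [Function.update_of_ne hj]) (fun j h1 h2 => ?_) S.other
        (by simp [hp, PC.bump])
      rw [hsh]
      have : j ≠ i := by rintro rfl; simp [hread] at h1
      simp [Function.update_of_ne this]
    have vis : ∀ s, Visited s i op.key rootId := fun s => .of .refl
    refine ⟨I.of_grt S (by rw [hsh]; exact I.tree) G (fun o h => .inl (by rwa [hsh] at h))
      (fun o j h => .inl (by rwa [hsh] at h)) (fun o _ h => .inl (by rwa [hsh] at h)) ?_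
      (by simp [hsh, hp', PC.inSection]) ?_ (fun w k cs h => .inl ⟨h, by simp [hp, PC.copy]⟩)
      (by simp [hp', PC.fresh]), G, fun k d => by rw [hsh]⟩
    · intro j o hj
      by_cases hji : j = i
      · subst hji
        left
        simp [hsh]
      · refine hgw (by simp) (by rw [hsh]) (by simp [hsh, Function.update_of_ne hji])
          (fun _ h => by rwa [hsh]) ?_
        rw [hsh] at hj
        simpa [Function.update_of_ne hji] using hj
    · rw [hp']
      refine ⟨vis _, ?_, ?_⟩
      · rw [hsh, I.root]
        exact fun h => by have := WithTop.coe_injective h; omega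
      · rintro _ ⟨rfl⟩
        exact vis _
  case locUnlock op x tag y =>
    have G : Grt i c P c' P := by
      refine .neutral (by rw [hsh]) (by rw [hsh]) (fun j o _ h => by rw [hsh]; exact h)
        (fun j hj => by rw [hsh]; simp [Function.update_of_ne hj]) (fun j h1 h2 => by rw [hsh]) S.other
        (by simp [hp, PC.bump])
    refine ⟨I.of_grt S (by rw [hsh]; exact I.tree) G (fun o h => .inl (by rwa [hsh] at h))
      (fun o j h => .inl (by rwa [hsh] at h)) (fun o _ h => .inl (by rwa [hsh] at h)) ?_
      (by simp [hsh, hp', PC.inSection]) ?_ (fun w k cs h => .inl ⟨h, by simp [hp, PC.copy]⟩)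
      (by simp [hp', PC.fresh]), G, fun k d => by rw [hsh]⟩
    · intro j o hj
      have hji : j ≠ i := by rintro rfl; simp [hsh] at hj
      refine hgw (by simp) (by rw [hsh]) (by rw [hsh]) (fun _ h => ?_) ?_
      · simp [hsh, h, hji]
      · rw [hsh] at hj
        simpa [Function.update_of_ne hji] using hj
    · rw [hp']
      refine ⟨⟨G.tagStable hown.1.1, G.rightStable hown.1.2⟩, ?_, ?_⟩
      · rw [hsh]; exact hown.2.1
      · rw [hsh]; exact hown.2.2
  case syncCall k y ps cs w =>
    have G : Grt i c P c' P := by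
      refine .neutral (by rw [hsh]) (by rw [hsh]) (fun j o _ h => by rw [hsh]; exact h)
        (fun j hj => by rw [hsh]) (fun j h1 h2 => by rw [hsh]) S.other
        (by simp [hp, PC.bump])
    refine ⟨I.of_grt S (by rw [hsh]; exact I.tree) G (fun o h => .inl (by rwa [hsh] at h))
      (fun o j h => .inl (by rwa [hsh] at h)) (fun o _ h => .inl (by rwa [hsh] at h)) ?_
      (by simp [hsh, hp', hread, PC.inSection]) ?_
      (fun w k cs h => .inl ⟨h, by simp [hp, hp', PC.copy]⟩)
      (by simp [hp', PC.fresh]), G, fun k d => by rw [hsh]⟩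
    · intro j o hj
      have hj' : c.shared.reader j = true := by rwa [hsh] at hj
      have hg : c'.shared.ghost = c.shared.ghost := by rw [hsh]
      have hh : c'.shared.heap = c.shared.heap := by rw [hsh]
      rw [hg, hh]
      refine (I.ghost j o hj').imp_right ?_
      rintro ⟨k, cs, e1, e2, j', k', y, ps, cs', e3⟩
      refine ⟨k, cs, e1, by rw [hg, e2], ?_⟩
      by_cases hji : j' = i
      · subst hji
        rw [hp] at e3
        simp only [PC.syncCall.injEq, reduceCtorEq, false_and, or_false] at e3
        obtain ⟨-, -, -, -, rfl⟩ := e3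
        exact ⟨j', _, _, _, _, .inr ⟨hp', by simp [hsh, hj']⟩⟩
      · exact ⟨j', k', y, ps, cs', by
          rw [S.other j' hji, hsh]; simp only [Function.update_of_ne hji]; exact e3⟩
    · rw [hp']
      refine ⟨?_, by rw [hsh]; exact hown.2⟩
      obtain ⟨h1, h2, h3, h4, h5⟩ := hown.1
      constructor <;> simpa only [hsh]
  case syncWait k y ps cs w hwait =>
    have G : Grt i c P c' P := by
      refine .neutral (by rw [hsh]) (by rw [hsh]) (fun j o _ h => by rw [hsh]; exact h)
        (fun j hj => by rw [hsh]) (fun j h1 h2 => by rw [hsh]) S.other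
        (by simp [hp, PC.bump])
    refine ⟨I.of_grt S (by rw [hsh]; exact I.tree) G (fun o h => .inl (by rwa [hsh] at h))
      (fun o j h => .inl (by rwa [hsh] at h)) (fun o _ h => .inl (by rwa [hsh] at h)) ?_
      (by simp [hsh, hp', hread, PC.inSection]) ?_
      (fun w k cs h => .inl ⟨h, by simp [hp, hp', PC.copy]⟩)
      (by simp [hp', PC.fresh]), G, fun k d => by rw [hsh]⟩
    · intro j o hj
      have hj' : c.shared.reader j = true := by rwa [hsh] at hj
      have hg : c'.shared.ghost = c.shared.ghost := by rw [hsh]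
      have hh : c'.shared.heap = c.shared.heap := by rw [hsh]
      rw [hg, hh]
      refine (I.ghost j o hj').imp_right ?_
      rintro ⟨k, cs, e1, e2, j', k', y, ps, cs', e3⟩
      refine ⟨k, cs, e1, by rw [hg, e2], ?_⟩
      by_cases hji : j' = i
      · subst hji
        rw [hp] at e3
        simp [hwait] at e3
      · exact ⟨j', k', y, ps, cs', by
          rw [S.other j' hji, hsh]; exact e3⟩
    · rw [hp']
      simp only [PCInv, hsh]
      exact hown

/-- Allocation of a leaf or of a copy, which is not in the tree yet. -/
theorem Inv.step_alloc (I : Inv c P) {nd : Node} (S : IsStep i (.alloc o nd) c c') :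
    Inv c' ((c.pc i).pendStep P) ∧ Grt i c P c' ((c.pc i).pendStep P) ∧
    RepStep (Rep c.shared.heap P) (Rep c'.shared.heap ((c.pc i).pendStep P))
      (c.pc i).commit := by
  have hloc := S.local_
  have hsh := S.shared
  have hown := I.pc i
  have hread := I.reader i
  have pcs : o = c.shared.next ∧ (c.pc i).pendStep P = P ∧ (c.pc i).commit = none ∧
      (c.pc i).bump = none ∧ (c.pc i).copy = none ∧ (c'.pc i).fresh = some o ∧
      (c'.pc i).inSection = false ∧ (c.pc i).inSection = false ∧
      ∀ k y ps cs w, c.pc i ≠ .syncCall k y ps cs w ∧ c.pc i ≠ .syncWait k y ps cs w := by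
    generalize c.pc i = p at hloc
    generalize c'.pc i = p' at hloc
    cases hloc <;> simp [PC.pendStep, PC.commit, PC.bump, PC.copy, PC.fresh, PC.inSection]
  obtain ⟨rfl, h1, h2, h3, h4, h5, h6, h7, h8⟩ := pcs
  rw [h1, h2]
  simp only [applyAct] at hsh
  obtain ⟨T, it, G, R⟩ := I.alloc (c' := c') (i := i) (nd := nd) (by rw [hsh]) (by rw [hsh])
    (by rw [hsh]) (by rw [hsh]) S.other h3 (by rw [hsh])
  have hnew : c'.shared.heap c.shared.next = nd := by simp [hsh]
  have hnext : c'.shared.next = c.shared.next + 1 := by rw [hsh]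
  have hlt : ∀ o < c.shared.next, c'.shared.heap o = c.shared.heap o := fun o ho => by
    simp [hsh, Function.update_of_ne ho.ne]
  have hlock : c'.shared.lock = c.shared.lock := by rw [hsh]
  have hfresh : ¬ InTree c'.shared.heap c.shared.next := by
    rw [it]
    exact fun h => lt_irrefl _ (I.tree_lt _ h)
  refine ⟨I.of_grt S T G (fun o h => .inl ((it o).1 h)) (fun o j h => .inl (by rwa [hlock] at h))
    (fun o ho h => ?_) (fun j o hj => ?_) ?_ ?_ (fun w k cs h => .inl ⟨h, by simp [h4]⟩)
    (fun n h => .inr ?_), G, R⟩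
  · left
    have : o ≠ c.shared.next := by omega
    simpa [hsh, Function.update_of_ne this] using h
  · by_cases ho : o = c.shared.next
    · subst ho
      left
      simp [hsh]
    · have hr : c.shared.reader j = true := by rwa [hsh] at hj
      have hg : c'.shared.ghost j o = c.shared.ghost j o := by simp [hsh, Function.update_of_ne ho]
      have hk : c'.shared.heap o = c.shared.heap o := by simp [hsh, Function.update_of_ne ho]
      rw [hg, hk]
      refine (I.ghost j o hr).imp_right ?_
      rintro ⟨k, cs, e1, e2, j', k', y, ps, cs', e3⟩
      have hj' : j' ≠ i := by
        rintro rfl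
        rcases e3 with e3 | e3
        · exact (h8 k' y ps cs' o).1 e3
        · exact (h8 k' y ps cs' o).2 e3.1
      exact ⟨k, cs, e1, by rw [hg, e2], j', k', y, ps, cs', by
        rw [S.other j' hj', hsh]; exact e3⟩
  · rw [hsh, h6]
    simpa [h7] using hread
  · have hfr : ∀ {x j}, c.shared.lock x = some j → c'.shared.heap x = c.shared.heap x :=
      fun h => hlt _ (I.lock_lt _ _ h)
    generalize c.pc i = p at hloc hown
    generalize c'.pc i = p' at hloc
    have stdN : ∀ {k x}, StdN c.shared.heap k x → StdN c'.shared.heap k x := by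
      intro k x h
      refine Rch.congr (fun o d ho => ?_) (fun o d ho hd => ?_) h
      · simp only [Heap.child, hlt o (I.tree_lt o ho)]
      · simpa only [SDir, hlt o (I.tree_lt o ho)] using hd
    cases hloc <;> simp only [PCInv] at hown ⊢
    case insNewLeft =>
      obtain ⟨e1, e2, e3⟩ := hown
      exact ⟨⟨stdN e1, by rw [hlock, e2], by rw [hfr e2]; exact e3⟩, by omega, hfresh, hnew⟩
    case insNewRight =>
      obtain ⟨⟨e1, e2, e3⟩, e4⟩ := hown
      exact ⟨⟨⟨stdN e1, by rw [hlock, e2], by rw [hfr e2]; exact e3⟩, by rw [hfr e2, e4]⟩,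
        by omega, hfresh, hnew⟩
    case dupNew k x y ps cs m d =>
      obtain ⟨⟨D, e1⟩, rfl, rfl⟩ := hown
      have hx := hfr D.held.lock_x
      have hy := hfr D.held.lock_y
      have hps := hfr D.lock_ps
      have hcs := hfr D.lock_cs
      refine ⟨⟨⟨⟨by rw [hlock, D.held.lock_x], by rw [hlock, D.held.lock_y],
        by rw [hx, D.held.rem_x], (it _).2 D.held.tree_x, by rw [hy, D.held.key_y], ?_⟩,
        by rw [hy]; exact D.left_y, G.walk D.held.tree_y (by simp only [Heap.child, hy]) D.walk,
        by rw [hlock, D.lock_ps], by rw [hlock, D.lock_cs], by rw [hcs, D.rem_cs],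
        by rw [hcs, D.left_cs], by rw [hps]; exact D.ps_ne⟩, by rw [hy, e1]⟩,
        by omega, hfresh, by rw [hnew]; exact e1, by rw [hnew, hcs], by rw [hnew, hcs],
        fun e => by cases e <;> simp [Heap.child, hnew, hy]⟩
      simpa only [Heap.child, hx] using D.held.child
  · rw [h5] at h
    exact (Option.some_injective _ h).le

/-- The control points around a write that changes no pointer. -/
theorem Inv.step_mark (I : Inv c P) {f : Field} {v : Val} {g : GhostCmd}
    (S : IsStep i (.write ⟨some p, f⟩ v g) c c') (hf : f = .rem ∨ f = .tag) :
    Inv c' ((c.pc i).pendStep P) ∧ Grt i c P c' ((c.pc i).pendStep P) ∧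
    RepStep (Rep c.shared.heap P) (Rep c'.shared.heap ((c.pc i).pendStep P))
      (c.pc i).commit := by
  have hloc := S.local_
  have hsh := S.shared
  have hown := I.pc i
  have pcs : (c.pc i).pendStep P = P ∧ (c.pc i).commit = none ∧ g = .skip ∧
      (∀ w, (c.pc i).copy = some w → (c'.pc i).copy = some w) ∧
      (c'.pc i).fresh = (c.pc i).fresh ∧
      (c'.pc i).inSection = (c.pc i).inSection ∧
      (∀ k y ps cs w, c.pc i ≠ .syncCall k y ps cs w ∧ c.pc i ≠ .syncWait k y ps cs w) ∧
      c.shared.lock p = some i ∧ (c.shared.heap p).rem = false ∧ InTree c.shared.heap p ∧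
      ((f = .rem ∧ v = .rem true ∧ (c.pc i).bump = none) ∨
        (f = .tag ∧ v = .tag ((c.shared.heap p).tag + 1) ∧
          ∀ o, (c.pc i).bump = some o → o = p)) := by
    generalize c.pc i = pc at hloc hown
    generalize c'.pc i = pc' at hloc
    cases hloc <;> simp only [reduceCtorEq, or_self] at hf <;> simp only [PCInv] at hown <;>
      simp only [PC.pendStep, PC.commit, PC.bump, PC.copy, PC.fresh, PC.inSection]
    case bypMark => simp [hown.1.lock_y, hown.2.1, hown.1.tree_y]
    case tagWrite =>
      simp [hown.1, hown.2.1, hown.2.2]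
    case dupMark => simp [hown.1.1.held.lock_y, hown.1.2, hown.1.1.held.tree_y]
    case csMark => simp [hown.1.lock_cs, hown.2, (I.tree.pend hown.1.pend).cs_inTree]
  obtain ⟨h1, h2, rfl, h4, h5, h6, h7, h8, h9, h10, h11⟩ := pcs
  rw [h1, h2]
  simp only [applyAct, GhostCmd.run, Heap.write] at hsh
  have hne : ∀ o, o ≠ p → c'.shared.heap o = c.shared.heap o := fun o ho => by
    simp [hsh, Function.update_of_ne ho]
  have hp : c'.shared.heap p = (c.shared.heap p).set f v := by simp [hsh]
  have hfields : (c'.shared.heap p).key = (c.shared.heap p).key ∧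
      (c'.shared.heap p).data = (c.shared.heap p).data ∧
      (c'.shared.heap p).left = (c.shared.heap p).left ∧
      (c'.shared.heap p).right = (c.shared.heap p).right := by
    rw [hp]
    rcases h11 with ⟨rfl, rfl, -⟩ | ⟨rfl, rfl, -⟩ <;> exact ⟨rfl, rfl, rfl, rfl⟩
  have hlock : c'.shared.lock = c.shared.lock := by rw [hsh]
  obtain ⟨T, back, G, R⟩ := I.mark (i := i) (p := p) (c' := c') (by rw [hsh]) hlock (by rw [hsh])
    (by rw [hsh]) S.other h8 h9 h10 hne hfields.1 hfields.2.1 hfields.2.2.1 hfields.2.2.2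
    (by rw [hp]; rcases h11 with ⟨rfl, rfl, -⟩ | ⟨rfl, rfl, -⟩ <;> simp [Node.set])
    (by
      rcases h11 with ⟨rfl, rfl, h⟩ | ⟨rfl, rfl, h⟩
      · simp [h]
      · intro o ho
        right
        rw [h o ho, hp]
        simp [Node.set])
  have hkey : ∀ o, (c'.shared.heap o).key = (c.shared.heap o).key := fun o => by
    by_cases h : o = p
    · rw [h, hfields.1]
    · rw [hne o h]
  refine ⟨I.of_grt S T G (fun o h => .inl (back o h)) (fun o j h => .inl (by rwa [hlock] at h))
    (fun o ho h => ?_) (I.ghost_keep S (by rw [hsh]) (fun _ _ => by rw [hsh]) hkey (by rw [hsh])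
      (fun _ _ _ h _ => h) h7) (by rw [hsh, h6]; exact I.reader i) ?_
    (fun w k cs h => .inl ⟨h, h4 w⟩) (fun n h => .inl (by rwa [h5] at h)), G, R⟩
  · by_cases hop : o = p
    · subst hop
      exact .inr (I.tree_lt _ h10)
    · left
      rwa [hne o hop] at h
  · have hrp : f = .rem → (c'.shared.heap p).rem = true := by
      rintro rfl
      rcases h11 with ⟨-, rfl, -⟩ | ⟨h, -⟩
      · rw [hp]; rfl
      · simp at h
    have hch : ∀ o e, c'.shared.heap.child o e = c.shared.heap.child o e := fun o e => by
      by_cases h : o = p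
      · simp only [Heap.child, h, hfields.2.2]
      · simp only [Heap.child, hne o h]
    have held : ∀ {k x}, Held c.shared i k x p → Held c'.shared i k x p := by
      intro k x H
      obtain ⟨d, e⟩ := H.child
      have hx := hne x (I.tree.child_ne H.tree_x e).symm
      refine ⟨by rw [hlock, H.lock_x], by rw [hlock, H.lock_y], by rw [hx, H.rem_x],
        G.inTree H.tree_x H.rem_x, by rw [hkey, H.key_y], d, by rw [hch, e]⟩
    generalize c.pc i = pc at hloc hown
    generalize c'.pc i = pc' at hloc
    cases hloc <;> simp only [reduceCtorEq, or_self] at hf <;> simp only [PCInv] at hown ⊢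
    case bypMark =>
      exact ⟨held hown.1, hrp rfl, by simpa only [OtherChild, hch] using hown.2.2⟩
    case dupMark k x ps cs w =>
      obtain ⟨⟨D, e1⟩, C⟩ := hown
      have hyt := D.held.tree_y
      have hcs : cs ≠ p := by
        rcases Hind.or D.walk.1 with ⟨r, e2, h2⟩ | h
        · exact I.tree.right_ne hyt e2 (Rch.toDesc h2)
        · simp [D.rem_cs] at h
      have hw : w ≠ p := by rintro rfl; exact C.tree hyt
      refine ⟨⟨⟨held D.held, by rw [hfields.2.2.1]; exact D.left_y, G.walk hyt (hch _ _) D.walk,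
        by rw [hlock, D.lock_ps], by rw [hlock, D.lock_cs], by rw [hne _ hcs, D.rem_cs],
        by rw [hne _ hcs, D.left_cs], fun h => by rw [hne _ h]; exact D.ps_ne h⟩, hrp rfl⟩, ?_⟩
      exact ⟨by rw [hsh]; exact C.lt, fun h => C.tree (back _ h), by rw [hne _ hw, C.rem],
        by rw [hne _ hw, hne _ hcs, C.key], by rw [hne _ hw, hne _ hcs, C.data],
        fun e => by rw [hch, hch, C.child]⟩
    case csMark k y ps w =>
      obtain ⟨L, e1⟩ := hown
      have hw : w ≠ p := by
        rintro rfl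
        have h1 := L.pend
        simp [(I.tree.pend L.pend).cs_none] at h1
      refine ⟨⟨by rw [hlock, L.lock_w], by rw [hlock, L.lock_cs], by rw [hne _ hw, L.rem_w],
        L.pend, ?_⟩, hrp rfl⟩
      rw [hne _ hw, hlock]
      refine L.ps.imp_right fun ⟨e2, e3, e4, e5, e6⟩ => ?_
      have hps : ps ≠ p := fun h => I.tree.child_ne e5 (d := false) e6 h.symm
      exact ⟨e2, e3, by rw [hne _ hps, e4], G.inTree e5 e4, by rw [hne _ hps, e6]⟩
end

/-! ### Writes to child pointers -/

section
variable {c c' : Config} {P P' : Pend} {i j : Tid} {k x y z w v ps cs d n p o : ℕ} {q : Key}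
  {a : Act}

/-- A write to a child field of an unmarked node that the thread has locked. -/
theorem ChildWrite.of {e : Bool} {b : Ptr} {g : GhostCmd} {f : Field}
    (hf : f = bif e then .right else .left)
    (S : IsStep i (.write ⟨some p, f⟩ (.ref b) g) c c')
    (hl : c.shared.lock p = some i) (hr : (c.shared.heap p).rem = false)
    (hb : (c.pc i).bump = none) :
    ChildWrite c c' i p e b ∧ (∀ o, (c'.shared.heap o).rem = (c.shared.heap o).rem) ∧
      c'.shared.ghost = g.run c.shared ∧ c'.shared.waiting = c.shared.waiting := by
  subst hf
  have hsh := S.shared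
  simp only [applyAct, Heap.write] at hsh
  have hne : ∀ o, o ≠ p → c'.shared.heap o = c.shared.heap o := fun o ho => by
    simp [hsh, Function.update_of_ne ho]
  have hp : c'.shared.heap p = (c.shared.heap p).set (bif e then .right else .left) (.ref b) := by
    simp [hsh]
  refine ⟨⟨by rw [hsh], by rw [hsh], by rw [hsh], S.other, hl, hr, hne, ?_, ?_, ?_, ?_, ?_, hb⟩,
    fun o => ?_, by rw [hsh], by rw [hsh]⟩
  iterate 3 rw [hp]; cases e <;> rfl
  · simp only [Heap.child, hp]; cases e <;> rfl
  · simp only [Heap.child, hp]; cases e <;> rfl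
  · by_cases h : o = p
    · rw [h, hp]; cases e <;> rfl
    · rw [hne o h]

/-- The control points around a write to a child field. -/
theorem Inv.of_child {e : Bool} {b : Ptr} (I : Inv c P) (S : IsStep i a c c')
    (W : ChildWrite c c' i p e b)
    (hrem : ∀ o, (c'.shared.heap o).rem = (c.shared.heap o).rem)
    (T : TreeInv c'.shared.heap P') (G : Grt i c P c' P')
    (hback : ∀ o, InTree c'.shared.heap o → InTree c.shared.heap o ∨ (c.pc i).fresh = some o)
    (hghost : ∀ j o, c'.shared.reader j = true →
      c'.shared.ghost j o = (c'.shared.heap o).key ∨ GhostWaits c' P' j o)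
    (hs : (c.pc i).inSection = (c'.pc i).inSection)
    (hown : PCInv c' P' i (c'.pc i))
    (hpend : ∀ w k cs, P' w = some (k, cs) →
      (P w = some (k, cs) ∧ ((c.pc i).copy = some w → (c'.pc i).copy = some w)) ∨
      (c'.pc i).copy = some w)
    (hf : (c'.pc i).fresh = none) : Inv c' P' :=
  I.of_grt S T G hback (fun o j h => .inl (by rwa [W.lock] at h))
    (fun o _ h => .inl (by rwa [hrem] at h)) hghost (by rw [W.reader, I.reader, hs]) hown hpend
    (fun n h => by simp [hf] at h)

theorem Inv.step_insert (I : Inv c P) {e : Bool} {f : Field}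
    (hf : f = bif e then .right else .left)
    (S : IsStep i (.write ⟨some p, f⟩ (.ref (some n)) .skip) c c')
    (hpc : c.pc i = bif e then .insWriteRight k d p n else .insWriteLeft k d p n)
    (hpc' : c'.pc i = .finish (.bool true)) :
    Inv c' ((c.pc i).pendStep P) ∧ Grt i c P c' ((c.pc i).pendStep P) ∧
    RepStep (Rep c.shared.heap P) (Rep c'.shared.heap ((c.pc i).pendStep P))
      (c.pc i).commit := by
  have hown := I.pc i
  have pcs : (c.pc i).pendStep P = P ∧ (c.pc i).commit = some (.insert k d) ∧
      (c.pc i).bump = none ∧ (c.pc i).copy = none ∧ (c.pc i).fresh = some n ∧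
      (c.pc i).inSection = false ∧
      (∀ k y ps cs w, c.pc i ≠ .syncCall k y ps cs w ∧ c.pc i ≠ .syncWait k y ps cs w) ∧
      StdN c.shared.heap (userKey k) p ∧ c.shared.lock p = some i ∧
      (c.shared.heap p).rem = false ∧ SDir c.shared.heap (userKey k) p e ∧
      c.shared.heap.child p e = none ∧ Leaf c.shared k d n := by
    rw [hpc] at hown ⊢
    cases e <;> simp only [cond_true, cond_false, PCInv] at hown ⊢ <;>
      simp only [PC.pendStep, PC.commit, PC.bump, PC.copy, PC.fresh, PC.inSection]
    · obtain ⟨⟨h1, h2, h3, h4, h5⟩, h6⟩ := hown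
      exact ⟨trivial, trivial, trivial, trivial, trivial, trivial, by simp, h1, h2, h3, h4, h5, h6⟩
    · obtain ⟨⟨⟨h1, h2, h3, h4⟩, h5⟩, h6⟩ := hown
      exact ⟨trivial, trivial, trivial, trivial, trivial, trivial, by simp, h1, h2, h3, h4, h5, h6⟩
  obtain ⟨h1, h2, h3, h4, h5, h6, h7, h8, h9, h10, h11, h12, h13⟩ := pcs
  rw [h1, h2]
  obtain ⟨W, hrem, hg, hw⟩ := ChildWrite.of hf S h9 h10 h3
  obtain ⟨T, back, G, R⟩ := W.insert I rfl h12 hg h8 h11 h13 h4 h5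
  refine ⟨I.of_child S W hrem T G (fun o h => (back o h).imp_right fun h => by rw [h5, h])
    (I.ghost_keep S W.reader (fun _ _ => by rw [hg]; rfl) W.setChild.key hw (fun _ _ _ h _ => h) h7)
    (by rw [h6, hpc']; rfl) (by rw [hpc']; rfl) (fun w k cs h => .inl ⟨h, by simp [h4]⟩)
    (by rw [hpc']; rfl), G, R⟩

theorem Inv.step_bypass (I : Inv c P) {e : Bool} {f : Field} {b : Ptr}
    (hf : f = bif e then .right else .left)
    (S : IsStep i (.write ⟨some p, f⟩ (.ref b) .skip) c c')
    (hpc : c.pc i = bif e then .bypRight k p y b else .bypLeft k p y b)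
    (hpc' : c'.pc i = if e = false ∧ b = none then .tagRead k p else .finish (.bool true)) :
    Inv c' ((c.pc i).pendStep P) ∧ Grt i c P c' ((c.pc i).pendStep P) ∧
    RepStep (Rep c.shared.heap P) (Rep c'.shared.heap ((c.pc i).pendStep P))
      (c.pc i).commit := by
  have hown := I.pc i
  have pcs : (c.pc i).pendStep P = P ∧ (c.pc i).commit = some (.delete k) ∧
      (c.pc i).bump = none ∧ (c.pc i).copy = none ∧
      (c.pc i).inSection = false ∧
      (∀ k y ps cs w, c.pc i ≠ .syncCall k y ps cs w ∧ c.pc i ≠ .syncWait k y ps cs w) ∧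
      Held c.shared i k p y ∧ (c.shared.heap y).rem = true ∧
      OtherChild c.shared y b ∧ c.shared.heap.child p e = some y := by
    rw [hpc] at hown ⊢
    cases e <;> simp only [cond_true, cond_false, PCInv] at hown ⊢ <;>
      simp only [PC.pendStep, PC.commit, PC.bump, PC.copy, PC.inSection] <;>
      exact ⟨trivial, trivial, trivial, trivial, trivial, by simp, hown⟩
  obtain ⟨h1, h2, h3, h4, h6, h7, H, h9, ⟨f', h10, h11⟩, h12⟩ := pcs
  rw [h1, h2]
  obtain ⟨W, hrem, hg, hw⟩ := ChildWrite.of hf S H.lock_x H.rem_x h3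
  obtain ⟨T, back, G, R⟩ := W.bypass I H.tree_x h12 h10 h11 h9 H.lock_y hg
    (fun h h' => by rw [hpc', if_pos ⟨h, h'⟩, PC.bump]) H.key_y h4
  refine ⟨I.of_child S W hrem T G (fun o h => .inl (back o h))
    (I.ghost_keep S W.reader (fun _ _ => by rw [hg]; rfl) W.setChild.key hw (fun _ _ _ h _ => h) h7)
    (by rw [h6, hpc']; split <;> rfl) ?_ (fun w k cs h => .inl ⟨h, by simp [h4]⟩)
    (by rw [hpc']; split <;> rfl), G, R⟩
  rw [hpc']
  split
  · exact ⟨by rw [W.lock, H.lock_x], G.inTree H.tree_x H.rem_x, by rw [hrem, H.rem_x]⟩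
  · rfl

/-- The final write of a deletion with two children. The traversals in progress entered their read
sections after the copy was linked, so that resetting the ghost key of the copy has no effect on
them (`Inv.ghost_done`). -/
theorem Inv.step_unlink (I : Inv c P) {e : Bool} {f : Field} {b : Ptr}
    (hf : f = bif e then .right else .left)
    (S : IsStep i (.write ⟨some p, f⟩ (.ref b) (.collapse w)) c c')
    (hpc : (e = true ∧ p = w ∧ c.pc i = .unlinkW k w b) ∨
      (e = false ∧ c.pc i = .unlinkPs k p w b))
    (hpc' : c'.pc i = if e = false ∧ b = none then .tagRead k p else .finish (.bool true)) :
    Inv c' ((c.pc i).pendStep P) ∧ Grt i c P c' ((c.pc i).pendStep P) ∧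
    RepStep (Rep c.shared.heap P) (Rep c'.shared.heap ((c.pc i).pendStep P))
      (c.pc i).commit := by
  have hown := I.pc i
  have pcs : (c.pc i).pendStep P = Function.update P w none ∧ (c.pc i).commit = none ∧
      (c.pc i).bump = none ∧ (c.pc i).copy = some w ∧
      (c.pc i).inSection = false ∧
      (∀ k y ps cs w, c.pc i ≠ .syncCall k y ps cs w ∧ c.pc i ≠ .syncWait k y ps cs w) ∧
      c.shared.lock p = some i ∧ (c.shared.heap p).rem = false ∧ InTree c.shared.heap p ∧
      c.shared.lock w = some i ∧
      ∃ cs, P w = some (userKey k, cs) ∧ c.shared.heap.child p e = some cs ∧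
        c.shared.lock cs = some i ∧ (c.shared.heap cs).rem = true ∧
        c.shared.heap.child cs true = b := by
    rcases hpc with ⟨rfl, rfl, hpc⟩ | ⟨rfl, hpc⟩ <;> rw [hpc] at hown ⊢ <;>
      simp only [PC.pendStep, PC.commit, PC.bump, PC.copy, PC.inSection, PCInv] at hown ⊢
    · obtain ⟨y, ps, cs, L, rfl, h1, h2⟩ := hown
      refine ⟨trivial, trivial, trivial, trivial, trivial, by simp, L.lock_w, L.rem_w,
        (I.tree.pend L.pend).inTree, L.lock_w, cs, L.pend, ?_, L.lock_cs, h1, h2⟩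
      rcases L.ps with ⟨-, h⟩ | ⟨h, -⟩
      · exact h
      · exact absurd rfl h
    · obtain ⟨y, cs, L, hy, h1, h2⟩ := hown
      rcases L.ps with ⟨h, -⟩ | ⟨-, h3, h4, h5, h6⟩
      · exact absurd h hy
      · exact ⟨trivial, trivial, trivial, trivial, trivial, by simp, h3, h4, h5, L.lock_w, cs,
          L.pend, h6, L.lock_cs, h1, h2⟩
  obtain ⟨h1, h2, h3, h4, h6, h7, h8, h9, h10, h11, cs, h12, h13, h14, h15, h16⟩ := pcs
  rw [h1, h2]
  obtain ⟨W, hrem, hg, hw⟩ := ChildWrite.of hf S h8 h9 h3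
  have hg' : ∀ j, c'.shared.ghost j = c.shared.ghost j := by
    intro j
    simp only [hg, GhostCmd.run]
    split
    · next hj =>
      rw [← I.ghost_done h4 (fun k y ps cs => h7 k y ps cs w) hj, Function.update_eq_self]
    · rfl
  obtain ⟨T, back, G, R⟩ := W.unlink I h10 h13 h16 h15 h14 (fun j _ => hg' j)
    (fun h h' => by rw [hpc', if_pos ⟨h, h'⟩, PC.bump]) h12 h4 h11
  refine ⟨I.of_child S W hrem T G (fun o h => .inl (back o h))
    (I.ghost_keep S W.reader (fun _ _ => by rw [hg']) W.setChild.key hw (fun w' k cs h hc => ?_) h7)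
    (by rw [h6, hpc']; split <;> rfl) ?_ (fun w' k cs h => ?_)
    (by rw [hpc']; split <;> rfl), G, R⟩
  · rw [Function.update_of_ne, h]
    rintro rfl
    exact hc h4
  · rw [hpc']
    split
    · exact ⟨by rw [W.lock, h8], G.inTree h10 h9, by rw [hrem, h9]⟩
    · rfl
  · left
    by_cases hw : w' = w
    · subst hw; simp at h
    · rw [Function.update_of_ne hw] at h
      refine ⟨h, fun hc => ?_⟩
      rw [h4] at hc
      exact absurd (Option.some_injective _ hc).symm hw

/-- The write that links the copy. The ghost key of the copy now differs from its key for all the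
traversals in progress, and all of them will be waited for. -/
theorem Inv.step_link (I : Inv c P) {e : Bool} {f : Field}
    (hf : f = bif e then .right else .left)
    (S : IsStep i (.write ⟨some p, f⟩ (.ref (some w)) (.open w (userKey k))) c c')
    (hpc : c.pc i = bif e then .linkRight k p y ps cs w else .linkLeft k p y ps cs w)
    (hpc' : c'.pc i = .syncCall k y ps cs w) :
    Inv c' ((c.pc i).pendStep P) ∧ Grt i c P c' ((c.pc i).pendStep P) ∧
    RepStep (Rep c.shared.heap P) (Rep c'.shared.heap ((c.pc i).pendStep P))
      (c.pc i).commit := by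
  have hown := I.pc i
  have pcs : (c.pc i).pendStep P = Function.update P w (some (userKey k, cs)) ∧
      (c.pc i).commit = some (.delete k) ∧
      (c.pc i).bump = none ∧ (c.pc i).copy = none ∧ (c.pc i).fresh = some w ∧
      (c.pc i).inSection = false ∧
      (∀ k y ps cs w, c.pc i ≠ .syncCall k y ps cs w ∧ c.pc i ≠ .syncWait k y ps cs w) ∧
      ((((Dup c.shared i k p y ps cs ∧ (c.shared.heap y).rem = true) ∧
      Copy c.shared y cs w) ∧ c.shared.lock w = some i) ∧ c.shared.heap.child p e = some y) := by
    rw [hpc] at hown ⊢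
    cases e <;> simp only [cond_true, cond_false, PCInv] at hown ⊢ <;>
      simp only [PC.pendStep, PC.commit, PC.bump, PC.copy, PC.inSection, PC.fresh] <;>
      exact ⟨trivial, trivial, trivial, trivial, trivial, trivial, by simp, hown⟩
  obtain ⟨h1, h2, h3, h4, h5, h6, h7, ⟨⟨⟨D, h9⟩, C⟩, h10⟩, h11⟩ := pcs
  rw [h1, h2]
  obtain ⟨W, hrem, hg, hw⟩ := ChildWrite.of hf S D.held.lock_x D.held.rem_x h3
  have hg' : ∀ j, c.shared.reader j = true →
      c'.shared.ghost j = Function.update (c.shared.ghost j) w (userKey k) := by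
    intro j hj
    simp only [hg, GhostCmd.run, hj, if_true]
  obtain ⟨T, back, G, R⟩ := W.link I D h9 C rfl h11 hg' h10 h4 h5
  have hpt := D.held.tree_x
  have hyt := D.held.tree_y
  refine ⟨I.of_child S W hrem T G (fun o h => (back o h).imp_right fun h => by rw [h5, h])
    (fun j o hj => ?_) (by rw [h6, hpc']; rfl) ?_ (fun w' k' cs' h => ?_)
    (by rw [hpc']; rfl), G, R⟩
  · rw [W.reader] at hj
    by_cases ho : o = w
    · subst ho
      right
      exact ⟨_, _, Function.update_self .., by rw [hg' j hj, Function.update_self], i, k, y, ps, cs,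
        .inl hpc'⟩
    · have e1 : c'.shared.ghost j o = c.shared.ghost j o := by
        rw [hg' j hj, Function.update_of_ne ho]
      rw [e1, W.setChild.key]
      refine (I.ghost j o hj).imp_right ?_
      rintro ⟨k', cs', e2, e3, j', k'', y', ps', cs'', e4⟩
      have hj' : j' ≠ i := by
        rintro rfl
        rcases e4 with e4 | e4
        · exact (h7 _ _ _ _ _).1 e4
        · exact (h7 _ _ _ _ _).2 e4.1
      exact ⟨k', cs', by rw [Function.update_of_ne ho, e2], by rw [e1, e3], j', k'', y', ps', cs'',
        by rw [S.other j' hj', hw]; exact e4⟩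
  · rw [hpc']
    -- the nodes below `y` differ from its parent
    have below : ∀ {z}, OnChain c.shared.heap y z → z ≠ p := by
      rintro z ⟨r, e1, e2⟩ rfl
      have e3 : Rch c.shared.heap AnyDir y z := (Rch.toDesc e2).head ⟨_, trivial, e1⟩
      cases e
      · exact absurd (I.tree.left_lt hpt h11 e3) (lt_irrefl _)
      · exact I.tree.right_ne hpt h11 e3 rfl
    have hwp : w ≠ p := by rintro rfl; exact C.tree hpt
    refine ⟨⟨by rw [W.lock, h10], by rw [W.lock, D.lock_cs], by rw [hrem, C.rem],
      Function.update_self .., ?_⟩, by rw [hrem, D.rem_cs]⟩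
    rw [W.other w hwp, W.lock, hrem]
    rcases D.walk.2 with ⟨e1, e2⟩ | ⟨e1, e2⟩
    · left
      refine ⟨e1, ?_⟩
      have := C.child true
      rw [e2] at this
      exact this
    · right
      obtain ⟨e3, e4⟩ := D.ps_ne e1
      have e5 : OnChain c.shared.heap y ps := by
        rcases Hind.or e2 with h | h
        · exact h
        · simp [e3] at h
      exact ⟨e1, D.lock_ps, e3, G.inTree (e5.inTree hyt) e3, by rw [W.other ps (below e5), e4]⟩
  · by_cases hw : w' = w
    · right
      rw [hw, hpc', PC.copy]
    · left
      rw [Function.update_of_ne hw] at h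
      exact ⟨h, by simp [h4]⟩

/-- Every step preserves the invariant and gives its guarantee to the other threads, and the
abstract map changes as required by the operation that takes effect, if any. -/
theorem Inv.step (I : Inv c P) (S : IsStep i a c c') :
    Inv c' ((c.pc i).pendStep P) ∧ Grt i c P c' ((c.pc i).pendStep P) ∧
    RepStep (Rep c.shared.heap P) (Rep c'.shared.heap ((c.pc i).pendStep P))
      (c.pc i).commit := by
  have hloc := S.local_
  by_cases h1 : a.isLocal
  · exact I.step_local S h1
  by_cases h2 : a = .rcuLock ∨ a = .rcuUnlock ∨ a = .syncCall ∨ a = .syncReturn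
  · exact I.step_rcu S h2
  generalize hp : c.pc i = p at hloc
  generalize hp' : c'.pc i = p' at hloc
  rw [← hp]
  cases hloc <;> simp only [Act.isLocal, not_true_eq_false, reduceCtorEq, or_self,
    not_false_eq_true, or_true, or_false] at h1 h2
  case insNewLeft | insNewRight | dupNew => exact I.step_alloc S
  case bypMark | dupMark | csMark => exact I.step_mark S (.inl rfl)
  case tagWrite => exact I.step_mark S (.inr rfl)
  case insWriteLeft => exact I.step_insert (e := false) rfl S hp hp'
  case insWriteRight => exact I.step_insert (e := true) rfl S hp hp'
  case bypLeftN => exact I.step_bypass (e := false) rfl S hp (by simpa using hp')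
  case bypLeftS => exact I.step_bypass (e := false) rfl S hp (by simpa using hp')
  case bypRight => exact I.step_bypass (e := true) rfl S hp (by simpa using hp')
  case linkLeft => exact I.step_link (e := false) rfl S hp hp'
  case linkRight => exact I.step_link (e := true) rfl S hp hp'
  case unlinkW => exact I.step_unlink (e := true) rfl S (.inl ⟨rfl, rfl, hp⟩) (by simpa using hp')
  case unlinkPsS => exact I.step_unlink (e := false) rfl S (.inr ⟨rfl, hp⟩) (by simpa using hp')
  case unlinkPsN => exact I.step_unlink (e := false) rfl S (.inr ⟨rfl, hp⟩) (by simpa using hp')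

theorem inv_init : Inv initConfig (fun _ => none) := by
  have h0 : initHeap rootId = ⟨((-1 : ℤ) : WithTop ℤ), 0, none, some 1, 0, false⟩ := rfl
  have h1 : ∀ o, o ≠ rootId → initHeap o = ⟨⊤, 0, none, none, 0, false⟩ := fun o ho => if_neg ho
  have child : ∀ {p d z}, initHeap.child p d = some z → p = rootId ∧ d = true ∧ z = 1 := by
    intro p d z h
    by_cases hp : p = rootId
    · subst hp
      cases d <;> simp [Heap.child, h0] at h
      exact ⟨rfl, rfl, h.symm⟩
    · cases d <;> simp [Heap.child, h1 p hp] at h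
  have desc : ∀ {z}, Rch initHeap AnyDir 1 z → z = 1 := by
    intro z h
    rcases ReflTransGen.cases_head h with rfl | ⟨b, ⟨f, -, e⟩, -⟩
    · rfl
    · exact absurd (child e).1 (by decide)
  have tree : ∀ {z}, InTree initHeap z → z = rootId ∨ z = 1 := by
    intro z h
    rcases ReflTransGen.cases_head h with rfl | ⟨b, ⟨f, -, e⟩, h⟩
    · exact .inl rfl
    · obtain ⟨-, -, rfl⟩ := child e
      exact .inr (desc h)
  refine ⟨rfl, ⟨?_, ?_, ?_, ?_, ?_⟩, ?_, ?_, ?_, ?_, ?_, ?_, ?_, ?_⟩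
  · intro p q d e z _ _ e1 e2
    obtain ⟨rfl, rfl, -⟩ := child e1
    obtain ⟨rfl, rfl, -⟩ := child e2
    exact ⟨rfl, rfl⟩
  · intro p d _ h
    exact absurd (child h).2.2 (by decide)
  · intro q r z _ h
    exact absurd (child h).2.1 (by decide)
  · intro q r z _ h hz
    obtain ⟨rfl, -, rfl⟩ := child h
    obtain rfl := desc hz
    left
    rw [lowKey_none rfl]
    exact WithTop.coe_lt_top _
  · intro w k cs h
    simp at h
  · intro o h
    rcases tree h with rfl | rfl <;> simp [initConfig, rootId]
  · intro o j h
    simp [initConfig] at h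
  · intro o _
    show (initHeap o).rem = false
    by_cases ho : o = rootId
    · rw [ho, h0]
    · rw [h1 o ho]
  · intro j o h
    simp [initConfig] at h
  · intro j; rfl
  · intro j; trivial
  · intro w k cs h
    simp at h
  · intro i j n h
    simp [initConfig, PC.fresh] at h
end

/-! ### Executions -/

namespace Execution
variable (E : Execution)

/-- The unfinished deletions at time `t`. -/
def pend : ℕ → Pend
  | 0 => fun _ => none
  | t + 1 => ((E.cfg t).pc (E.act t).1).pendStep (pend t)

theorem isStep (t : ℕ) : IsStep (E.act t).1 (E.act t).2 (E.cfg t) (E.cfg (t + 1)) :=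
  ⟨E.step_local t, E.step_other t, E.step_shared t⟩

theorem inv (t : ℕ) : Inv (E.cfg t) (E.pend t) := by
  induction t with
  | zero => rw [E.init]; exact inv_init
  | succ t ih => exact (ih.step (E.isStep t)).1

theorem grt (t : ℕ) : Grt (E.act t).1 (E.cfg t) (E.pend t) (E.cfg (t + 1)) (E.pend (t + 1)) :=
  ((E.inv t).step (E.isStep t)).2.1

end Execution

/-! ### Reachability of locations -/

/-- The field of the child pointer in direction `d`. -/
def dirFld (d : Bool) : Field := bif d then .right else .left

/-- One step of a search at the level of locations, which leaves nodes in the directions that `A`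
admits. -/
inductive LocStep (h : Heap) (A : ℕ → Bool → Prop) : Loc → Loc → Prop
  | link {o d} : A o d → LocStep h A ⟨some o, .key⟩ ⟨some o, dirFld d⟩
  | ptr {o d} : LocStep h A ⟨some o, dirFld d⟩ ⟨h.child o d, .key⟩

/-- The locations that a search from the node `r` reaches. -/
def Reached (h : Heap) (A : ℕ → Bool → Prop) (r : ℕ) : Loc → Prop
  | ⟨some x, .key⟩ => Rch h A r x
  | ⟨none, .key⟩ => ∃ o d, Rch h A r o ∧ A o d ∧ h.child o d = none
  | ⟨some x, .left⟩ => Rch h A r x ∧ A x false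
  | ⟨some x, .right⟩ => Rch h A r x ∧ A x true
  | _ => False

section
variable {h : Heap} {A : ℕ → Bool → Prop} {r x o : ℕ} {l l' : Loc} {k : Key} {g : ℕ → Key}
  {d : Bool}

theorem stdLink_iff : StdLink h k l l' ↔ LocStep h (SDir h k) l l' := by
  constructor
  · intro H
    rcases l with ⟨_ | o, f⟩
    · have H : Extend k ⟨none, f⟩ .undef l' := H
      cases H
    · cases f
      · have H : Extend k ⟨some o, .key⟩ (.key (h o).key) l' := H
        cases H with
        | right H' => exact .link (d := true) H'
        | left H' => exact .link (d := false) H'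
      · have H : Extend k ⟨some o, .data⟩ (.data (h o).data) l' := H
        cases H
      · have H : Extend k ⟨some o, .left⟩ (.ref (h o).left) l' := H
        cases H
        exact .ptr (d := false)
      · have H : Extend k ⟨some o, .right⟩ (.ref (h o).right) l' := H
        cases H
        exact .ptr (d := true)
      · have H : Extend k ⟨some o, .tag⟩ (.tag (h o).tag) l' := H
        cases H
      · have H : Extend k ⟨some o, .rem⟩ (.rem (h o).rem) l' := H
        cases H
  · intro H
    cases H with
    | @link o d H' => cases d; exacts [.left H', .right H']
    | @ptr o d => cases d; exacts [.ofLeft, .ofRight]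

theorem weakLink_iff : WeakLink h g k l l' ↔
    ∃ o d, WDir h g k o d ∧ l = ⟨some o, .key⟩ ∧ l' = ⟨some o, dirFld d⟩ := by
  constructor
  · intro H
    cases H with
    | right H => exact ⟨_, true, H, rfl, rfl⟩
    | left H => exact ⟨_, false, H, rfl, rfl⟩
  · rintro ⟨o, d, H, rfl, rfl⟩
    cases d
    exacts [.left H, .right H]

theorem weakStep_iff : WeakStep h g k l l' ↔ LocStep h (WDir h g k) l l' := by
  constructor
  · intro H
    cases H with
    | ofLeft => exact .ptr (d := false)
    | ofRight => exact .ptr (d := true)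
    | link H' =>
      obtain ⟨o, d, hd, rfl, rfl⟩ := weakLink_iff.1 H'
      exact .link hd
  · intro H
    cases H with
    | link H' => exact .link (weakLink_iff.2 ⟨_, _, H', rfl, rfl⟩)
    | @ptr o d => cases d; exacts [.ofLeft, .ofRight]

theorem Reached.dir : Reached h A r ⟨some x, dirFld d⟩ ↔ Rch h A r x ∧ A x d := by
  cases d <;> rfl

theorem Rch.loc (H : Rch h A r x) : ReflTransGen (LocStep h A) ⟨some r, .key⟩ ⟨some x, .key⟩ := by
  induction H with
  | refl => exact .refl
  | tail _ e ih =>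
    obtain ⟨d, hd, e⟩ := e
    have := (ih.tail (.link hd)).tail .ptr
    rwa [e] at this

theorem locReach_iff : ReflTransGen (LocStep h A) ⟨some r, .key⟩ l ↔ Reached h A r l := by
  constructor
  · intro H
    induction H with
    | refl => exact ReflTransGen.refl
    | tail _ e ih =>
      cases e with
      | link H => exact Reached.dir.2 ⟨ih, H⟩
      | @ptr o d =>
        obtain ⟨h1, h2⟩ := Reached.dir.1 ih
        rcases e : h.child o d with _ | z
        · exact ⟨o, d, h1, h2, e⟩
        · exact ReflTransGen.tail h1 ⟨d, h2, e⟩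
  · have key : ∀ {o d}, Rch h A r o → A o d →
        ReflTransGen (LocStep h A) ⟨some r, .key⟩ ⟨some o, dirFld d⟩ :=
      fun h1 h2 => (Rch.loc h1).tail (.link h2)
    intro H
    rcases l with ⟨_ | x, f⟩
    · cases f <;> try exact H.elim
      obtain ⟨o, d, h1, h2, e⟩ := H
      have := (key h1 h2).tail .ptr
      rwa [e] at this
    · cases f
      case key => exact Rch.loc H
      case left => exact key (d := false) H.1 H.2
      case right => exact key (d := true) H.1 H.2
      all_goals exact H.elim

theorem stdPath_eq : StdPath h k = ReflTransGen (LocStep h (SDir h k)) := by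
  have : StdLink h k = LocStep h (SDir h k) := by
    funext l l'
    exact propext stdLink_iff
  rw [StdPath, this]

theorem stdReach_iff : StdReach h k l ↔ Reached h (SDir h k) rootId l := by
  rw [StdReach, stdPath_eq]
  exact locReach_iff

theorem weakReach_iff : WeakReach h g k l ↔ Reached h (WDir h g k) rootId l := by
  have : WeakStep h g k = LocStep h (WDir h g k) := by
    funext l l'
    exact propext weakStep_iff
  rw [WeakReach, this]
  exact locReach_iff

theorem stdPath_dir {z : ℕ} (e : h.child x d = some r) (H : Rch h (SDir h k) r z) :
    StdPath h k ⟨some x, dirFld d⟩ ⟨some z, .key⟩ := by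
  rw [stdPath_eq]
  refine ReflTransGen.head .ptr ?_
  rw [e]
  exact Rch.loc H

theorem inSubtree_iff {z : ℕ} : InSubtree h (h.child x d) z ↔
    ∃ r, h.child x d = some r ∧ Rch h AnyDir r z := by
  refine exists_congr fun r => and_congr_right fun _ => ?_
  have : (fun u v => (h u).left = some v ∨ (h u).right = some v) = Edge h AnyDir := by
    funext u v
    refine propext ⟨?_, ?_⟩
    · rintro (e | e)
      exacts [⟨false, trivial, e⟩, ⟨true, trivial, e⟩]
    · rintro ⟨d, -, e⟩
      cases d
      exacts [.inl e, .inr e]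
  rw [this]
end

/-! ### Steps during an RCU read section -/

section
variable {c c' : Config} {P P' : Pend} {i j : Tid} {k x y z w v ps cs d n p o : ℕ} {q : Key}
  {a : Act}

/-- Where the weak search may turn right but the standard one does not, there is a right child. -/
theorem Inv.weak_right (I : Inv c P) (hi : c.shared.reader i = true)
    (H : WDir c.shared.heap (c.shared.ghost i) q o true) (hs : ¬ SDir c.shared.heap q o true) :
    c.shared.heap.child o true ≠ none := by
  have hg : c.shared.ghost i o ≠ (c.shared.heap o).key := by
    rintro hg
    rcases H with ⟨h1, -⟩ | ⟨-, h2⟩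
    · exact hs (hg.symm.trans_lt h1)
    · exact h2 hg
  obtain ⟨k, cs, h1, -⟩ := (I.ghost i o hi).resolve_left hg
  obtain ⟨r, e, -⟩ := (I.tree.pend h1).chain
  simp [e]

/-- During a read section the ghost keys of nodes in the tree do not change. -/
theorem Inv.ghost_eq (I : Inv c P) (S : IsStep j a c c') (hi : c.shared.reader i = true)
    (ho : InTree c.shared.heap o) : c'.shared.ghost i o = c.shared.ghost i o := by
  have hloc := S.local_
  have hpc := I.pc j
  have hsh := S.shared
  have hr := I.reader j
  have done : ∀ {w}, (c.pc j).copy = some w →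
      (∀ k y ps cs, c.pc j ≠ .syncCall k y ps cs w ∧ c.pc j ≠ .syncWait k y ps cs w) →
      c.shared.ghost i w = (c.shared.heap w).key := fun h1 h2 => I.ghost_done h1 h2 hi
  have upd : ∀ {w v}, (o = w → v = c.shared.ghost i o) →
      Function.update (c.shared.ghost i) w v o = c.shared.ghost i o := by
    intro w v h
    rw [Function.update_apply]
    split
    · next ho => exact h ho
    · rfl
  rw [hsh]
  generalize c.pc j = p at *
  generalize c'.pc j = p' at *
  cases hloc <;> try rfl
  case locStart =>
    have : i ≠ j := by
      rintro rfl
      simp [hi, PC.inSection] at hr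
    simp [applyAct, Function.update_of_ne this]
  case insNewLeft | insNewRight | dupNew =>
    exact Function.update_of_ne (I.tree_lt o ho).ne _ _
  case linkLeft | linkRight =>
    simp only [applyAct, GhostCmd.run, hi, if_true]
    exact upd fun h => (hpc.1.1.2.tree (h ▸ ho)).elim
  case unlinkW | unlinkPsS | unlinkPsN =>
    simp only [applyAct, GhostCmd.run, hi, if_true]
    refine upd fun h => ?_
    rw [h, done rfl fun _ _ _ _ => ⟨nofun, nofun⟩]

/-- A location whose weak reachability a step reduces belongs to a marked node. -/
theorem Inv.weak_lost (I : Inv c P) (S : IsStep j a c c') (G : Grt j c P c' P')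
    (hi : c.shared.reader i = true) (hi' : c'.shared.reader i = true) {l : Loc}
    (H : WeakReach c.shared.heap (c.shared.ghost i) q l) :
    WeakReach c'.shared.heap (c'.shared.ghost i) q l ∨ l.obj = none ∨
      ∃ o, l.obj = some o ∧ (c.shared.heap o).rem = true := by
  rw [weakReach_iff] at H ⊢
  have dir : ∀ {x d}, WeakN c.shared i q x →
      WDir c.shared.heap (c.shared.ghost i) q x d → WDir c'.shared.heap (c'.shared.ghost i) q x d := by
    intro x d h1 h2
    have h3 := G.key x (I.tree_lt x h1.inTree)
    have h4 := I.ghost_eq S hi h1.inTree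
    simpa only [WDir, h3, h4] using h2
  rcases l with ⟨_ | x, f⟩
  · exact .inr (.inl rfl)
  · cases f
    case key =>
      exact (G.weak i q x hi hi' H).imp_right fun h => .inr ⟨x, rfl, h⟩
    case left =>
      exact (G.weak i q x hi hi' H.1).imp (fun h => ⟨h, dir H.1 H.2⟩) fun h => .inr ⟨x, rfl, h⟩
    case right =>
      exact (G.weak i q x hi hi' H.1).imp (fun h => ⟨h, dir H.1 H.2⟩) fun h => .inr ⟨x, rfl, h⟩
    all_goals exact H.elim

/-- A ghost key that differs from the key of its node after a step did so before, or the step has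
linked the node. -/
theorem Inv.ghost_step (I : Inv c P) (S : IsStep j a c c') (I' : Inv c' ((c.pc j).pendStep P))
    (hi : c.shared.reader i = true) (hi' : c'.shared.reader i = true)
    (hw : c'.shared.ghost i w ≠ (c'.shared.heap w).key) :
    (InTree c.shared.heap w ∧ c.shared.ghost i w ≠ (c.shared.heap w).key ∧
      (c.pc j).pendStep P w = P w) ∨
    ∃ k x y ps cs, (c.pc j = .linkLeft k x y ps cs w ∨ c.pc j = .linkRight k x y ps cs w) ∧
      c'.shared.ghost i w = userKey k ∧ (c.pc j).pendStep P w = some (userKey k, cs) := by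
  by_cases hl : ∃ k x y ps cs, c.pc j = .linkLeft k x y ps cs w ∨ c.pc j = .linkRight k x y ps cs w
  · right
    obtain ⟨k, x, y, ps, cs, hl⟩ := hl
    have hP : (c.pc j).pendStep P w = some (userKey k, cs) := by
      rcases hl with hl | hl <;> simp [hl, PC.pendStep]
    obtain ⟨k', cs', h1, h2, -⟩ := (I'.ghost i w hi').resolve_left hw
    rw [hP] at h1
    obtain ⟨rfl, rfl⟩ : userKey k = k' ∧ cs = cs' := by simpa using h1
    exact ⟨k, x, y, ps, cs, hl, h2, hP⟩
  · left
    obtain ⟨k', cs', h1, h2, -⟩ := (I'.ghost i w hi').resolve_left hw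
    have h0 := h1
    have hP : P w = some (k', cs') := by
      generalize c.pc j = p at *
      cases p <;> simp only [PC.pendStep] at h1 <;> try exact h1
      case linkLeft | linkRight =>
        rw [Function.update_of_ne] at h1
        · exact h1
        · rintro rfl
          exact hl ⟨_, _, _, _, _, by simp; exact ⟨rfl, rfl, rfl, rfl, rfl⟩⟩
      all_goals
        rw [Function.update_apply] at h1
        split at h1
        · simp at h1
        · exact h1
    have ht := (I.tree.pend hP).inTree
    refine ⟨ht, ?_, h0.trans hP.symm⟩
    rw [← I.ghost_eq S hi ht, h2]
    exact (I.tree.pend hP).lt.ne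

/-- The situation in which a copy of a node with key `g` that has the key `m` is linked: until then,
all the searches for keys above `g` and up to `m` end at the successor or at its null left child. -/
structure Opening (h : Heap) (g m : Key) (cs : ℕ) : Prop where
  key : (h cs).key = m
  left : h.child cs false = none
  std : ∀ q, g < q → q ≤ m → StdN h q cs

/-- When a copy is about to be linked, the searches for keys above the deleted one and up to that of
the successor pass `y` and follow the chain of left pointers to the successor. -/
theorem Inv.opening (I : Inv c P) (D : Dup c.shared j k x y ps cs)
    (hcopy : (c.pc j).copy = none) :
    Opening c.shared.heap (userKey k) (c.shared.heap cs).key cs := by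
  have hy := D.held
  obtain ⟨d, e⟩ := hy.child
  have hyt := hy.tree_x.child e
  obtain ⟨r, er, hr⟩ : OnChain c.shared.heap y cs := by
    rcases Hind.or D.walk.1 with h | h
    · exact h
    · simp [D.rem_cs] at h
  refine ⟨rfl, D.left_cs, fun q h1 h2 => ?_⟩
  have hyq : StdN c.shared.heap q y := by
    refine std_of_ancestors hyt fun p f r' hp e' hr' => ?_
    cases f
    · exact lt_of_le_of_lt h2 (I.tree.left_lt hp e'
        (hr'.trans ((Rch.toDesc hr).head ⟨true, trivial, er⟩)))
    · refine lt_trans ?_ h1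
      rw [← hy.key_y]
      exact I.tree.right_gt' hp e' hr' (I.not_pend hcopy hy.lock_y).2
  exact (hyq.tail ⟨true, by simpa [SDir, hy.key_y] using h1, er⟩).trans
    (I.tree.chain_std (hyt.child er) hr h2)
end

/-! ### Read sections -/

theorem Heap.val_congr {h h' : Heap} {l : Loc} (H : ∀ o, l.obj = some o → h o = h' o) :
    h.val l = h'.val l := by
  rcases l with ⟨_ | o, f⟩
  · rfl
  · cases f <;> simp [Heap.val, H o rfl]

namespace Execution
variable {E : Execution} {i : Tid} {a b s t u k x y v o : ℕ} {q : Key} {l : Loc}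

theorem InSection.reader (H : E.InSection i a b) : (E.cfg b).shared.reader i = true :=
  H.2.2 b H.2.1 le_rfl

theorem InSection.mono (H : E.InSection i a b) (h : a < s) (h' : s ≤ b) : E.InSection i a s :=
  ⟨H.1, h, fun t h1 h2 => H.2.2 t h1 (h2.trans h')⟩

variable (E) in
theorem next_mono (h : s ≤ t) : (E.cfg s).shared.next ≤ (E.cfg t).shared.next := by
  induction h with
  | refl => exact le_rfl
  | step _ ih => exact ih.trans (E.grt _).next_le

variable (E) in
theorem key_eq (h : s ≤ t) (ho : o < (E.cfg s).shared.next) :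
    (E.heap t o).key = (E.heap s o).key := by
  induction h with
  | refl => rfl
  | step h ih => exact ((E.grt _).key o (lt_of_lt_of_le ho (E.next_mono h))).trans ih

variable (E) in
theorem data_eq (h : s ≤ t) (ho : o < (E.cfg s).shared.next) :
    (E.heap t o).data = (E.heap s o).data := by
  induction h with
  | refl => rfl
  | step h ih => exact ((E.grt _).data o (lt_of_lt_of_le ho (E.next_mono h))).trans ih

variable (E) in
theorem frozen (h : s ≤ t) (ho : (E.heap s o).rem = true) : E.heap t o = E.heap s o := by
  induction h with
  | refl => rfl
  | step h ih =>
    rw [← ih] at ho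
    exact ((E.grt _).frozen o ho).trans ih

theorem tagStable_mono (h : s ≤ t) (H : TagStable (E.cfg s) (E.pend s) q x v) :
    TagStable (E.cfg t) (E.pend t) q x v := by
  induction h with
  | refl => exact H
  | step _ ih => exact (E.grt _).tagStable ih

theorem rightStable_mono (h : s ≤ t) (H : RightStable (E.cfg s).shared q x) :
    RightStable (E.cfg t).shared q x := by
  induction h with
  | refl => exact H
  | step _ ih => exact (E.grt _).rightStable ih

theorem published_mono (h : s ≤ t) (H : Published (E.cfg s).shared x) :
    Published (E.cfg t).shared x := by
  induction h with
  | refl => exact H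
  | step _ ih => exact (E.grt _).published ih

/-- Marked nodes are not written. -/
theorem not_writes {f : Field} (ho : (E.heap s o).rem = true) : ¬ E.writes s ⟨some o, f⟩ := by
  have hloc := E.step_local s
  have H := (E.inv s).pc (E.act s).1
  have hun := (E.inv s).unalloc (E.cfg s).shared.next le_rfl
  change ((E.cfg s).shared.heap o).rem = true at ho
  unfold writes
  generalize (E.act s).2 = a at *
  generalize (E.cfg s).pc (E.act s).1 = p at *
  generalize (E.cfg (s + 1)).pc (E.act s).1 = p' at *
  have key : ∀ {x} {f' : Field}, ((E.cfg s).shared.heap x).rem = false →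
      (⟨some x, f'⟩ : Loc) ≠ ⟨some o, f⟩ := by
    rintro x f' hx h
    injection h with h1 h2
    injection h1 with h1
    subst h1
    simp [ho] at hx
  cases hloc <;> try exact id
  case insNewLeft | insNewRight | dupNew =>
    intro h
    rw [← Option.some_injective _ h] at hun
    simp [ho] at hun
  case insWriteLeft => exact key H.1.2.2.1
  case insWriteRight => exact key H.1.1.2.2.1
  case bypMark | dupMark => exact key (by first | exact H.2.1 | exact H.1.2)
  case bypLeftN | bypLeftS | bypRight => exact key H.1.rem_x
  case tagWrite => exact key H.2.2.1
  case linkLeft | linkRight => exact key H.1.1.1.1.held.rem_x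
  case csMark => exact key H.2
  case unlinkW =>
    obtain ⟨_, _, _, L, -⟩ := H
    exact key L.rem_w
  case unlinkPsS | unlinkPsN =>
    obtain ⟨y, cs, L, hne, -⟩ := H
    rcases L.ps with h | h
    · exact absurd h.1 hne
    · exact key h.2.2.1

theorem not_writes_later (h : s ≤ t) {f : Field} (ho : (E.heap s o).rem = true) :
    ¬ E.writes t ⟨some o, f⟩ := not_writes (by rw [E.frozen h ho, ho])

theorem not_writes_null {f : Field} : ¬ E.writes s ⟨none, f⟩ := by
  have hloc := E.step_local s
  unfold writes
  generalize (E.act s).2 = a at *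
  generalize (E.cfg s).pc (E.act s).1 = p at *
  generalize (E.cfg (s + 1)).pc (E.act s).1 = p' at *
  cases hloc <;> first | exact id | exact nofun

/-! ### Weak reachability during a read section -/

theorem std_weak (H : E.InSection i a b) (h : E.Std k b l) : E.Weak i k b l := by
  have G := (E.inv b).ghostOK H.reader
  refine weakReach_iff.2 ?_
  have h := stdReach_iff.1 h
  have mono : ∀ {o}, Rch (E.heap b) (SDir (E.heap b) (userKey k)) rootId o →
      Rch (E.heap b) (WDir (E.heap b) ((E.cfg b).shared.ghost i) (userKey k)) rootId o :=
    fun h => (E.inv b).std_weak H.reader h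
  have dir : ∀ {o d}, SDir (E.heap b) (userKey k) o d →
      WDir (E.heap b) ((E.cfg b).shared.ghost i) (userKey k) o d :=
    fun h => h.wdir (G.le (E.inv b).tree _)
  rcases l with ⟨_ | x, f⟩
  · cases f <;> try exact h.elim
    obtain ⟨o, d, h1, h2, h3⟩ := h
    exact ⟨o, d, mono h1, dir h2, h3⟩
  · cases f
    case key => exact mono h
    case left => exact ⟨mono h.1, dir (d := false) h.2⟩
    case right => exact ⟨mono h.1, dir (d := true) h.2⟩
    all_goals exact h.elim

theorem weak_extend (H : E.InSection i a b) :
    SingleStepCompatible (Extend (userKey k)) (E.heap b).val (E.Weak i k b) := by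
  intro l l' h e
  refine ReflTransGen.tail h (weakStep_iff.2 ?_)
  have G := (E.inv b).ghostOK H.reader
  cases stdLink_iff.1 e with
  | link h' => exact .link (h'.wdir (G.le (E.inv b).tree _))
  | ptr => exact .ptr

/-- Weak reachability is lost only at marked nodes and at null. As marked nodes do not change, this
is what makes the argument from hindsight work. -/
theorem weak_step (H : E.InSection i a b) (h1 : a < s) (h2 : s < b) (h : E.Weak i k s l) :
    E.Weak i k (s + 1) l ∨ ∀ o, l.obj = some o → (E.heap s o).rem = true := by
  rcases (E.inv s).weak_lost (E.isStep s) (E.grt s) (H.mono h1 h2.le).reader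
    (H.mono (h1.trans (Nat.lt_succ_self _)) h2).reader h with h | h | ⟨o, h, h'⟩
  · exact .inl h
  · exact .inr fun o ho => by simp [h] at ho
  · exact .inr fun o' ho => by
      obtain rfl := Option.some_injective _ (h.symm.trans ho)
      exact h'

theorem strongForepassed (H : E.InSection i a b) (h1 : a < s) (h2 : s < b) :
    StrongForepassed E.writes (E.Weak i k) b s := by
  intro l
  by_cases h : E.Weak i k s l
  · refine (weak_step H h1 h2 h).imp (fun h _ => h) fun h t ht _ => ?_
    rcases l with ⟨_ | o, f⟩
    · exact not_writes_null
    · exact not_writes_later ht (h o rfl)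
  · exact .inl fun h' => absurd h' h

theorem tag_forepassed (H : E.InSection i a b) (h1 : a < s) (h2 : s < b) :
    ForepassedField E.writes (E.Weak i k) b s ⟨some x, .key⟩ ⟨some x, .tag⟩ := by
  by_cases h : E.Weak i k s ⟨some x, .key⟩
  · exact (weak_step H h1 h2 h).imp (fun h _ => h) fun h t ht _ => not_writes_later ht (h x rfl)
  · exact .inl fun h' => absurd h' h

/-- A location that was weakly reachable during the read section was so at a time since when its
node has not changed. -/
theorem weak_freeze (H : E.InSection i a b) (h1 : a < s) (h2 : s ≤ b) (h : E.Weak i k s l) :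
    ∃ t, s ≤ t ∧ t ≤ b ∧ E.Weak i k t l ∧ ∀ o, l.obj = some o → E.heap b o = E.heap t o := by
  induction h2 using Nat.decreasingInduction with
  | self => exact ⟨b, le_rfl, le_rfl, h, fun _ _ => rfl⟩
  | of_succ s hs ih =>
    rcases weak_step H h1 hs h with h' | h'
    · obtain ⟨t, h3, h4⟩ := ih (h1.trans (Nat.lt_succ_self _)) h'
      exact ⟨t, (Nat.le_succ s).trans h3, h4⟩
    · exact ⟨s, le_rfl, hs.le, h, fun o ho => E.frozen hs.le (h' o ho)⟩

/-- A standard search step from a location that was weakly reachable during the read section leads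
to another one. -/
theorem weak_next (H : E.InSection i a b) (h1 : a < s) (h2 : s ≤ b) (h : E.Weak i k s l) {l' : Loc}
    (e : Extend (userKey k) l ((E.heap b).val l) l') :
    ∃ t, s ≤ t ∧ t ≤ b ∧ E.Weak i k t l' := by
  obtain ⟨t, h3, h4, h5, h6⟩ := weak_freeze H h1 h2 h
  rw [Heap.val_congr h6] at e
  exact ⟨t, h3, h4, weak_extend (H.mono (lt_of_lt_of_le h1 h3) h4) _ _ h5 e⟩

/-! ### Hindsight about endpoints of weak paths -/

/-- If a weak search deviates at the copy `w`, then `w` was linked during the read section, since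
ghost keys equal the keys when the read section starts. At that moment the nodes that the deviation
leads to were still standardly reachable. -/
theorem opening_before (H : E.InSection i a b) {w cs : ℕ} {g : Key}
    (hP : E.pend b w = some (g, cs)) (hg : (E.cfg b).shared.ghost i w = g) :
    ∃ s, a < s ∧ s ≤ b ∧ Opening (E.heap s) g (E.heap b w).key cs := by
  obtain ⟨n, rfl⟩ := Nat.exists_eq_add_of_lt H.2.1
  induction n generalizing w with
  | zero =>
    exfalso
    have hsh := E.step_shared a
    rw [H.1] at hsh
    have h1 : (E.cfg (a + 0 + 1)).shared.ghost i w = (E.heap a w).key := by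
      simp [hsh, applyAct, heap]
    have h2 : (E.heap (a + 0 + 1) w).key = (E.heap a w).key := by
      simp [heap, hsh, applyAct]
    have := ((E.inv _).tree.pend hP).lt
    rw [← hg, h1] at this
    exact absurd h2 this.ne'
  | succ n ih =>
    have h1 : a < a + n + 1 := by omega
    change E.InSection i a (a + n + 1 + 1) at H
    change E.pend (a + n + 1 + 1) w = _ at hP
    change (E.cfg (a + n + 1 + 1)).shared.ghost i w = g at hg
    change ∃ s, a < s ∧ s ≤ a + n + 1 + 1 ∧ Opening (E.heap s) g (E.heap (a + n + 1 + 1) w).key cs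
    generalize a + n + 1 = t at *
    have H' : E.InSection i a t := H.mono h1 (Nat.le_succ _)
    have I := E.inv t
    have hw : (E.cfg (t + 1)).shared.ghost i w ≠ (E.heap (t + 1) w).key := by
      rw [hg]
      exact ((E.inv _).tree.pend hP).lt.ne
    rcases I.ghost_step (E.isStep _) (E.inv (t + 1)) H'.reader H.reader hw with
      ⟨h2, -, h3⟩ | ⟨k, x, y, ps, cs', hl, h2, h3⟩
    · rw [E.key_eq (Nat.le_succ t) (I.tree_lt w h2)]
      obtain ⟨s, h4, h5, h6⟩ := ih H' (h3.symm.trans hP)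
        ((I.ghost_eq (E.isStep t) H'.reader h2).symm.trans hg)
      exact ⟨s, h4, h5.trans (Nat.le_succ _), h6⟩
    · obtain ⟨rfl, rfl⟩ : userKey k = g ∧ cs' = cs := by simpa using h3.symm.trans hP
      have hpc := I.pc (E.act t).1
      obtain ⟨D, C, hc⟩ : Dup (E.cfg t).shared (E.act t).1 k x y ps cs' ∧
          Copy (E.cfg t).shared y cs' w ∧ ((E.cfg t).pc (E.act t).1).copy = none := by
        rcases hl with hl | hl <;> rw [hl] at hpc ⊢ <;>
          exact ⟨hpc.1.1.1.1, hpc.1.1.2, rfl⟩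
      refine ⟨t, h1, Nat.le_succ t, ?_⟩
      rw [E.key_eq (Nat.le_succ t) C.lt]
      exact C.key ▸ I.opening D hc

/-- A null location that is weakly reachable was standardly reachable during the read section. -/
theorem weak_null (H : E.InSection i a b) (h : E.Weak i k b ⟨none, .key⟩) :
    ∃ s, a < s ∧ s ≤ b ∧ E.Std k s ⟨none, .key⟩ := by
  have I := E.inv b
  obtain ⟨o, d, h1, h2, h3⟩ := weakReach_iff.1 h
  have hsd : SDir (E.heap b) (userKey k) o d := by
    by_contra hcon
    cases d
    · exact hcon h2
    · exact I.weak_right H.reader h2 hcon h3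
  rcases weak_cases I.tree (I.ghostOK H.reader) h1 with h4 | ⟨w, cs, r, D, e, h4, h5, -⟩
  · exact ⟨b, H.2.1, le_rfl, stdReach_iff.2 ⟨o, d, h4, hsd, h3⟩⟩
  · have W := I.tree.pend D.pend
    have hwo := I.tree.right_ge W.inTree e (Rch.toDesc h4)
    cases d
    · obtain rfl : o = cs := by
        rcases ReflTransGen.cases_head h5 with h | ⟨z, ⟨f, hf, ez⟩, -⟩
        · exact h
        · obtain rfl : f = false := hf
          exact absurd (ez.symm.trans h3) nofun
      obtain ⟨s, h6, h7, O⟩ := opening_before H D.pend rfl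
      have hlt : userKey k < (E.heap s o).key := by
        rw [O.key]
        exact lt_of_lt_of_eq hsd W.key_cs
      exact ⟨s, h6, h7, stdReach_iff.2 ⟨o, false, O.std _ D.lt D.le, hlt, O.left⟩⟩
    · exact absurd hsd (not_lt.2 (D.le.trans hwo))

/-- A node that is weakly reachable for its own key was standardly reachable during the read
section. -/
theorem weak_own (H : E.InSection i a b) (h : E.Weak i k b ⟨some x, .key⟩)
    (hk : (E.heap b x).key = userKey k) :
    ∃ s, a < s ∧ s ≤ b ∧ E.Std k s ⟨some x, .key⟩ ∧ (E.heap s x).key = userKey k := by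
  have I := E.inv b
  rcases weak_cases I.tree (I.ghostOK H.reader) (weakReach_iff.1 h) with
    h4 | ⟨w, cs, r, D, e, h4, h5, -⟩
  · exact ⟨b, H.2.1, le_rfl, stdReach_iff.2 h4, hk⟩
  · have W := I.tree.pend D.pend
    have hwo := I.tree.right_ge W.inTree e (Rch.toDesc h4)
    have hkw : (E.heap b w).key = userKey k := le_antisymm (hwo.trans hk.le) D.le
    rcases ReflTransGen.cases_head h5 with rfl | ⟨z, ⟨f, hf, ez⟩, hz⟩
    · obtain ⟨s, h6, h7, O⟩ := opening_before H D.pend rfl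
      exact ⟨s, h6, h7, stdReach_iff.2 (O.std _ D.lt D.le), O.key.trans hkw⟩
    · obtain rfl : f = false := hf
      have hx : InTree (E.heap b) x := (W.inTree.child e).desc (Rch.toDesc h4)
      have := I.tree.left_lt hx ez (Rch.toDesc hz)
      rw [W.key_cs] at this
      exact absurd (this.trans_eq (hk.trans hkw.symm)) (lt_irrefl _)

/-! ### The structure of weak paths -/

/-- The right subtree of a copy whose deletion is unfinished has no key below that of the copy, and
it contains the successor. -/
theorem ghost_gap (H : E.InSection i a b)
    (hg : (E.cfg b).shared.ghost i x ≠ (E.heap b x).key) :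
    (∀ z, InSubtree (E.heap b) (E.heap b x).right z →
      ¬ ((E.cfg b).shared.ghost i x < (E.heap b z).key ∧ (E.heap b z).key < (E.heap b x).key)) ∧
    ∃ y, y ≠ x ∧ (E.heap b y).key = (E.heap b x).key ∧
      StdPath (E.heap b) (E.heap b x).key ⟨some x, .right⟩ ⟨some y, .key⟩ := by
  have I := E.inv b
  obtain ⟨g, cs, hP, -⟩ := (I.ghost i x H.reader).resolve_left hg
  have W := I.tree.pend hP
  constructor
  · intro z hz h
    obtain ⟨r, e, hr⟩ := (inSubtree_iff (d := true)).1 hz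
    exact absurd (I.tree.right_ge W.inTree e hr) (not_le.2 h.2)
  · obtain ⟨r, e, hr⟩ := W.chain
    refine ⟨cs, I.tree.right_ne W.inTree e (Rch.toDesc hr), W.key_cs, ?_⟩
    exact stdPath_dir (d := true) e (I.tree.chain_std (W.inTree.child e) hr W.key_cs.ge)

/-- After a deviation, or after the first link if there is none, a weak search is a standard one. -/
theorem weak_one_deviation (H : E.InSection i a b) {p : Ptr} (hp : p ≠ some rootId)
    (h : E.Weak i k b ⟨p, .key⟩) :
    ∃ l l', E.Std k b l ∧ WeakLink (E.heap b) ((E.cfg b).shared.ghost i) (userKey k) l l' ∧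
      StdPath (E.heap b) (userKey k) l' ⟨p, .key⟩ := by
  have I := E.inv b
  have G := I.ghostOK H.reader
  have link : ∀ {w cs}, Deviates (E.heap b) (E.pend b) ((E.cfg b).shared.ghost i) (userKey k) w cs →
      WeakLink (E.heap b) ((E.cfg b).shared.ghost i) (userKey k) ⟨some w, .key⟩
        ⟨some w, dirFld true⟩ := by
    intro w cs D
    refine weakLink_iff.2 ⟨w, true, ?_, rfl, rfl⟩
    by_cases h : userKey k = (E.heap b w).key
    · exact .inr ⟨h, (h ▸ D.lt).ne⟩
    · exact .inl ⟨D.lt, h⟩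
  rcases p with _ | x
  · obtain ⟨o, d, h1, h2, h3⟩ := weakReach_iff.1 h
    rcases weak_cases I.tree G h1 with h4 | ⟨w, cs, r, D, e, h4, h5, h6⟩
    · refine ⟨⟨some o, .key⟩, _, stdReach_iff.2 h4, weakLink_iff.2 ⟨o, d, h2, rfl, rfl⟩, ?_⟩
      rw [stdPath_eq, ← h3]
      exact .single .ptr
    · have hsd : SDir (E.heap b) (userKey k) o d := by
        by_contra hcon
        cases d
        · exact hcon h2
        · exact I.weak_right H.reader h2 hcon h3
      refine ⟨⟨some w, .key⟩, _, stdReach_iff.2 D.std, link D,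
        (stdPath_dir (d := true) e h6).trans ?_⟩
      change StdPath (E.heap b) (userKey k) _ _
      rw [stdPath_eq, ← h3]
      exact .tail (.single (.link hsd)) .ptr
  · rcases weak_cases I.tree G (weakReach_iff.1 h) with h4 | ⟨w, cs, r, D, e, h4, h5, h6⟩
    · rcases ReflTransGen.cases_head h4 with rfl | ⟨z, ⟨d, hd, e⟩, hz⟩
      · exact absurd rfl hp
      · exact ⟨rootLoc, _, .refl, weakLink_iff.2 ⟨rootId, d, hd.wdir (G.le I.tree _), rfl, rfl⟩,
          stdPath_dir e hz⟩
    · exact ⟨⟨some w, .key⟩, _, stdReach_iff.2 D.std, link D, stdPath_dir (d := true) e h6⟩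

/-! ### Present reachability -/

theorem present_left (H : E.InSection i a b) (hu : b ≤ u) (h : E.Weak i k b ⟨some x, .key⟩)
    (hv : (E.heap b x).tag = v) (hl : (E.heap u x).left = none) (ht : (E.heap u x).tag = v)
    (hr : (E.heap u x).rem = false) (hlk : (E.cfg u).shared.lock x = none) :
    E.Std k u ⟨some x, .key⟩ := by
  have h1 := tagStable_mono hu ((E.inv b).weak_tagStable H.reader (weakReach_iff.1 h))
  change TagStable _ _ _ _ (E.heap b x).tag at h1
  rw [hv, ← ht] at h1
  exact stdReach_iff.2 ((E.inv u).tagStable_std h1 hr hl fun j hj => by simp [hlk] at hj)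

theorem present_right (H : E.InSection i a b) (hu : b ≤ u) (h : E.Weak i k b ⟨some x, .right⟩)
    (hk : (E.heap u x).key < userKey k) (hr : (E.heap u x).rem = false) :
    E.Std k u ⟨some x, .right⟩ := by
  have h1 := rightStable_mono hu ((E.inv b).weak_rightStable H.reader (weakReach_iff.1 h).1)
  refine stdReach_iff.2 ⟨(h1.2 hk).resolve_left ?_, hk⟩
  change ¬ (E.heap u x).rem = true
  simp [hr]

theorem present_own (hu : b ≤ u) (h : E.Weak i k b ⟨some x, .key⟩)
    (hk : (E.heap u x).key = userKey k) (hr : (E.heap u x).rem = false)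
    (hlk : (E.cfg u).shared.lock x = none) : E.Std k u ⟨some x, .key⟩ := by
  have I := E.inv u
  have h1 := (published_mono hu (.inl (WeakN.inTree (weakReach_iff.1 h)))).inTree hr
  have h2 := I.tree.own h1 fun ⟨w, g, hP⟩ => by
    obtain ⟨j, -, -, h3⟩ := I.pend_locked hP
    simp [hlk] at h3
  change Rch _ (SDir _ (E.heap u x).key) _ _ at h2
  rw [hk] at h2
  exact stdReach_iff.2 h2

theorem present_delete {y : ℕ} (h : (E.cfg u).pc i = .delLeft k x y) :
    E.Std k u ⟨some y, .key⟩ ∧ E.Std k u ⟨some x, .key⟩ := by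
  have I := E.inv u
  have hpc := I.pc i
  have hc : ((E.cfg u).pc i).copy = none := by rw [h]; rfl
  rw [h] at hpc
  obtain ⟨H, -⟩ := hpc
  obtain ⟨d, e⟩ := H.child
  have h2 := I.tree.own (H.tree_x.child e) (I.not_pend hc H.lock_y).2
  rw [H.key_y] at h2
  exact ⟨stdReach_iff.2 h2, stdReach_iff.2 (I.tree.passes h2 H.tree_x e .refl).1⟩

end Execution

/-! ### Invocations of locate -/

/-- The operation on behalf of which a thread is searching. -/
def PC.searching : PC → Option Op
  | .locTest op _ _ | .locRight op _ | .locLeft op _ => some op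
  | _ => none

theorem LStep.search {s : Shared} {i : Tid} {p p' : PC} {l l' : Loc} {op : Op}
    (S : LStep s i p (.read l) p') (h : p.cursor = some l) (h' : p'.cursor = some l')
    (ho : p.searching = some op) :
    p'.searching = some op ∧ Extend (userKey op.key) l (s.heap.val l) l' := by
  cases S <;> simp only [PC.cursor, PC.searching, Option.some.injEq, reduceCtorEq] at h h' ho <;>
    subst ho h' <;> refine ⟨rfl, ?_⟩
  case locGoRight => exact .right (by assumption)
  case locGoLeft => exact .left (by assumption)
  case locRight => exact .ofRight
  case locLeft => exact .ofLeft

/-- A thread at this control point is executing the operation `op`. -/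
def PC.Serves (op : Op) : PC → Prop
  | .idle => False
  | .locStart op' | .locTest op' _ _ | .locRight op' _ | .locLeft op' _ | .locTag op' _ _
  | .locUnlock op' _ _ _ | .located op' _ _ _ | .restart op' => op' = op
  | .conData _ => ∃ k, op = .contains k
  | .insLock k d _ _ | .insRem k d _ _ | .insKey k d _ _ | .insLeft k d _ _ | .insTag k d _ _
  | .insNewLeft k d _ | .insWriteLeft k d _ _ | .insRight k d _ | .insNewRight k d _
  | .insWriteRight k d _ _ => op = .insert k d
  | .delLockX k _ _ | .delLockY k _ _ | .delRemY k _ _ | .delRemX k _ _ | .delParLeft k _ _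
  | .delParRight k _ _ | .delLeft k _ _ | .delRight k _ _ _ | .bypMark k _ _ _ | .bypCmp k _ _ _
  | .bypLeft k _ _ _ | .bypRight k _ _ _ | .tagRead k _ | .tagWrite k _ _ | .sucRight k _ _
  | .sucLeft k _ _ _ _ | .sucLockPs k _ _ _ _ | .sucLockCs k _ _ _ _ | .sucRemPs k _ _ _ _
  | .sucRemCs k _ _ _ _ | .sucPar k _ _ _ _ | .sucNull k _ _ _ _ | .dupKey k _ _ _ _
  | .dupData k _ _ _ _ _ | .dupNew k _ _ _ _ _ _ | .dupMark k _ _ _ _ _ | .dupLock k _ _ _ _ _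
  | .linkCmp k _ _ _ _ _ | .linkLeft k _ _ _ _ _ | .linkRight k _ _ _ _ _ | .syncCall k _ _ _ _
  | .syncWait k _ _ _ _ | .csMark k _ _ _ _ | .csRight k _ _ _ _ | .unlinkW k _ _
  | .unlinkPs k _ _ _ => op = .delete k
  | .finish _ | .ret _ => True

theorem LStep.serves {s : Shared} {i : Tid} {p p' : PC} {a : Act} {op : Op} (S : LStep s i p a p')
    (h : p.Serves op) (h' : p' ≠ .idle) : p'.Serves op := by
  cases S <;> simp only [PC.Serves, ne_eq, not_true_eq_false] at h h' ⊢ <;>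
    first | exact h | exact h.symm | exact ⟨_, h.symm⟩

namespace Execution
variable {E : Execution} {i : Tid} {op : Op} {a b s u j n x y : ℕ} {l : ℕ → Loc} {t : ℕ → ℕ}
  {k : ℕ}

theorem InSection.succ (H : E.InSection i a b) (h : ((E.cfg (b + 1)).pc i).inSection = true) :
    E.InSection i a (b + 1) := by
  refine ⟨H.1, H.2.1.trans (Nat.lt_succ_self _), fun s h1 h2 => ?_⟩
  rcases Nat.lt_succ_iff_lt_or_eq.1 (Nat.lt_succ_of_le h2) with h3 | rfl
  · exact H.2.2 s h1 (Nat.lt_succ_iff.1 h3)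
  · rw [(E.inv _).reader, h]

theorem pc_other (h : (E.act s).1 ≠ i) : (E.cfg (s + 1)).pc i = (E.cfg s).pc i :=
  E.step_other s i h.symm

theorem step_act (h : (E.act s).1 = i) :
    LStep (E.cfg s).shared i ((E.cfg s).pc i) (E.act s).2 ((E.cfg (s + 1)).pc i) := by
  have := E.step_local s
  rwa [h] at this

theorem inSection_start (h : E.act a = (i, .rcuLock)) : E.InSection i a (a + 1) := by
  refine ⟨h, Nat.lt_succ_self _, fun s h1 h2 => ?_⟩
  obtain rfl : s = a + 1 := le_antisymm h2 h1
  have := E.step_shared a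
  rw [this, h]
  simp [applyAct]

theorem locate_searching (T : LocateTraversal E i op a n l t) (hj : j < n) (h1 : a < s)
    (h2 : s ≤ t j) : ((E.cfg s).pc i).searching = some op ∧ E.InSection i a s := by
  induction s, (Nat.succ_le_of_lt h1) using Nat.le_induction with
  | base =>
    refine ⟨?_, inSection_start T.act_start⟩
    have := E.step_act (i := i) (s := a) (by rw [T.act_start])
    rw [T.act_start, T.pc_start] at this
    generalize (E.cfg (a + 1)).pc i = p' at *
    cases this
    rfl
  | succ s hs ih =>
    obtain ⟨ih1, ih2⟩ := ih hs ((Nat.le_succ s).trans h2)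
    have key : ((E.cfg (s + 1)).pc i).searching = some op := by
      by_cases h : (E.act s).1 = i
      · obtain ⟨j', hj', rfl⟩ := T.all s hs ⟨j, hj, (Nat.le_succ s).trans h2⟩ h
        have S := E.step_act h
        rw [T.act_read j' hj'] at S
        exact (S.search (T.cursor_before j' hj') (T.cursor_after j' hj') ih1).1
      · rw [pc_other h, ih1]
    refine ⟨key, ih2.succ ?_⟩
    generalize (E.cfg (s + 1)).pc i = p at *
    cases p <;> simp [PC.searching, PC.inSection] at key ⊢

theorem locate_extend (T : LocateTraversal E i op a n l t) (hj : j < n) :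
    Extend (userKey op.key) (l j) ((E.heap (t j)).val (l j)) (l (j + 1)) := by
  have S := E.step_act (i := i) (s := t j) (by rw [T.act_read j hj])
  rw [T.act_read j hj] at S
  exact (S.search (T.cursor_before j hj) (T.cursor_after j hj)
    (locate_searching T hj (T.after j hj) le_rfl).1).2

/-- By hindsight, each step of the traversal leads from a location that was weakly reachable to
another one that was (`weak_next`), although the two times need not be the same. -/
theorem locate_correct (T : LocateTraversal E i op a n l t) {base : ℕ} (hb : a < base)
    (hbt : ∀ j < n, base ≤ t j) : TraversalCorrect (E.Weak i op.key) base n l t := by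
  have h0 : E.Weak i op.key base (l 0) := by
    rw [T.first]
    exact ReflTransGen.refl
  have next : ∀ j < n, (∃ s, base ≤ s ∧ s ≤ t j ∧ E.Weak i op.key s (l j)) →
      ∃ s, base ≤ s ∧ s ≤ t j ∧ E.Weak i op.key s (l (j + 1)) := by
    rintro j hj ⟨s, h1, h2, h3⟩
    obtain ⟨s', h4, h5, h6⟩ := weak_next (locate_searching T hj (T.after j hj) le_rfl).2
      (lt_of_lt_of_le hb h1) h2 h3 (locate_extend T hj)
    exact ⟨s', h1.trans h4, h5, h6⟩
  refine ⟨h0, fun j hj => next j hj ?_⟩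
  induction j with
  | zero => exact ⟨base, le_rfl, hbt 0 hj, h0⟩
  | succ j ih =>
    obtain ⟨s, h1, h2, h3⟩ := next j (Nat.lt_of_succ_lt hj) (ih (Nat.lt_of_succ_lt hj))
    exact ⟨s, h1, h2.trans (T.strictMono j (j + 1) (Nat.lt_succ_self _) hj).le, h3⟩

/-! ### The outcome of locate -/

variable (E) in
/-- `l` was weakly reachable at a time in `(a, u]`. -/
def Was (i : Tid) (k a u : ℕ) (l : Loc) : Prop := ∃ s, a < s ∧ s ≤ u ∧ E.Weak i k s l

theorem Was.mono {l : Loc} (H : E.Was i k a u l) (h : u ≤ b) : E.Was i k a b l := by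
  obtain ⟨s, h1, h2, h3⟩ := H
  exact ⟨s, h1, h2.trans h, h3⟩

variable (E) in
/-- `x` was weakly reachable with the tag `v` at a time in `(a, u]`. -/
def WasTag (i : Tid) (k a u x v : ℕ) : Prop :=
  ∃ s, a < s ∧ s ≤ u ∧ E.Weak i k s ⟨some x, .key⟩ ∧ (E.heap s x).tag = v

theorem WasTag.mono {v : ℕ} (H : E.WasTag i k a u x v) (h : u ≤ b) : E.WasTag i k a b x v := by
  obtain ⟨s, h1, h2, h3⟩ := H
  exact ⟨s, h1, h2.trans h, h3⟩

variable (E) in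
/-- What a traversal that started after time `j` has seen up to time `u`. -/
def Seen (i : Tid) (j u : ℕ) : PC → Prop
  | .locTest op x y | .locTag op x y => ∃ a, j < a ∧ E.InSection i a u ∧
      E.Was i op.key a u ⟨some x, .key⟩ ∧ E.Was i op.key a u ⟨y, .key⟩
  | .locRight op x => ∃ a, j < a ∧ E.InSection i a u ∧
      E.Was i op.key a u ⟨some x, .key⟩ ∧ E.Was i op.key a u ⟨some x, .right⟩
  | .locLeft op x => ∃ a, j < a ∧ E.InSection i a u ∧
      E.Was i op.key a u ⟨some x, .key⟩ ∧ E.Was i op.key a u ⟨some x, .left⟩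
  | .locUnlock op x tag y => ∃ a, j < a ∧ E.InSection i a u ∧
      E.WasTag i op.key a u x tag ∧ E.Was i op.key a u ⟨y, .key⟩
  | .located op x tag y => ∃ a b, j < a ∧ b < u ∧ E.InSection i a b ∧
      E.WasTag i op.key a b x tag ∧ E.Was i op.key a b ⟨y, .key⟩
  | _ => True

theorem During.pred (H : E.During i op j (u + 1)) (h : j < u) : E.During i op j u :=
  ⟨H.1, h, fun s h1 h2 => H.2.2 s h1 (h2.trans (Nat.le_succ _))⟩

theorem During.start (H : E.During i op j u) : (E.cfg (j + 1)).pc i = .locStart op := by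
  have S := E.step_act (i := i) (s := j) (by rw [H.1])
  rw [H.1] at S
  generalize (E.cfg (j + 1)).pc i = p' at *
  generalize (E.cfg j).pc i = p at *
  cases S
  rfl

/-- Induction on the progress of an operation. -/
theorem During.induction {motive : ℕ → Prop} (H : E.During i op j u) (start : motive (j + 1))
    (step : ∀ s, j < s → s < u → E.During i op j s → E.During i op j (s + 1) → motive s →
      motive (s + 1)) : motive u := by
  obtain ⟨h1, h2, h3⟩ := H
  induction u, (Nat.succ_le_of_lt h2) using Nat.le_induction with
  | base => exact start
  | succ u hu ih =>
    have D : E.During i op j (u + 1) := ⟨h1, h2, h3⟩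
    have hu : j < u := hu
    exact step u hu (Nat.lt_succ_self u) (D.pred hu) D
      (ih (fun s h4 h5 => step s h4 (h5.trans (Nat.lt_succ_self u))) hu (D.pred hu).2.2)

theorem During.serves (H : E.During i op j u) : ((E.cfg u).pc i).Serves op := by
  refine H.induction (motive := fun u => ((E.cfg u).pc i).Serves op) ?_ ?_
  · rw [H.start]; exact rfl
  · intro s h1 h2 D D' ih
    by_cases h : (E.act s).1 = i
    · exact (E.step_act h).serves ih (D'.2.2 _ (h1.trans (Nat.lt_succ_self s)) le_rfl)
    · rw [pc_other h]; exact ih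

theorem During.seen (H : E.During i op j u) : E.Seen i j u ((E.cfg u).pc i) := by
  refine H.induction (motive := fun u => E.Seen i j u ((E.cfg u).pc i)) ?_ ?_
  · rw [H.start]; trivial
  · intro s h1 h2 D D' ih
    have hr : ∀ {a}, E.InSection i a s → ((E.cfg (s + 1)).pc i).inSection = true →
      E.InSection i a (s + 1) := fun h => h.succ
    have hs := Nat.le_succ s
    by_cases h : (E.act s).1 = i
    · have S := E.step_act h
      have start := fun h' => E.inSection_start (a := s) (i := i) (Prod.ext h h')
      generalize (E.act s).2 = a at *
      generalize (E.cfg s).pc i = p at *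
      generalize (E.cfg (s + 1)).pc i = p' at *
      cases S <;> try trivial
      case locStart =>
        exact ⟨s, h1, start rfl, ⟨s + 1, Nat.lt_succ_self s, le_rfl, .refl⟩,
          ⟨s + 1, Nat.lt_succ_self s, le_rfl, .refl⟩⟩
      case locNull | locFound =>
        obtain ⟨a, h1, h2, h3, h4⟩ := ih
        exact ⟨a, h1, hr h2 rfl, h3.mono hs, h4.mono hs⟩
      case locGoRight hlt =>
        obtain ⟨a, h1, h2, h3, s', h5, h6, h7⟩ := ih
        obtain ⟨s'', h8, h9, h10⟩ := weak_next h2 h5 h6 h7 (.right hlt)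
        exact ⟨a, h1, hr h2 rfl, ⟨s', h5, h6.trans hs, h7⟩, s'', lt_of_lt_of_le h5 h8,
          h9.trans hs, h10⟩
      case locGoLeft hlt =>
        obtain ⟨a, h1, h2, h3, s', h5, h6, h7⟩ := ih
        obtain ⟨s'', h8, h9, h10⟩ := weak_next h2 h5 h6 h7 (.left hlt)
        exact ⟨a, h1, hr h2 rfl, ⟨s', h5, h6.trans hs, h7⟩, s'', lt_of_lt_of_le h5 h8,
          h9.trans hs, h10⟩
      case locRight =>
        obtain ⟨a, h1, h2, h3, s', h5, h6, h7⟩ := ih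
        obtain ⟨s'', h8, h9, h10⟩ := weak_next h2 h5 h6 h7 .ofRight
        exact ⟨a, h1, hr h2 rfl, h3.mono hs, s'', lt_of_lt_of_le h5 h8, h9.trans hs, h10⟩
      case locLeft =>
        obtain ⟨a, h1, h2, h3, s', h5, h6, h7⟩ := ih
        obtain ⟨s'', h8, h9, h10⟩ := weak_next h2 h5 h6 h7 .ofLeft
        exact ⟨a, h1, hr h2 rfl, h3.mono hs, s'', lt_of_lt_of_le h5 h8, h9.trans hs, h10⟩
      case locTag =>
        obtain ⟨a, h1, h2, ⟨s', h5, h6, h7⟩, h4⟩ := ih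
        obtain ⟨s'', h8, h9, h10, h11⟩ := weak_freeze h2 h5 h6 h7
        exact ⟨a, h1, hr h2 rfl, ⟨s'', lt_of_lt_of_le h5 h8, h9.trans hs, h10,
          congrArg Node.tag (h11 _ rfl).symm⟩, h4.mono hs⟩
      case locUnlock =>
        obtain ⟨a, h1, h2, h3, h4⟩ := ih
        exact ⟨a, s, h1, Nat.lt_succ_self s, h2, h3, h4⟩
    · rw [pc_other h] at hr ⊢
      generalize (E.cfg s).pc i = p at *
      cases p <;> try trivial
      case located =>
        obtain ⟨a, b, h1, h2, h3⟩ := ih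
        exact ⟨a, b, h1, h2.trans (Nat.lt_succ_self s), h3⟩
      case locUnlock =>
        obtain ⟨a, h1, h2, h3, h4⟩ := ih
        exact ⟨a, h1, hr h2 rfl, h3.mono hs, h4.mono hs⟩
      all_goals
        obtain ⟨a, h1, h2, h3, h4⟩ := ih
        exact ⟨a, h1, hr h2 rfl, h3.mono hs, h4.mono hs⟩

/-- Whatever `locate` returns, its result was right at some time since the invocation. -/
theorem During.outcome {op' : Op} {tag : ℕ} {y : Ptr} (H : E.During i op j u)
    (hpc : (E.cfg u).pc i = .located op' x tag y) : op' = op ∧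
    (∃ a b, j < a ∧ b < u ∧ E.InSection i a b ∧ E.WasTag i op.key a b x tag ∧
      E.Was i op.key a b ⟨y, .key⟩) ∧
    (E.heap u x).key ≠ userKey op.key ∧
    (∀ z, y = some z → (E.heap u z).key = userKey op.key) ∧
    ∃ s, j < s ∧ s ≤ u ∧ E.Std op.key s ⟨y, .key⟩ ∧
      ∀ z, y = some z → (E.heap s z).key = userKey op.key := by
  obtain rfl : op' = op := by
    have := H.serves
    rwa [hpc] at this
  have h1 := H.seen
  rw [hpc] at h1
  have h2 := (E.inv u).pc i
  rw [hpc] at h2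
  obtain ⟨-, ⟨-, h3⟩, h4⟩ := h2
  refine ⟨rfl, h1, h3, fun z hz => (h4 z hz).1, ?_⟩
  obtain ⟨a, b, h5, h6, h7, -, s, h8, h9, h10⟩ := h1
  have h7 := h7.mono h8 h9
  rcases y with _ | z
  · obtain ⟨s', h11, h12, h13⟩ := weak_null h7 h10
    exact ⟨s', h5.trans h11, (h12.trans h9).trans h6.le, h13, nofun⟩
  · have hz : InTree (E.heap s) z := WeakN.inTree (weakReach_iff.1 h10)
    have hk := (h4 z rfl).1
    change (E.heap u z).key = _ at hk
    rw [E.key_eq (h9.trans h6.le) ((E.inv s).tree_lt z hz)] at hk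
    obtain ⟨s', h11, h12, h13, h14⟩ := weak_own h7 h10 hk
    refine ⟨s', h5.trans h11, (h12.trans h9).trans h6.le, h13, fun z' hz' => ?_⟩
    obtain rfl := Option.some_injective _ hz'
    exact h14
end Execution

/-! ### The abstract map -/

section
variable {c : Config} {P : Pend} {h : Heap} {k d x : ℕ} {q : Key} {i : Tid}

/-- The standard search for the key of a tree node ends at this node. -/
theorem std_end {r y : ℕ} (hx : Rch h (SDir h q) r x) (kx : (h x).key = q)
    (hy : Rch h (SDir h q) r y) {e : Bool} (he : SDir h q y e) : h.child y e ≠ none := by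
  induction hx using ReflTransGen.head_induction_on with
  | refl =>
    rcases ReflTransGen.cases_head hy with rfl | ⟨b, ⟨f, hf, -⟩, -⟩
    · cases e <;> simp [SDir, kx] at he
    · cases f <;> simp [SDir, kx] at hf
  | head e1 _ ih =>
    obtain ⟨f, hf, e1⟩ := e1
    rcases ReflTransGen.cases_head hy with rfl | ⟨b, ⟨f', hf', e2⟩, hb⟩
    · obtain rfl := hf.unique he
      simp [e1]
    · obtain rfl := hf.unique hf'
      obtain rfl := Option.some_injective _ (e1.symm.trans e2)
      exact ih hb

/-- The abstract map can be read off the heap alone: `k` is mapped to the data of the node with key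
`k` on the standard search path for `k`. -/
theorem Inv.rep_iff (I : Inv c P) : Rep c.shared.heap P k d ↔
    ∃ x, StdN c.shared.heap (userKey k) x ∧ (c.shared.heap x).key = userKey k ∧
      (c.shared.heap x).data = d := by
  constructor
  · rintro ⟨x, h1, h2, h3, h4⟩
    have := I.tree.own h1 h2
    rw [h3] at this
    exact ⟨x, this, h3, h4⟩
  · rintro ⟨x, h1, h3, h4⟩
    refine ⟨x, h1.inTree, ?_, h3, h4⟩
    -- the search would have to pass the copy, which has the same key
    rintro ⟨w, g, hP⟩
    have W := I.tree.pend hP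
    obtain ⟨r, e, hr⟩ := W.chain
    have := (I.tree.passes h1 W.inTree e (Rch.toDesc hr)).2
    simp [SDir, ← W.key_cs, h3] at this

theorem Inv.rep_unique (I : Inv c P) {d' : ℕ} (h : Rep c.shared.heap P k d)
    (h' : Rep c.shared.heap P k d') : d = d' := by
  obtain ⟨x, h1, h2, rfl⟩ := I.rep_iff.1 h
  obtain ⟨y, h3, h4, rfl⟩ := I.rep_iff.1 h'
  rw [std_unique h1 h3 h2 h4]
end

theorem LStep.idle {s : Shared} {i : Tid} {p : PC} {a : Act} (S : LStep s i p a .idle) :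
    p = .idle ∨ ∃ v, a = .respond v ∧ p = .ret v := by
  cases S
  · exact .inl rfl
  · exact .inr ⟨_, rfl, rfl⟩

namespace Execution
variable {E : Execution} {i : Tid} {op : Op} {a b s u j n x y k d r N : ℕ} {v : Res}

open Classical in
variable (E) in
/-- The abstract map at time `t`. -/
noncomputable def abs (t k : ℕ) : Option ℕ :=
  if h : ∃ d, Rep (E.heap t) (E.pend t) k d then some h.choose else none

theorem abs_eq_some : E.abs s k = some d ↔ Rep (E.heap s) (E.pend s) k d := by
  unfold abs
  split
  · next h =>
    rw [Option.some_inj]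
    exact ⟨fun e => e ▸ h.choose_spec, fun h' => (E.inv s).rep_unique h.choose_spec h'⟩
  · next h => exact ⟨nofun, fun h' => absurd ⟨d, h'⟩ h⟩

theorem abs_eq_none : E.abs s k = none ↔ ∀ d, ¬ Rep (E.heap s) (E.pend s) k d := by
  rw [Option.eq_none_iff_forall_ne_some]
  exact forall_congr' fun d => not_congr abs_eq_some

theorem represents_abs : Represents (E.heap s) (E.abs s) := fun k d => by
  rw [abs_eq_some]
  refine (E.inv s).rep_iff.trans (exists_congr fun x => and_congr ?_ Iff.rfl)
  exact (stdReach_iff (l := ⟨some x, .key⟩)).symm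

theorem abs_of_std (h : E.Std k s ⟨some x, .key⟩) (hk : (E.heap s x).key = userKey k) :
    E.abs s k = some (E.heap s x).data :=
  (represents_abs k _).2 ⟨x, h, hk, rfl⟩

theorem abs_of_null (h : E.Std k s ⟨none, .key⟩) : E.abs s k = none := by
  rw [abs_eq_none]
  intro d hd
  obtain ⟨x, h1, h2, -⟩ := (E.inv s).rep_iff.1 hd
  obtain ⟨o, e, h3, h4, h5⟩ := stdReach_iff.1 h
  exact std_end h1 h2 h3 h4 h5

theorem abs_zero : E.abs 0 = fun _ => none := by
  funext k
  rw [abs_eq_none]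
  intro d hd
  obtain ⟨x, h1, h2, -⟩ := (E.inv 0).rep_iff.1 hd
  rw [E.init] at h2
  change (initHeap x).key = _ at h2
  unfold initHeap at h2
  split at h2
  · have : (-1 : ℤ) = k := WithTop.coe_injective h2
    omega
  · exact absurd h2.symm (WithTop.coe_ne_top)

variable (E) in
/-- The step at time `s` is one by which an operation of thread `i` takes effect. -/
def Commits (i : Tid) (s : ℕ) : Prop := (E.act s).1 = i ∧ ((E.cfg s).pc i).commit ≠ none

theorem abs_succ (h : ¬ E.Commits (E.act s).1 s) : E.abs (s + 1) = E.abs s := by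
  have H := ((E.inv s).step (E.isStep s)).2.2
  have h : ((E.cfg s).pc (E.act s).1).commit = none := by
    by_contra hcon
    exact h ⟨rfl, hcon⟩
  rw [h] at H
  funext k
  refine Option.ext fun d => ?_
  rw [abs_eq_some, abs_eq_some]
  exact H k d

/-- The step by which a modifying operation takes effect changes the abstract map as specified. -/
theorem specStep_commit (h : ((E.cfg s).pc (E.act s).1).commit = some op) :
    specStep (E.abs s) op = (.bool true, E.abs (s + 1)) := by
  have H := ((E.inv s).step (E.isStep s)).2.2
  rw [h] at H
  cases op with
  | insert k d =>
    obtain ⟨h1, h2⟩ := H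
    have : E.abs s k = none := abs_eq_none.2 h1
    simp only [specStep, this, Prod.mk.injEq, true_and]
    funext k'
    refine Option.ext fun d' => ?_
    rw [abs_eq_some.trans (h2 k' d')]
    by_cases hk : k' = k
    · subst hk
      simp [eq_comm]
    · simp only [Function.update_of_ne hk, hk, false_and, false_or, not_false_eq_true, true_and,
        ne_eq]
      exact abs_eq_some
  | delete k =>
    obtain ⟨⟨d, h1⟩, h2⟩ := H
    have : E.abs s k = some d := abs_eq_some.2 h1
    simp only [specStep, this, Prod.mk.injEq, true_and]
    funext k'
    refine Option.ext fun d' => ?_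
    rw [abs_eq_some.trans (h2 k' d')]
    by_cases hk : k' = k
    · subst hk
      simp
    · simp only [Function.update_of_ne hk, hk, not_false_eq_true, true_and, ne_eq]
      exact abs_eq_some
  | contains k => exact H.elim

/-! ### The effect of an operation -/

theorem PC.commit_serves {p : PC} {op op' : Op} (h : p.Serves op) (h' : p.commit = some op') :
    op' = op := by
  cases p <;> simp only [PC.Serves, PC.commit, reduceCtorEq, Option.some.injEq] at h h' <;>
    exact h'.symm.trans h.symm

variable (E) in
/-- No operation of thread `i` takes effect between the times `j` and `u`. -/
def NoEffect (i : Tid) (j u : ℕ) : Prop := ∀ s, j < s → s < u → ¬ E.Commits i s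

variable (E) in
/-- Between the times `j` and `u`, thread `i` makes exactly one step by which an operation takes
effect. -/
def OneEffect (i : Tid) (j u : ℕ) : Prop :=
  ∃ s, j < s ∧ s < u ∧ E.Commits i s ∧ ∀ s', j < s' → s' < u → E.Commits i s' → s' = s

theorem NoEffect.succ (H : E.NoEffect i j u) (h : ¬ E.Commits i u) : E.NoEffect i j (u + 1) := by
  intro s h1 h2
  rcases Nat.lt_succ_iff_lt_or_eq.1 h2 with h2 | rfl
  · exact H s h1 h2
  · exact h

theorem OneEffect.succ (H : E.OneEffect i j u) (h : ¬ E.Commits i u) :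
    E.OneEffect i j (u + 1) := by
  obtain ⟨s, h1, h2, h3, h4⟩ := H
  refine ⟨s, h1, h2.trans (Nat.lt_succ_self u), h3, fun s' h5 h6 h7 => ?_⟩
  rcases Nat.lt_succ_iff_lt_or_eq.1 h6 with h6 | rfl
  · exact h4 s' h5 h6 h7
  · exact absurd h7 h

theorem NoEffect.commit (H : E.NoEffect i j u) (hj : j < u) (h : E.Commits i u) :
    E.OneEffect i j (u + 1) := by
  refine ⟨u, hj, Nat.lt_succ_self u, h, fun s' h5 h6 h7 => ?_⟩
  rcases Nat.lt_succ_iff_lt_or_eq.1 h6 with h6 | rfl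
  · exact absurd h7 (H s' h5 h6)
  · rfl

variable (E) in
/-- What has happened when the operation `op`, invoked at time `j`, has reached a control point at
time `u`: whether it took effect, and, before it returns without effect, when its result was
justified. -/
def Effect (i : Tid) (op : Op) (j u : ℕ) : PC → Prop
  | .tagRead _ _ | .tagWrite _ _ _ | .syncCall _ _ _ _ _ | .syncWait _ _ _ _ _ | .csMark _ _ _ _ _
  | .csRight _ _ _ _ _ | .unlinkW _ _ _ | .unlinkPs _ _ _ _ | .finish _ => E.OneEffect i j u
  | .conData y => E.NoEffect i j u ∧ ∃ k s, op = .contains k ∧ j < s ∧ s ≤ u ∧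
      E.Std k s ⟨some y, .key⟩ ∧ (E.heap s y).key = userKey k
  | .ret v => (E.OneEffect i j u ∧ v = .bool true) ∨ (E.NoEffect i j u ∧ ∃ s, j < s ∧ s ≤ u ∧
      specStep (E.abs s) op = (v, E.abs s))
  | _ => E.NoEffect i j u

theorem During.effect (H : E.During i op j u) : E.Effect i op j u ((E.cfg u).pc i) := by
  refine H.induction (motive := fun u => E.Effect i op j u ((E.cfg u).pc i)) ?_ ?_
  · rw [H.start]
    intro s h1 h2
    exact absurd (Nat.lt_succ_iff.1 h2) (not_le.2 h1)
  · intro u h1 h2 D D' ih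
    have hs := Nat.le_succ u
    by_cases h : (E.act u).1 = i
    · have S := E.step_act h
      have hfin := (E.inv u).pc i
      have hout := fun op' x tag y => D.outcome (op' := op') (x := x) (tag := tag) (y := y)
      have hno : ((E.cfg u).pc i).commit = none → ¬ E.Commits i u := fun h h' => h'.2 h
      have hyes : ((E.cfg u).pc i).commit ≠ none → E.Commits i u := fun h' => ⟨h, h'⟩
      have hne := D'.2.2 (u + 1) (h1.trans (Nat.lt_succ_self u)) le_rfl
      generalize (E.act u).2 = a at *
      generalize (E.cfg u).pc i = p at *
      generalize (E.cfg (u + 1)).pc i = p' at *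
      have nul : ∀ {op' x tag}, p = .located op' x tag none → ∃ s, j < s ∧ s ≤ u + 1 ∧ op' = op ∧
          E.abs s op.key = none := by
        intro op' x tag h
        obtain ⟨h1, -, -, -, s, h2, h3, h4, -⟩ := hout _ _ _ _ h
        exact ⟨s, h2, h3.trans hs, h1, abs_of_null h4⟩
      cases S
      case conNull =>
        obtain ⟨s, h1, h2, rfl, h4⟩ := nul rfl
        exact .inr ⟨ih.succ (hno rfl), s, h1, h2, by simp only [Op.key] at h4; simp [specStep, h4]⟩
      case delNull =>
        obtain ⟨s, h1, h2, rfl, h4⟩ := nul rfl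
        exact .inr ⟨ih.succ (hno rfl), s, h1, h2, by simp only [Op.key] at h4; simp [specStep, h4]⟩
      case insFound =>
        obtain ⟨rfl, -, -, -, s, h2, h3, h4, h5⟩ := hout _ _ _ _ rfl
        have h6 := abs_of_std h4 (h5 _ rfl)
        exact .inr ⟨ih.succ (hno rfl), s, h2, h3.trans hs,
          by simp only [Op.key] at h6; simp [specStep, h6]⟩
      case conFound =>
        obtain ⟨rfl, -, -, -, s, h2, h3, h4, h5⟩ := hout _ _ _ _ rfl
        exact ⟨ih.succ (hno rfl), _, s, rfl, h2, h3.trans hs, h4, h5 _ rfl⟩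
      case conData =>
        obtain ⟨h1, k, s, rfl, h2, h3, h4, h5⟩ := ih
        have h6 := abs_of_std h4 h5
        rw [← E.data_eq h3 ((E.inv s).tree_lt _ (StdN.inTree (stdReach_iff.1 h4)))] at h6
        exact .inr ⟨h1.succ (hno rfl), s, h2, h3.trans hs, by simp only [specStep, h6]; rfl⟩
      case finishDone =>
        exact .inl ⟨ih.succ (hno rfl), hfin⟩
      case ret => exact absurd rfl hne
      all_goals first
        | exact NoEffect.succ ih (hno rfl)
        | exact OneEffect.succ ih (hno rfl)
        | exact NoEffect.commit ih h1 (hyes nofun)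
    · rw [pc_other h]
      have hno : ¬ E.Commits i u := fun h' => h h'.1
      generalize (E.cfg u).pc i = p at *
      cases p <;> try first | exact NoEffect.succ ih hno | exact OneEffect.succ ih hno
      case conData =>
        obtain ⟨h1, k, s, h2, h3, h4, h5⟩ := ih
        exact ⟨h1.succ hno, k, s, h2, h3, h4.trans hs, h5⟩
      case ret =>
        refine ih.imp (fun h => ⟨h.1.succ hno, h.2⟩) ?_
        rintro ⟨h1, s, h2, h3, h4⟩
        exact ⟨h1.succ hno, s, h2, h3.trans hs, h4⟩

/-! ### Operations in progress -/

theorem Returns.during (H : E.Returns j r v) :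
    ∃ i op, E.During i op j r ∧ (E.cfg r).pc i = .ret v ∧ (E.cfg (r + 1)).pc i = .idle := by
  obtain ⟨i, op, h1, h2, h3, h4⟩ := H
  refine ⟨i, op, ⟨h1, h2, fun s h5 h6 => ?_⟩, ?_⟩
  · induction s, (Nat.succ_le_of_lt h5) using Nat.le_induction with
    | base =>
      rw [(During.start ⟨h1, Nat.lt_succ_self j, fun s h7 h8 => ?_⟩ : _ = PC.locStart op)]
      · exact nofun
      · obtain rfl : s = j + 1 := le_antisymm h8 h7
        have S := E.step_act (i := i) (s := j) (by rw [h1])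
        rw [h1] at S
        generalize (E.cfg (j + 1)).pc i = p' at *
        generalize (E.cfg j).pc i = p at *
        cases S
        exact nofun
    | succ s hs ih =>
      have ih := ih hs ((Nat.le_succ s).trans h6)
      by_cases h : (E.act s).1 = i
      · intro hcon
        have S := E.step_act h
        rw [hcon] at S
        rcases S.idle with h7 | ⟨v', h7, -⟩
        · exact ih h7
        · exact h4 s v' hs h6 (Prod.ext h h7)
      · rwa [pc_other h]
  · have S := E.step_act (i := i) (s := r) (by rw [h3])
    rw [h3] at S
    generalize (E.cfg (r + 1)).pc i = p' at *
    generalize (E.cfg r).pc i = p at *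
    cases S
    exact ⟨rfl, rfl⟩

theorem exists_during (h : (E.cfg s).pc i ≠ .idle) : ∃ op j, E.During i op j s := by
  induction s with
  | zero => rw [E.init] at h; exact absurd rfl h
  | succ s ih =>
    have ext : ∀ {op j}, E.During i op j s → E.During i op j (s + 1) := by
      rintro op j ⟨h1, h2, h3⟩
      refine ⟨h1, h2.trans (Nat.lt_succ_self s), fun t h4 h5 => ?_⟩
      rcases Nat.lt_succ_iff_lt_or_eq.1 (Nat.lt_succ_of_le h5) with h6 | rfl
      · exact h3 t h4 (Nat.lt_succ_iff.1 h6)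
      · exact h
    by_cases h0 : (E.cfg s).pc i = .idle
    · have ha : (E.act s).1 = i := by
        by_contra hcon
        exact h (by rw [pc_other hcon, h0])
      have S := E.step_act ha
      rw [h0] at S
      have : ∃ op, (E.act s).2 = .invoke op := by
        generalize (E.act s).2 = a at *
        generalize (E.cfg (s + 1)).pc i = p' at *
        cases S
        · exact absurd rfl h
        · exact ⟨_, rfl⟩
      obtain ⟨op, hop⟩ := this
      refine ⟨op, s, Prod.ext ha hop, Nat.lt_succ_self s, fun t h4 h5 => ?_⟩
      obtain rfl : t = s + 1 := le_antisymm h5 h4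
      exact h
    · obtain ⟨op, j, H⟩ := ih h0
      exact ⟨op, j, ext H⟩

theorem During.invoked_idle (H : E.During i op j s) : (E.cfg j).pc i = .idle := by
  have S := E.step_act (i := i) (s := j) (by rw [H.1])
  rw [H.1] at S
  generalize (E.cfg (j + 1)).pc i = p' at *
  generalize (E.cfg j).pc i = p at *
  cases S
  rfl

theorem During.unique {op' : Op} {j' : ℕ} (H : E.During i op j s) (H' : E.During i op' j' s) :
    j = j' := by
  rcases lt_trichotomy j j' with h | h | h
  · exact absurd H'.invoked_idle (H.2.2 j' h H'.2.1.le)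
  · exact h
  · exact absurd H.invoked_idle (H'.2.2 j h H.2.1.le)

theorem During.mono (H : E.During i op j s) (h : j < u) (h' : u ≤ s) : E.During i op j u :=
  ⟨H.1, h, fun t h1 h2 => H.2.2 t h1 (h2.trans h')⟩

variable (E) in
/-- The operation invoked at time `j` takes effect by the step at time `s`. -/
def TakesEffect (j s : ℕ) : Prop := ∃ i op, E.During i op j s ∧ E.Commits i s

theorem effect_none {p : PC} (h : p.commit ≠ none) (H : E.Effect i op j s p) :
    E.NoEffect i j s := by
  cases p <;> first | exact H | exact absurd rfl h

theorem During.inj {i' : Tid} {op' : Op} (H : E.During i op j s) (H' : E.During i' op' j u) :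
    i = i' ∧ op = op' := by
  have := H.1.symm.trans H'.1
  simp only [Prod.mk.injEq, Act.invoke.injEq] at this
  exact this

theorem TakesEffect.unique (H : E.TakesEffect j s) (H' : E.TakesEffect j u) : s = u := by
  have key : ∀ {s u}, E.TakesEffect j s → E.TakesEffect j u → ¬ s < u := by
    rintro s u ⟨i, op, h1, h2⟩ ⟨i', op', h3, h4⟩ hlt
    obtain ⟨rfl, rfl⟩ := h1.inj h3
    exact effect_none h4.2 h3.effect s h1.2.1 hlt h2
  exact le_antisymm (not_lt.1 (key H' H)) (not_lt.1 (key H H'))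

theorem TakesEffect.inj {j' : ℕ} (H : E.TakesEffect j s) (H' : E.TakesEffect j' s) : j = j' := by
  obtain ⟨i, op, h1, h2⟩ := H
  obtain ⟨i', op', h3, h4⟩ := H'
  obtain rfl : i = i' := h2.1.symm.trans h4.1
  exact h1.unique h3

/-- An operation that took effect returns true afterwards. -/
theorem TakesEffect.returns (H : E.TakesEffect j s) (H' : E.Returns j r v) :
    s < r ∧ v = .bool true := by
  obtain ⟨i, op, h1, h2⟩ := H
  obtain ⟨i', op', h3, h4, h5⟩ := H'.during
  obtain ⟨rfl, rfl⟩ := h1.inj h3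
  have hlt : s < r := by
    rcases lt_trichotomy s r with h | rfl | h
    · exact h
    · exact absurd (by rw [h4]; rfl) h2.2
    · exact absurd h5 (h1.2.2 (r + 1) (h3.2.1.trans (Nat.lt_succ_self r)) h)
  refine ⟨hlt, ?_⟩
  have := h3.effect
  rw [h4] at this
  rcases this with h | ⟨h, -⟩
  · exact h.2
  · exact absurd h2 (h s h1.2.1 hlt)
end Execution

/-! ### Linearizability -/

theorem legal_append {m m' m'' : ℕ → Option ℕ} {l l' : List (Op × Res)} (h : Legal m l m')
    (h' : Legal m' l' m'') : Legal m (l ++ l') m'' := by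
  induction l generalizing m with
  | nil =>
    obtain rfl : m' = m := h
    exact h'
  | cons e l ih => exact ⟨h.1, ih h.2⟩

theorem legal_readOnly {m : ℕ → Option ℕ} {l : List (Op × Res)}
    (h : ∀ e ∈ l, specStep m e.1 = (e.2, m)) : Legal m l m := by
  induction l with
  | nil => rfl
  | cons e l ih =>
    have he := h e (by simp)
    refine ⟨by rw [he], ?_⟩
    rw [he]
    exact ih fun e' h' => h e' (by simp [h'])

theorem legal_flatMap {β : Type} {A : ℕ → ℕ → Option ℕ} {B : ℕ → List β} {f : β → Op × Res} {n : ℕ}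
    (h : ∀ i < n, Legal (A i) ((B i).map f) (A (i + 1))) :
    Legal (A 0) (((List.range n).flatMap B).map f) (A n) := by
  induction n with
  | zero => rfl
  | succ n ih =>
    rw [List.range_succ, List.flatMap_append, List.map_append, List.flatMap_singleton]
    exact legal_append (ih fun i hi => h i (hi.trans (Nat.lt_succ_self n))) (h n (Nat.lt_succ_self n))

namespace Execution
variable {E : Execution} {i : Tid} {op : Op} {a b s u j n x y k d r N : ℕ} {v : Res}

variable (E) in
/-- The place `τ` of an operation in the linearization of the first `N` steps: `2 * s` stands for
time `s`, and `2 * s + 1` for the step from time `s`. -/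
structure Placed (N j : ℕ) (op : Op) (v : Res) (τ : ℕ) : Prop where
  invoked : ∃ i, E.act j = (i, .invoke op)
  after : 2 * (j + 1) ≤ τ
  bound : τ < 2 * N + 1
  before : ∀ r v', r < N → E.Returns j r v' → v' = v
  returns : ∀ r v', E.Returns j r v' → τ ≤ 2 * r
  effect : (∃ s, τ = 2 * s ∧ specStep (E.abs s) op = (v, E.abs s) ∧
      ∀ s < N, ¬ E.TakesEffect j s) ∨
    ∃ s, τ = 2 * s + 1 ∧ E.TakesEffect j s ∧ specStep (E.abs s) op = (v, E.abs (s + 1))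

theorem Returns.unique {r' : ℕ} {v' : Res} (H : E.Returns j r v) (H' : E.Returns j r' v') :
    r = r' ∧ v = v' := by
  obtain ⟨i, op, h1, h2, h3, h4⟩ := H
  obtain ⟨i', op', h1', h2', h3', h4'⟩ := H'
  have := h1.symm.trans h1'
  simp only [Prod.mk.injEq, Act.invoke.injEq] at this
  obtain ⟨rfl, rfl⟩ := this
  rcases lt_trichotomy r r' with h | rfl | h
  · exact absurd h3 (h4' r v h2 h)
  · exact ⟨rfl, by simpa using h3.symm.trans h3'⟩
  · exact absurd h3' (h4 r' v' h2' h)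

theorem TakesEffect.placed (H : E.TakesEffect j s) (hs : s < N) :
    ∃ op v τ, E.Placed N j op v τ := by
  have H0 := H
  obtain ⟨i, op, h1, rfl, h2⟩ := H
  obtain ⟨op', h3⟩ := Option.ne_none_iff_exists'.1 h2
  obtain rfl := PC.commit_serves h1.serves h3
  have hj := h1.2.1
  exact ⟨op', .bool true, 2 * s + 1, ⟨_, h1.1⟩, by omega, by omega,
    fun r v' _ h => (H0.returns h).2, fun r v' h => by have := (H0.returns h).1; omega,
    .inr ⟨s, rfl, H0, specStep_commit h3⟩⟩

theorem Returns.placed (H : E.Returns j r v) (hr : r < N) : ∃ op v τ, E.Placed N j op v τ := by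
  by_cases hc : ∃ s < N, E.TakesEffect j s
  · obtain ⟨s, hs, h⟩ := hc
    exact h.placed hs
  · push Not at hc
    obtain ⟨i, op, h1, h2, -⟩ := H.during
    have := h1.effect
    rw [h2] at this
    rcases this with ⟨⟨s, h3, h4, h5, -⟩, -⟩ | ⟨-, s, h3, h4, h5⟩
    · exact absurd ⟨i, op, h1.mono h3 h4.le, h5⟩ (hc s (h4.trans hr))
    · refine ⟨op, v, 2 * s, ⟨i, h1.1⟩, by omega, by omega, fun r' v' _ h => (h.unique H).2,
        fun r' v' h => ?_, .inl ⟨s, rfl, h5, hc⟩⟩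
      rw [(h.unique H).1]
      omega

open Classical in
/-- The operations, in the order of their places, are a linearization: those that take effect by a
step are placed at this step, and the others at a time when their result agrees with the abstract
map. -/
theorem linearizable (E : Execution) (N : ℕ) :
    ∃ L, Linearization E N L (E.abs N) := by
  have hex : ∀ j, ∃ op v τ, (∃ op v τ, E.Placed N j op v τ) → E.Placed N j op v τ := by
    intro j
    by_cases h : ∃ op v τ, E.Placed N j op v τ
    · obtain ⟨op, v, τ, h⟩ := h
      exact ⟨op, v, τ, fun _ => h⟩
    · exact ⟨.contains 0, .bool true, 0, fun h' => absurd h' h⟩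
  choose op v τ hpl using hex
  set B : ℕ → List ℕ := fun n =>
    (List.range N).filter (fun j => (∃ op v τ, E.Placed N j op v τ) ∧ τ j = n) with hB
  have mem : ∀ {n j}, j ∈ B n ↔ j < N ∧ E.Placed N j (op j) (v j) (τ j) ∧ τ j = n := by
    intro n j
    simp only [hB, List.mem_filter, List.mem_range, decide_eq_true_eq]
    exact and_congr_right fun _ => and_congr_left fun _ => ⟨hpl j, fun h => ⟨_, _, _, h⟩⟩
  set J := (List.range (2 * N + 1)).flatMap B with hJ
  have memJ : ∀ {j}, j ∈ J ↔ j < N ∧ E.Placed N j (op j) (v j) (τ j) := by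
    intro j
    simp only [hJ, List.mem_flatMap, List.mem_range, mem]
    exact ⟨fun ⟨n, _, h1, h2, _⟩ => ⟨h1, h2⟩, fun ⟨h1, h2⟩ => ⟨τ j, h2.bound, h1, h2, rfl⟩⟩
  have incl : ∀ {j}, (∃ op v τ, E.Placed N j op v τ) → j ∈ J := by
    intro j h
    have := hpl j h
    refine memJ.2 ⟨?_, this⟩
    have h1 := this.after
    have h2 := this.bound
    omega
  have nodupB : ∀ n, (B n).Nodup := fun n => List.Nodup.filter _ List.nodup_range
  have sorted : J.Pairwise (fun j j' => τ j ≤ τ j') := by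
    rw [hJ, List.pairwise_flatMap]
    constructor
    · intro n _
      refine List.pairwise_iff_forall_sublist.2 fun {a b} h => ?_
      have ha := (mem.1 (h.subset (by simp : a ∈ [a, b]))).2.2
      have hb := (mem.1 (h.subset (by simp : b ∈ [a, b]))).2.2
      rw [ha, hb]
    · refine List.pairwise_lt_range.imp fun {m n} h j hj j' hj' => ?_
      rw [(mem.1 hj).2.2, (mem.1 hj').2.2]
      exact h.le
  refine ⟨J.map fun j => (j, op j, v j), ?_, ?_, ?_, ?_, ?_⟩
  · rw [List.map_map]
    change (J.map id).Nodup
    rw [List.map_id, hJ, List.nodup_flatMap]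
    refine ⟨fun n _ => nodupB n, List.nodup_range.imp fun {m n} h j hj hj' => ?_⟩
    exact h ((mem.1 hj).2.2.symm.trans (mem.1 hj').2.2)
  · intro e he
    obtain ⟨j, hj, rfl⟩ := List.mem_map.1 he
    obtain ⟨h1, h2⟩ := memJ.1 hj
    exact ⟨h1, h2.invoked⟩
  · intro j r v' hr h
    have hj := incl (h.placed hr)
    refine ⟨op j, List.mem_map.2 ⟨j, hj, ?_⟩⟩
    rw [(memJ.1 hj).2.before r v' hr h]
  · rw [List.pairwise_map]
    refine (List.Pairwise.and_mem.1 sorted).imp ?_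
    rintro j j' ⟨hj, hj', hle⟩ ⟨r, v', h, hlt⟩
    have h1 := (memJ.1 hj).2.after
    have h2 := (memJ.1 hj').2.returns r v' h
    change r < j at hlt
    omega
  · rw [List.map_map]
    have h0 : E.abs ((0 + 0) / 2) = fun _ => none := abs_zero
    have hN : E.abs (2 * N / 2) = E.abs N := by rw [Nat.mul_div_cancel_left _ two_pos]
    have := legal_flatMap (A := fun n => E.abs (n / 2)) (B := B)
      (f := Prod.snd ∘ fun j => (j, op j, v j)) (n := 2 * N + 1) ?_
    · have h1 : (2 * N + 1) / 2 = N := by omega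
      simp only [h1, Nat.zero_div, abs_zero] at this
      exact this
    · intro n hn
      rcases Nat.even_or_odd' n with ⟨s, rfl | rfl⟩
      · have h1 : 2 * s / 2 = s := by omega
        have h2 : (2 * s + 1) / 2 = s := by omega
        simp only [h1, h2]
        refine legal_readOnly fun e he => ?_
        obtain ⟨j, hj, rfl⟩ := List.mem_map.1 he
        obtain ⟨-, hj, hτ⟩ := mem.1 hj
        rcases hj.effect with ⟨s', h3, h4, -⟩ | ⟨s', h3, -⟩
        · obtain rfl : s' = s := by omega
          exact h4
        · omega
      · have h1 : (2 * s + 1) / 2 = s := by omega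
        have h2 : (2 * s + 1 + 1) / 2 = s + 1 := by omega
        simp only [h1, h2]
        have hsN : s < N := by omega
        have te : ∀ {j}, j ∈ B (2 * s + 1) →
            E.TakesEffect j s ∧ specStep (E.abs s) (op j) = (v j, E.abs (s + 1)) := by
          intro j hj
          obtain ⟨-, hj, hτ⟩ := mem.1 hj
          rcases hj.effect with ⟨s', h3, h4, -⟩ | ⟨s', h3, h4⟩
          · omega
          · obtain rfl : s' = s := by omega
            exact h4
        by_cases hc : E.Commits (E.act s).1 s
        · obtain ⟨op', j, hD⟩ := E.exists_during (i := (E.act s).1) (s := s)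
            fun h => hc.2 (by rw [h]; rfl)
          have hT : E.TakesEffect j s := ⟨_, _, hD, hc⟩
          have hj : j ∈ B (2 * s + 1) := by
            obtain ⟨h3, h4⟩ := memJ.1 (incl (hT.placed hsN))
            refine mem.2 ⟨h3, h4, ?_⟩
            rcases h4.effect with ⟨s', -, -, h5⟩ | ⟨s', h5, h6, -⟩
            · exact absurd hT (h5 s hsN)
            · rw [h5, h6.unique hT]
          have hsing : B (2 * s + 1) = [j] := by
            refine List.perm_singleton.1 ((List.perm_ext_iff_of_nodup (nodupB _)
              (List.nodup_singleton j)).2 fun j' => ?_)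
            rw [List.mem_singleton]
            exact ⟨fun h => (te h).1.inj hT, fun h => h ▸ hj⟩
          rw [hsing]
          have := (te hj).2
          exact ⟨by simp [this], by simp [this, Legal]⟩
        · have : B (2 * s + 1) = [] := by
            refine List.eq_nil_iff_forall_not_mem.2 fun j hj => ?_
            obtain ⟨i, _, h3, h4⟩ := (te hj).1
            exact hc (h4.1.symm ▸ h4)
          rw [this]
          exact abs_succ hc
end Execution

/-! ### Simulation of runs -/

/-- The order of keys, as a comparison that the kernel evaluates quickly: instances derived from
`WithTop ℤ` do not reduce well. -/
def keyLt : Key → Key → Bool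
  | some a, some b => decide (a < b)
  | some _, none => true
  | none, _ => false

theorem keyLt_iff {a b : Key} : keyLt a b = true ↔ a < b := by
  rcases a with _ | a
  · exact iff_of_false nofun not_top_lt
  · rcases b with _ | b
    · exact iff_of_true rfl (WithTop.coe_lt_top a)
    · exact decide_eq_true_iff.trans WithTop.coe_lt_coe.symm

/-- The next step of thread `i`, when it runs the operation `op` and finally unlocks `o`. Restarts,
bypassing, and what follows the linking of a copy are left out. -/
def PC.move (s : Shared) (i : Tid) (op : Op) (o : ℕ) : PC → Option (Act × PC)
  | .idle => some (.invoke op, .locStart op)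
  | .locStart op => some (.rcuLock, .locTest op rootId (some rootId))
  | .locTest op x none => some (.tau, .locTag op x none)
  | .locTest op x (some y) =>
    if keyLt (s.heap y).key (userKey op.key) then some (.read ⟨some y, .key⟩, .locRight op y)
    else if keyLt (userKey op.key) (s.heap y).key then some (.read ⟨some y, .key⟩, .locLeft op y)
    else some (.read ⟨some y, .key⟩, .locTag op x (some y))
  | .locRight op x => some (.read ⟨some x, .right⟩, .locTest op x (s.heap x).right)
  | .locLeft op x => some (.read ⟨some x, .left⟩, .locTest op x (s.heap x).left)
  | .locTag op x y => some (.read ⟨some x, .tag⟩, .locUnlock op x (s.heap x).tag y)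
  | .locUnlock op x tag y => some (.rcuUnlock, .located op x tag y)
  | .located (.insert k d) x tag none => some (.tau, .insLock k d x tag)
  | .located (.delete k) x _ (some y) => some (.tau, .delLockX k x y)
  | .insLock k d x tag =>
    if s.lock x = none ∨ s.lock x = some i then some (.lock x, .insRem k d x tag) else none
  | .insRem k d x tag =>
    if (s.heap x).rem = false then some (.read ⟨some x, .rem⟩, .insKey k d x tag) else none
  | .insKey k d x tag =>
    if keyLt (userKey k) (s.heap x).key then some (.read ⟨some x, .key⟩, .insLeft k d x tag)
    else if keyLt (s.heap x).key (userKey k) then some (.read ⟨some x, .key⟩, .insRight k d x)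
    else none
  | .insLeft k d x tag =>
    if (s.heap x).left = none then some (.read ⟨some x, .left⟩, .insTag k d x tag) else none
  | .insTag k d x tag =>
    if (s.heap x).tag = tag then some (.read ⟨some x, .tag⟩, .insNewLeft k d x) else none
  | .insNewLeft k d x =>
    some (.alloc s.next ⟨userKey k, d, none, none, 0, false⟩, .insWriteLeft k d x s.next)
  | .insWriteLeft _ _ x n =>
    some (.write ⟨some x, .left⟩ (.ref (some n)) .skip, .finish (.bool true))
  | .insRight k d x =>
    if (s.heap x).right = none then some (.read ⟨some x, .right⟩, .insNewRight k d x) else none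
  | .insNewRight k d x =>
    some (.alloc s.next ⟨userKey k, d, none, none, 0, false⟩, .insWriteRight k d x s.next)
  | .insWriteRight _ _ x n =>
    some (.write ⟨some x, .right⟩ (.ref (some n)) .skip, .finish (.bool true))
  | .finish r => if s.lock o = some i then some (.unlock o, .finish r) else none
  | .delLockX k x y =>
    if s.lock x = none ∨ s.lock x = some i then some (.lock x, .delLockY k x y) else none
  | .delLockY k x y =>
    if s.lock y = none ∨ s.lock y = some i then some (.lock y, .delRemY k x y) else none
  | .delRemY k x y =>
    if (s.heap y).rem = false then some (.read ⟨some y, .rem⟩, .delRemX k x y) else none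
  | .delRemX k x y =>
    if (s.heap x).rem = false then some (.read ⟨some x, .rem⟩, .delParLeft k x y) else none
  | .delParLeft k x y =>
    if (s.heap x).left = some y then some (.read ⟨some x, .left⟩, .delLeft k x y) else none
  | .delLeft k x y => some (.read ⟨some y, .left⟩, .delRight k x y (s.heap y).left)
  | .delRight k x y (some _) =>
    if (s.heap y).right ≠ none then some (.read ⟨some y, .right⟩, .sucRight k x y) else none
  | .sucRight k x y =>
    match (s.heap y).right with
    | some cs => some (.read ⟨some y, .right⟩, .sucLeft k x y y cs)
    | none => none
  | .sucLeft k x y ps cs =>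
    match (s.heap cs).left with
    | none => some (.read ⟨some cs, .left⟩, .sucLockPs k x y ps cs)
    | some nx => some (.read ⟨some cs, .left⟩, .sucLeft k x y cs nx)
  | .sucLockPs k x y ps cs =>
    if s.lock ps = none ∨ s.lock ps = some i then some (.lock ps, .sucLockCs k x y ps cs) else none
  | .sucLockCs k x y ps cs =>
    if s.lock cs = none ∨ s.lock cs = some i then some (.lock cs, .sucRemPs k x y ps cs) else none
  | .sucRemPs k x y ps cs =>
    if (s.heap ps).rem = false then some (.read ⟨some ps, .rem⟩, .sucRemCs k x y ps cs) else none
  | .sucRemCs k x y ps cs =>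
    if (s.heap cs).rem = false then some (.read ⟨some cs, .rem⟩, .sucPar k x y ps cs) else none
  | .sucPar k x y ps cs =>
    if ps = y then some (.tau, .sucNull k x y ps cs)
    else if (s.heap ps).left = some cs then some (.read ⟨some ps, .left⟩, .sucNull k x y ps cs)
    else none
  | .sucNull k x y ps cs =>
    if (s.heap cs).left = none then some (.read ⟨some cs, .left⟩, .dupKey k x y ps cs) else none
  | .dupKey k x y ps cs => some (.read ⟨some cs, .key⟩, .dupData k x y ps cs (s.heap cs).key)
  | .dupData k x y ps cs m => some (.read ⟨some cs, .data⟩, .dupNew k x y ps cs m (s.heap cs).data)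
  | .dupNew k x y ps cs m d =>
    some (.alloc s.next { s.heap y with key := m, data := d }, .dupMark k x y ps cs s.next)
  | .dupMark k x y ps cs w =>
    some (.write ⟨some y, .rem⟩ (.rem true) .skip, .dupLock k x y ps cs w)
  | .dupLock k x y ps cs w =>
    if s.lock w = none ∨ s.lock w = some i then some (.lock w, .linkCmp k x y ps cs w) else none
  | .linkCmp k x y ps cs w =>
    if keyLt (userKey k) (s.heap x).key then some (.read ⟨some x, .key⟩, .linkLeft k x y ps cs w)
    else none
  | .linkLeft k x y ps cs w =>
    some (.write ⟨some x, .left⟩ (.ref (some w)) (.open w (userKey k)), .syncCall k y ps cs w)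
  | _ => none

theorem PC.move_sound {s : Shared} {i : Tid} {op : Op} {o : ℕ} {p p' : PC} {a : Act}
    (h : p.move s i op o = some (a, p')) : LStep s i p a p' := by
  unfold PC.move at h
  split at h
  all_goals try split at h
  all_goals try split at h
  all_goals simp only [Option.some.injEq, Prod.mk.injEq, reduceCtorEq] at h
  all_goals obtain ⟨rfl, rfl⟩ := h
  all_goals try simp only [keyLt_iff] at *
  all_goals subst_vars
  case h_4.isFalse.isFalse h1 h2 => exact .locFound (le_antisymm (not_lt.1 h2) (not_lt.1 h1))
  all_goals constructor
  all_goals first | assumption | rfl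

/-- The standard search path for the key 2 from `x`, of length at most `n`, avoids the node `q`. -/
def avoids (h : Heap) (q : ℕ) : ℕ → ℕ → Bool
  | 0, _ => false
  | n + 1, x => x != q &&
    if keyLt (h x).key (userKey 2) then
      match (h x).right with
      | none => true
      | some z => avoids h q n z
    else if keyLt (userKey 2) (h x).key then
      match (h x).left with
      | none => true
      | some z => avoids h q n z
    else true

theorem avoids_sound {h : Heap} {q : ℕ} : ∀ {n x z : ℕ}, avoids h q n x = true →
    Rch h (SDir h (userKey 2)) x z → z ≠ q
  | 0, _, _, H, _ => nomatch H
  | n + 1, x, z, H, hz => by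
    unfold avoids at H
    rw [Bool.and_eq_true] at H
    obtain ⟨H1, H⟩ := H
    rcases ReflTransGen.cases_head hz with rfl | ⟨b, ⟨d, hd, e⟩, hb⟩
    · simpa using H1
    · cases d
      · have hd : userKey 2 < (h x).key := hd
        have e : (h x).left = some b := e
        simp only [keyLt_iff, not_lt.2 hd.le, hd, if_true, if_false, e] at H
        exact avoids_sound H hb
      · have hd : (h x).key < userKey 2 := hd
        have e : (h x).right = some b := e
        simp only [keyLt_iff, hd, if_true, e] at H
        exact avoids_sound H hb

/-- A task `(i, op, o, n)`: thread `i`, which is idle, makes the first `n` steps of the operation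
`op`, and unlocks `o` when it is finishing. -/
abbrev Task := Tid × Op × ℕ × ℕ

/-- The shared state after `n` steps of thread `i` from the control point `p`, provided that before
each of them the search for the key 2 avoids node 10. -/
def drive (i : Tid) (op : Op) (o : ℕ) : ℕ → PC → Shared → Option Shared
  | 0, _, s => some s
  | n + 1, p, s =>
    if avoids s.heap 10 8 rootId then
      match p.move s i op o with
      | some (a, p') => drive i op o n p' (applyAct i s a)
      | none => none
    else none

/-- The shared state after the given tasks, one after another. -/
def driveAll : List Task → Shared → Option Shared
  | [], s => some s
  | (i, op, o, n) :: l, s => (drive i op o n .idle s).bind (driveAll l)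

/-! ### Finite runs -/

/-- A step with the configurations before and after it. -/
structure Event where
  pre : Config
  tid : Tid
  act : Act
  post : Config

/-- `Run c L c'`: the steps in the list `L` lead from `c` to `c'`. -/
inductive Run : Config → List Event → Config → Prop
  | nil {c} : Run c [] c
  | cons {c c' c'' i a L} : IsStep i a c c' → Run c' L c'' → Run c (⟨c, i, a, c'⟩ :: L) c''

theorem Run.append {c c' c'' : Config} {L L' : List Event} (R : Run c L c') (R' : Run c' L' c'') :
    Run c (L ++ L') c'' := by
  induction R with
  | nil => exact R'
  | cons S _ ih => exact .cons S (ih R')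

/-- A run after which thread 0 is idle is a prefix of an execution, in which this thread stutters.
-/
theorem Run.exists_execution {c : Config} {L : List Event} (R : Run initConfig L c)
    (h0 : c.pc 0 = .idle) : ∃ E : Execution, ∀ t e, L[t]? = some e →
      E.cfg t = e.pre ∧ E.act t = (e.tid, e.act) ∧ E.cfg (t + 1) = e.post := by
  have key : ∀ {c0 c : Config} {L : List Event}, Run c0 L c → c.pc 0 = .idle →
      ∃ (cfg : ℕ → Config) (act : ℕ → Tid × Act), cfg 0 = c0 ∧
      (∀ t, IsStep (act t).1 (act t).2 (cfg t) (cfg (t + 1))) ∧ ∀ t e, L[t]? = some e →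
        cfg t = e.pre ∧ act t = (e.tid, e.act) ∧ cfg (t + 1) = e.post := by
    intro c0 c L R h0
    induction R with
    | @nil c =>
      refine ⟨fun _ => c, fun _ => (0, .tau), rfl, fun _ => ⟨?_, fun _ _ => rfl, rfl⟩, by simp⟩
      change LStep c.shared 0 (c.pc 0) .tau (c.pc 0)
      rw [h0]
      exact .stutter
    | @cons c c' c'' i a L S _ ih =>
      obtain ⟨cfg, act, h1, h2, h3⟩ := ih h0
      refine ⟨fun t => t.casesOn c cfg, fun t => t.casesOn (i, a) act, rfl, ?_, ?_⟩
      · rintro (_ | t)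
        · change IsStep i a c (cfg 0)
          rw [h1]
          exact S
        · exact h2 t
      · rintro (_ | t) e he
        · obtain rfl : (⟨c, i, a, c'⟩ : Event) = e := by simpa using he
          exact ⟨rfl, rfl, h1⟩
        · exact h3 t e (by simpa using he)
  obtain ⟨cfg, act, h1, h2, h3⟩ := key R h0
  exact ⟨⟨cfg, act, h1, fun t => (h2 t).local_, fun t => (h2 t).other, fun t => (h2 t).shared⟩, h3⟩

/-- The configuration after a step of thread `i` to the control point `p`. -/
def Config.next (c : Config) (i : Tid) (a : Act) (p : PC) : Config :=
  ⟨applyAct i c.shared a, Function.update c.pc i p⟩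

theorem Config.next_pc (c : Config) (i : Tid) (a : Act) (p : PC) : (c.next i a p).pc i = p :=
  Function.update_self ..

theorem Config.isStep_next {c : Config} {i : Tid} {a : Act} {p : PC}
    (S : LStep c.shared i (c.pc i) a p) : IsStep i a c (c.next i a p) :=
  ⟨by rw [c.next_pc]; exact S, fun _ hj => Function.update_of_ne hj _ _, rfl⟩

/-- The simulation is sound: it describes a run in which the search for the key 2 avoids node 10
before every step. -/
theorem drive_run {i : Tid} {op : Op} {o : ℕ} : ∀ {n : ℕ} {c : Config} {s : Shared},
    drive i op o n (c.pc i) c.shared = some s →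
    ∃ L c', Run c L c' ∧ c'.shared = s ∧ (∀ j, j ≠ i → c'.pc j = c.pc j) ∧
      ∀ e ∈ L, e.tid = i ∧ avoids e.pre.shared.heap 10 8 rootId = true
  | 0, c, s, H => ⟨[], c, .nil, Option.some_injective _ H, fun _ _ => rfl, by simp⟩
  | n + 1, c, s, H => by
    unfold drive at H
    split at H
    · next hav =>
      split at H
      · next a p' hm =>
        obtain ⟨L, c', h1, h2, h3, h4⟩ := drive_run (c := c.next i a p') (by rwa [c.next_pc])
        refine ⟨_, c', .cons (Config.isStep_next (PC.move_sound hm)) h1, h2, fun j hj => ?_, ?_⟩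
        · rw [h3 j hj]
          exact Function.update_of_ne hj _ _
        · rintro e (_ | ⟨_, he⟩)
          exacts [⟨rfl, hav⟩, h4 e he]
      · exact nomatch H
    · exact nomatch H

theorem driveAll_run : ∀ {l : List Task} {c : Config} {s : Shared}, driveAll l c.shared = some s →
    (∀ x ∈ l, c.pc x.1 = .idle) → (l.map Prod.fst).Nodup →
    ∃ L c', Run c L c' ∧ c'.shared = s ∧ (∀ j, j ∉ l.map Prod.fst → c'.pc j = c.pc j) ∧
      ∀ e ∈ L, e.tid ∈ l.map Prod.fst ∧ avoids e.pre.shared.heap 10 8 rootId = true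
  | [], c, s, H, _, _ => ⟨[], c, .nil, Option.some_injective _ H, fun _ _ => rfl, by simp⟩
  | (i, op, o, n) :: l, c, s, H, hidle, hnd => by
    obtain ⟨s1, H1, H2⟩ := Option.bind_eq_some_iff.1 H
    rw [← hidle (i, op, o, n) (by simp)] at H1
    obtain ⟨L1, c1, h1, h2, h3, h4⟩ := drive_run H1
    subst h2
    rw [List.map_cons, List.nodup_cons] at hnd
    obtain ⟨L2, c2, h5, h6, h7, h8⟩ := driveAll_run H2 (fun x hx => by
      rw [h3 x.1 fun h => hnd.1 (List.mem_map.2 ⟨x, hx, h⟩)]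
      exact hidle x (by simp [hx])) hnd.2
    refine ⟨L1 ++ L2, c2, h1.append h5, h6, fun j hj => ?_, fun e he => ?_⟩
    · rw [List.map_cons, List.mem_cons, not_or] at hj
      rw [h7 j hj.2, h3 j hj.1]
    · rw [List.map_cons]
      rcases List.mem_append.1 he with he | he
      · exact ⟨by simp [h4 e he], (h4 e he).2⟩
      · exact ⟨List.mem_cons_of_mem _ (h8 e he).1, (h8 e he).2⟩

/-! ### A traversal that is not correct for standard reachability -/

/-- Insertions of the keys 1, 0, 7, 5, 6, 4 and 3 into the initial tree. Nodes 0 and 1 are the root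
and the sentinel, and the keys get the nodes 2 to 8 in this order. Thus node 2 (key 1) has the right
child 4 (key 7), whose left child is 5 (key 5), with the children 7 (key 4) and 6 (key 6), and node
8 (key 3) is the left child of 7. -/
def inserts : List Task :=
  [(1, .insert 1 0, 1, 18), (2, .insert 0 0, 2, 20), (3, .insert 7 0, 2, 19),
  (4, .insert 5 0, 4, 22), (5, .insert 6 0, 5, 23), (6, .insert 4 0, 5, 24),
  (7, .insert 3 0, 7, 26)]

/-- The deletions of the keys 1 and 5, up to the moment when their copies are linked: node 9 with
the key 3 for node 2, and node 10 with the key 6 for node 5. -/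
def deletes : List Task := [(9, .delete 1, 0, 35), (10, .delete 5, 0, 36)]

/-- The facts about the states after the insertions and after the deletions on which the steps of
the traversal depend. -/
def scenario : Bool :=
  match driveAll inserts initConfig.shared with
  | none => false
  | some s =>
    avoids s.heap 10 8 rootId &&
    (keyLt (s.heap 0).key (userKey 2) && keyLt (userKey 2) (s.heap 1).key &&
      keyLt (s.heap 2).key (userKey 2)) &&
    (decide ((s.heap 0).right = some 1) && decide ((s.heap 1).left = some 2)) &&
    match driveAll deletes (applyAct 8 s .rcuLock) with
    | none => false
    | some s =>
      avoids s.heap 10 8 rootId && keyLt (userKey 2) (s.heap 4).key &&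
      (decide ((s.heap 2).right = some 4) && decide ((s.heap 4).left = some 10))

set_option maxRecDepth 100000 in
/-- By evaluation in the kernel. -/
theorem scenario_true : scenario = true := by decide +kernel

theorem exists_states : ∃ s s', driveAll inserts initConfig.shared = some s ∧
    driveAll deletes (applyAct 8 s .rcuLock) = some s' ∧
    avoids s.heap 10 8 rootId = true ∧ avoids s'.heap 10 8 rootId = true ∧
    (s.heap 0).key < userKey 2 ∧ userKey 2 < (s.heap 1).key ∧ (s.heap 2).key < userKey 2 ∧
    (s.heap 0).right = some 1 ∧ (s.heap 1).left = some 2 ∧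
    userKey 2 < (s'.heap 4).key ∧ (s'.heap 2).right = some 4 ∧ (s'.heap 4).left = some 10 := by
  have H := scenario_true
  unfold scenario at H
  split at H
  · exact nomatch H
  · next s hs =>
    rw [Bool.and_eq_true] at H
    obtain ⟨H, H'⟩ := H
    split at H'
    · exact nomatch H'
    · next s' hs' =>
      simp only [Bool.and_eq_true, keyLt_iff, decide_eq_true_eq] at H H'
      obtain ⟨⟨h1, ⟨h2, h3⟩, h4⟩, h5, h6⟩ := H
      obtain ⟨⟨h7, h8⟩, h9, h10⟩ := H'
      exact ⟨s, s', hs, hs', h1, h7, h2, h3, h4, h5, h6, h8, h9, h10⟩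

/-- The locations that the traversal visits. -/
def visits : List Loc :=
  [⟨some 0, .key⟩, ⟨some 0, .right⟩, ⟨some 1, .key⟩, ⟨some 1, .left⟩, ⟨some 2, .key⟩,
  ⟨some 2, .right⟩, ⟨some 4, .key⟩, ⟨some 4, .left⟩, ⟨some 10, .key⟩]

/-- A traversal for the key 2 reads the key 1 of node 2 and is about to read its right child. Then
the deletion of 1 replaces this node by a copy with the key 3, so that standard searches for 2 turn
left there from now on, and the deletion of 5 replaces a node in the right subtree by a copy. The
traversal continues in the right subtree and reaches this copy, which was never on the standard
search path for 2. -/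
theorem exists_incorrect : ∃ (E : Execution) (i : Tid) (op : Op) (a n : ℕ) (l : ℕ → Loc)
    (t : ℕ → ℕ), LocateTraversal E i op a n l t ∧
      ∀ base ≤ t 0, ¬ TraversalCorrect (E.Std op.key) base n l t := by
  obtain ⟨s, s', hs, hs', av, av', k0, k1, k2, p0, p1, k4, p2, p4⟩ := exists_states
  set op : Op := .contains 2 with hop
  obtain ⟨L1, c, R1, rfl, f1, g1⟩ := driveAll_run (c := initConfig) hs (fun _ _ => rfl) (by decide)
  -- the traversal starts and reads the key of node 2
  set c1 := c.next 8 (.invoke op) (.locStart op) with hc1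
  set c2 := c1.next 8 .rcuLock (.locTest op 0 (some 0)) with hc2
  set c3 := c2.next 8 (.read ⟨some 0, .key⟩) (.locRight op 0) with hc3
  set c4 := c3.next 8 (.read ⟨some 0, .right⟩) (.locTest op 0 (some 1)) with hc4
  set c5 := c4.next 8 (.read ⟨some 1, .key⟩) (.locLeft op 1) with hc5
  set c6 := c5.next 8 (.read ⟨some 1, .left⟩) (.locTest op 1 (some 2)) with hc6
  set c7 := c6.next 8 (.read ⟨some 2, .key⟩) (.locRight op 2) with hc7
  have hp0 : c.pc 8 = .idle := f1 8 (by decide)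
  have hp1 : c1.pc 8 = .locStart op := Config.next_pc ..
  have hp2 : c2.pc 8 = .locTest op 0 (some 0) := Config.next_pc ..
  have hp3 : c3.pc 8 = .locRight op 0 := Config.next_pc ..
  have hp4 : c4.pc 8 = .locTest op 0 (some 1) := Config.next_pc ..
  have hp5 : c5.pc 8 = .locLeft op 1 := Config.next_pc ..
  have hp6 : c6.pc 8 = .locTest op 1 (some 2) := Config.next_pc ..
  have hp7 : c7.pc 8 = .locRight op 2 := Config.next_pc ..
  have S0 : IsStep 8 _ c c1 := Config.isStep_next (by rw [hp0]; exact .invoke op)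
  have S1 : IsStep 8 _ c1 c2 := Config.isStep_next (by rw [hp1]; exact .locStart)
  have S2 : IsStep 8 _ c2 c3 := Config.isStep_next (by rw [hp2]; exact .locGoRight k0)
  have S3 : IsStep 8 _ c3 c4 := Config.isStep_next (by rw [hp3, ← p0]; exact .locRight)
  have S4 : IsStep 8 _ c4 c5 := Config.isStep_next (by rw [hp4]; exact .locGoLeft k1)
  have S5 : IsStep 8 _ c5 c6 := Config.isStep_next (by rw [hp5, ← p1]; exact .locLeft)
  have S6 : IsStep 8 _ c6 c7 := Config.isStep_next (by rw [hp6]; exact .locGoRight k2)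
  have R2 : Run c _ c7 := .cons S0 (.cons S1 (.cons S2 (.cons S3 (.cons S4 (.cons S5 (.cons S6 .nil))))))
  have hidle : ∀ x ∈ deletes, c7.pc x.1 = .idle := by
    intro x hx
    have h8 : x.1 ≠ 8 := by
      rintro h
      have : 8 ∈ deletes.map Prod.fst := List.mem_map.2 ⟨x, hx, h⟩
      exact absurd this (by decide)
    have h1 : x.1 ∉ inserts.map Prod.fst := by
      have : x.1 ∈ deletes.map Prod.fst := List.mem_map_of_mem hx
      revert this
      generalize x.1 = n
      intro h h'
      fin_cases h <;> exact absurd h' (by decide)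
    have : c7.pc x.1 = c.pc x.1 := by
      simp only [hc1, hc2, hc3, hc4, hc5, hc6, hc7, Config.next, Function.update_of_ne h8]
    rw [this, f1 _ h1]
    rfl
  obtain ⟨L3, c8, R3, rfl, f3, g3⟩ := driveAll_run (c := c7) hs' hidle (by decide)
  -- the traversal continues, and reaches node 10, the copy for node 5
  set c9 := c8.next 8 (.read ⟨some 2, .right⟩) (.locTest op 2 (some 4)) with hc9
  set c10 := c9.next 8 (.read ⟨some 4, .key⟩) (.locLeft op 4) with hc10
  set c11 := c10.next 8 (.read ⟨some 4, .left⟩) (.locTest op 4 (some 10)) with hc11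
  have hp8 : c8.pc 8 = .locRight op 2 := (f3 8 (by decide)).trans hp7
  have hp9 : c9.pc 8 = .locTest op 2 (some 4) := Config.next_pc ..
  have hp10 : c10.pc 8 = .locLeft op 4 := Config.next_pc ..
  have hp11 : c11.pc 8 = .locTest op 4 (some 10) := Config.next_pc ..
  have S8 : IsStep 8 _ c8 c9 := Config.isStep_next (by rw [hp8, ← p2]; exact .locRight)
  have S9 : IsStep 8 _ c9 c10 := Config.isStep_next (by rw [hp9]; exact .locGoLeft k4)
  have S10 : IsStep 8 _ c10 c11 := Config.isStep_next (by rw [hp10, ← p4]; exact .locLeft)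
  have R4 : Run c8 _ c11 := .cons S8 (.cons S9 (.cons S10 .nil))
  obtain ⟨E, hE⟩ := (R1.append (R2.append (R3.append R4))).exists_execution (by
    simp only [hc9, hc10, hc11, Config.next, Function.update_of_ne (show (0 : ℕ) ≠ 8 by decide)]
    rw [f3 0 (by decide)]
    simp only [hc1, hc2, hc3, hc4, hc5, hc6, hc7, Config.next,
      Function.update_of_ne (show (0 : ℕ) ≠ 8 by decide)]
    exact f1 0 (by decide))
  set n1 := L1.length with hn1
  set n3 := L3.length with hn3
  have hL : ∀ {A B : List Event} {m : ℕ} {e : Event}, B[m]? = some e →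
      (A ++ B)[A.length + m]? = some e := by
    intro A B m e h
    rw [List.getElem?_append_right (Nat.le_add_right _ _), Nat.add_sub_cancel_left, h]
  have hR : ∀ {A B : List Event} {m : ℕ} {e : Event}, A[m]? = some e → (A ++ B)[m]? = some e := by
    intro A B m e h
    rw [List.getElem?_append_left (List.getElem?_eq_some_iff.1 h).1, h]
  have E2 := fun m e h => hE (n1 + m) e (hL (hR h))
  have E3 := fun m e h => hE (n1 + (7 + m)) e (hL (hL (A := [_, _, _, _, _, _, _]) (hR h)))
  have E4 := fun m e h => hE (n1 + (7 + (n3 + m))) e (hL (hL (A := [_, _, _, _, _, _, _]) (hL h)))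
  have e0 := E2 1 _ rfl
  have e1 := E2 2 _ rfl
  have e2 := E2 3 _ rfl
  have e3 := E2 4 _ rfl
  have e4 := E2 5 _ rfl
  have e5 := E2 6 _ rfl
  have e6 := E4 0 _ rfl
  have e7 := E4 1 _ rfl
  have e8 := E4 2 _ rfl
  dsimp only at e0 e1 e2 e3 e4 e5 e6 e7 e8
  set t : ℕ → ℕ := fun j => if j < 5 then n1 + (j + 2) else n1 + (7 + (n3 + (j - 5))) with ht
  have avoid : ∀ u ≤ t 7, avoids (E.heap u) 10 8 rootId = true := by
    intro u hu
    have h7 : t 7 = n1 + (7 + (n3 + 2)) := if_neg (by decide)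
    have hu : u < n1 + (7 + (n3 + 3)) := by omega
    rcases Nat.lt_or_ge u n1 with h1 | h1
    · have := hE u _ (hR (List.getElem?_eq_getElem h1))
      rw [Execution.heap, this.1]
      exact (g1 _ (List.getElem_mem h1)).2
    obtain ⟨m, rfl⟩ := Nat.exists_eq_add_of_le h1
    rcases Nat.lt_or_ge m 7 with h2 | h2
    · have := E2 m _ (List.getElem?_eq_getElem h2)
      rw [Execution.heap, this.1]
      interval_cases m <;> exact av
    obtain ⟨m, rfl⟩ := Nat.exists_eq_add_of_le h2
    rcases Nat.lt_or_ge m n3 with h3 | h3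
    · have := E3 m _ (List.getElem?_eq_getElem h3)
      rw [Execution.heap, this.1]
      exact (g3 _ (List.getElem_mem h3)).2
    obtain ⟨m, rfl⟩ := Nat.exists_eq_add_of_le h3
    have h4 : m < 3 := by omega
    have := E4 m _ (List.getElem?_eq_getElem h4)
    rw [Execution.heap, this.1]
    interval_cases m <;> exact av'
  refine ⟨E, 8, op, n1 + 1, 8, fun j => visits.getD j rootLoc, t, ⟨?_, ?_, ?_, ?_, ?_, ?_, ?_, ?_,
    ?_⟩, ?_⟩
  · rw [e0.1, hp1]
  · exact e0.2.1
  · rfl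
  · intro j hj
    simp only [ht]
    split <;> omega
  · intro j j' h1 h2
    simp only [ht]
    split <;> split <;> omega
  · intro j hj
    interval_cases j
    exacts [e1.2.1, e2.2.1, e3.2.1, e4.2.1, e5.2.1, e6.2.1, e7.2.1, e8.2.1]
  · intro j hj
    interval_cases j
    · exact (congrArg (fun c => (c.pc 8).cursor) e1.1).trans (congrArg PC.cursor hp2)
    · exact (congrArg (fun c => (c.pc 8).cursor) e2.1).trans (congrArg PC.cursor hp3)
    · exact (congrArg (fun c => (c.pc 8).cursor) e3.1).trans (congrArg PC.cursor hp4)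
    · exact (congrArg (fun c => (c.pc 8).cursor) e4.1).trans (congrArg PC.cursor hp5)
    · exact (congrArg (fun c => (c.pc 8).cursor) e5.1).trans (congrArg PC.cursor hp6)
    · exact (congrArg (fun c => (c.pc 8).cursor) e6.1).trans (congrArg PC.cursor hp8)
    · exact (congrArg (fun c => (c.pc 8).cursor) e7.1).trans (congrArg PC.cursor hp9)
    · exact (congrArg (fun c => (c.pc 8).cursor) e8.1).trans (congrArg PC.cursor hp10)
  · intro j hj
    interval_cases j
    · exact (congrArg (fun c => (c.pc 8).cursor) e1.2.2).trans (congrArg PC.cursor hp3)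
    · exact (congrArg (fun c => (c.pc 8).cursor) e2.2.2).trans (congrArg PC.cursor hp4)
    · exact (congrArg (fun c => (c.pc 8).cursor) e3.2.2).trans (congrArg PC.cursor hp5)
    · exact (congrArg (fun c => (c.pc 8).cursor) e4.2.2).trans (congrArg PC.cursor hp6)
    · exact (congrArg (fun c => (c.pc 8).cursor) e5.2.2).trans (congrArg PC.cursor hp7)
    · exact (congrArg (fun c => (c.pc 8).cursor) e6.2.2).trans (congrArg PC.cursor hp9)
    · exact (congrArg (fun c => (c.pc 8).cursor) e7.2.2).trans (congrArg PC.cursor hp10)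
    · exact (congrArg (fun c => (c.pc 8).cursor) e8.2.2).trans (congrArg PC.cursor hp11)
  · rintro u hu ⟨j, hj, hju⟩ h8
    have hju : u < n1 + (7 + (n3 + 3)) := by
      simp only [ht] at hju
      split at hju <;> omega
    rcases Nat.lt_or_ge u (n1 + 7) with h1 | h1
    · refine ⟨u - (n1 + 2), by omega, ?_⟩
      simp only [ht]
      split <;> omega
    rcases Nat.lt_or_ge u (n1 + (7 + n3)) with h2 | h2
    · exfalso
      have h3 : u - (n1 + 7) < n3 := by omega
      have := E3 (u - (n1 + 7)) _ (List.getElem?_eq_getElem h3)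
      rw [show n1 + (7 + (u - (n1 + 7))) = u by omega] at this
      rw [this.2.1] at h8
      have h9 := (g3 _ (List.getElem_mem h3)).1
      rw [show (L3[u - (n1 + 7)]).tid = 8 from h8] at h9
      exact absurd h9 (by decide)
    · refine ⟨u - (n1 + (7 + n3)) + 5, by omega, ?_⟩
      simp only [ht]
      split <;> omega
  · rintro base - ⟨-, H⟩
    obtain ⟨u, -, hu, h⟩ := H 7 (by decide)
    exact avoids_sound (avoid u hu) (stdReach_iff.1 h) rfl

end Citrus

open Citrus in
theorem mainTheorem5 :
    -- locate is not correct for standard reachability, whatever the base time is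
    (∃ (E : Execution) (i : Tid) (op : Op) (a n : ℕ) (l : ℕ → Loc) (t : ℕ → ℕ),
      LocateTraversal E i op a n l t ∧
      ∀ base ≤ t 0, ¬ TraversalCorrect (E.Std op.key) base n l t) ∧
    ∀ E : Execution,
      -- weak reachability is implied by standard reachability, single-step compatible, and all the
      -- writes during a traversal are strong forepassed, also for the tag of a node
      (∀ (i : Tid) (a b k : ℕ), E.InSection i a b →
        (∀ s, a < s → s ≤ b →
          (∀ l, E.Std k s l → E.Weak i k s l) ∧
          SingleStepCompatible (Extend (userKey k)) (E.heap s).val (E.Weak i k s)) ∧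
        (∀ s, a < s → s < b →
          StrongForepassed E.writes (E.Weak i k) b s ∧
          ∀ x : ℕ, ForepassedField E.writes (E.Weak i k) b s ⟨some x, .key⟩ ⟨some x, .tag⟩)) ∧
      -- every invocation of locate is a traversal, correct for weak reachability
      (∀ (i : Tid) (op : Op) (a n : ℕ) (l : ℕ → Loc) (t : ℕ → ℕ),
        LocateTraversal E i op a n l t →
        IsTraversal (Extend (userKey op.key)) (fun s => (E.heap s).val) n l t ∧
        ∀ base, a < base → (∀ j < n, base ≤ t j) →
          TraversalCorrect (E.Weak i op.key) base n l t) ∧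
      -- the keys between the ghost key and the key of a node are absent from its right subtree,
      -- which still contains another node with the same key
      (∀ (i : Tid) (a b x : ℕ), E.InSection i a b →
        (E.cfg b).shared.ghost i x ≠ (E.heap b x).key →
        (∀ z, InSubtree (E.heap b) (E.heap b x).right z →
          ¬ ((E.cfg b).shared.ghost i x < (E.heap b z).key ∧
            (E.heap b z).key < (E.heap b x).key)) ∧
        ∃ y, y ≠ x ∧ (E.heap b y).key = (E.heap b x).key ∧
          StdPath (E.heap b) (E.heap b x).key ⟨some x, .right⟩ ⟨some y, .key⟩) ∧
      -- a weak search path deviates from a standard one in at most one node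
      (∀ (i : Tid) (a b k : ℕ) (x : Ptr), E.InSection i a b → x ≠ some rootId →
        E.Weak i k b ⟨x, .key⟩ →
        ∃ l l', E.Std k b l ∧
          WeakLink (E.heap b) ((E.cfg b).shared.ghost i) (userKey k) l l' ∧
          StdPath (E.heap b) (userKey k) l' ⟨x, .key⟩) ∧
      -- endpoints (null, or a node with the key) of weak paths were standardly reachable
      (∀ (i : Tid) (a b k : ℕ), E.InSection i a b →
        (E.Weak i k b ⟨none, .key⟩ → ∃ s, a < s ∧ s ≤ b ∧ E.Std k s ⟨none, .key⟩) ∧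
        ∀ x : ℕ, E.Weak i k b ⟨some x, .key⟩ → (E.heap b x).key = userKey k →
          ∃ s, a < s ∧ s ≤ b ∧ E.Std k s ⟨some x, .key⟩ ∧ (E.heap s x).key = userKey k) ∧
      -- the outcome of locate
      (∀ (i : Tid) (op : Op) (j u x tag : ℕ) (y : Ptr), E.During i op j u →
        (E.cfg u).pc i = .located op x tag y →
        (∃ a b, j < a ∧ b < u ∧ E.InSection i a b ∧
          (∃ s, a < s ∧ s ≤ b ∧ E.Weak i op.key s ⟨some x, .key⟩ ∧ (E.heap s x).tag = tag) ∧
          (∃ s, a < s ∧ s ≤ b ∧ E.Weak i op.key s ⟨y, .key⟩)) ∧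
        (E.heap u x).key ≠ userKey op.key ∧
        (∀ z, y = some z → (E.heap u z).key = userKey op.key) ∧
        ∃ s, j < s ∧ s ≤ u ∧ E.Std op.key s ⟨y, .key⟩ ∧
          ∀ z, y = some z → (E.heap s z).key = userKey op.key) ∧
      -- present reachability of a node with a null left child and an unchanged tag
      (∀ (i : Tid) (a b k x v u : ℕ), E.InSection i a b → b ≤ u →
        E.Weak i k b ⟨some x, .key⟩ → (E.heap b x).tag = v →
        (E.heap u x).left = none → (E.heap u x).tag = v → (E.heap u x).rem = false →
        (E.cfg u).shared.lock x = none →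
        E.Std k u ⟨some x, .key⟩) ∧
      -- present reachability of right fields
      (∀ (i : Tid) (a b k x u : ℕ), E.InSection i a b → b ≤ u →
        E.Weak i k b ⟨some x, .right⟩ → (E.heap u x).key < userKey k →
        (E.heap u x).rem = false → (E.cfg u).shared.lock x = none →
        E.Std k u ⟨some x, .right⟩) ∧
      -- present reachability of a node for its own key
      (∀ (i : Tid) (a b k x u : ℕ), E.InSection i a b → b ≤ u →
        E.Weak i k b ⟨some x, .key⟩ → (E.heap u x).key = userKey k →
        (E.heap u x).rem = false → (E.cfg u).shared.lock x = none →
        E.Std k u ⟨some x, .key⟩) ∧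
      -- present reachability when an insertion or a deletion is about to change the tree
      (∀ (i : Tid) (u k d x n : ℕ), (E.cfg u).pc i = .insWriteLeft k d x n →
        E.Std k u ⟨some x, .key⟩ ∧ userKey k < (E.heap u x).key ∧ (E.heap u x).left = none) ∧
      (∀ (i : Tid) (u k d x n : ℕ), (E.cfg u).pc i = .insWriteRight k d x n →
        E.Std k u ⟨some x, .key⟩ ∧ (E.heap u x).key < userKey k ∧ (E.heap u x).right = none) ∧
      (∀ (i : Tid) (u k x y : ℕ), (E.cfg u).pc i = .delLeft k x y →
        E.Std k u ⟨some y, .key⟩ ∧ E.Std k u ⟨some x, .key⟩) ∧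
      -- linearizability, with the abstract map read off the tree
      (∀ N : ℕ, ∃ (L : List (ℕ × Op × Res)) (m : ℕ → Option ℕ),
        Linearization E N L m ∧ Represents (E.heap N) m) := by
  refine ⟨exists_incorrect, fun E => ⟨?_, ?_, ?_, ?_, ?_, ?_, ?_, ?_, ?_, ?_, ?_, ?_, ?_⟩⟩
  · intro i a b k H
    exact ⟨fun s h1 h2 => ⟨fun l => Execution.std_weak (H.mono h1 h2),
      Execution.weak_extend (H.mono h1 h2)⟩,
      fun s h1 h2 => ⟨Execution.strongForepassed H h1 h2, fun x => Execution.tag_forepassed H h1 h2⟩⟩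
  · intro i op a n l t T
    exact ⟨⟨fun j j' h h' => (T.strictMono j j' h h').le, fun j hj => Execution.locate_extend T hj⟩,
      fun base hb h => Execution.locate_correct T hb h⟩
  · intro i a b x H h
    exact Execution.ghost_gap H h
  · intro i a b k x H hx h
    exact Execution.weak_one_deviation H hx h
  · intro i a b k H
    exact ⟨Execution.weak_null H, fun x h hk => Execution.weak_own H h hk⟩
  · intro i op j u x tag y H h
    obtain ⟨-, ⟨a, b, h1, h2, h3, h4, h5⟩, h6⟩ := H.outcome h
    exact ⟨⟨a, b, h1, h2, h3, h4, h5⟩, h6⟩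
  · intro i a b k x v u H hu h1 h2 h3 h4 h5 h6
    exact Execution.present_left H hu h1 h2 h3 h4 h5 h6
  · intro i a b k x u H hu h1 h2 h3 _
    exact Execution.present_right H hu h1 h2 h3
  · intro i a b k x u _ hu h1 h2 h3 h4
    exact Execution.present_own hu h1 h2 h3 h4
  · intro i u k d x n h
    have H := (E.inv u).pc i
    rw [h] at H
    exact ⟨stdReach_iff.2 H.1.1, H.1.2.2.2.1, H.1.2.2.2.2⟩
  · intro i u k d x n h
    have H := (E.inv u).pc i
    rw [h] at H
    exact ⟨stdReach_iff.2 H.1.1.1, H.1.1.2.2.2, H.1.2⟩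
  · intro i u k x y h
    exact Execution.present_delete h
  · intro N
    obtain ⟨L, hL⟩ := E.linearizable N
    exact ⟨L, _, hL, Execution.represents_abs⟩
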